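/- Let $K$ be a field, and let $R\longrightarrow S$ be a degree-preserving inclusion of $\mathbb{N}$-graded normal rings that are finitely generated over $R_0=S_0=K$. Let $\mathfrak{m}_R$ be the homogeneous maximal ideal of $R$, let $d=\dim R$, and let $E_R$ be the injective hull of $R/\mathfrak{m}_R$ in the category of $\mathbb{Z}$-graded $R$-modules and degree-preserving $R$-linear maps (such a hull exists). Consider the following statements: 1. $R$ is a direct summand of $S$ as an $R$-module, i.e. the inclusion $R\longrightarrow S$ splits as a map of $R$-modules. 2. The map $R\longrightarrow S$ is pure, i.e. $R\otimes_R M\longrightarrow S\otimes_R M$ is injective for each $R$-module $M$. 3. The induced map $R\otimes_R E_R\longrightarrow S\otimes_R E_R$ is injective. 4. The local cohomology module $H^d_{\mathfrak{m}_R}(S)$ is nonzero. 5. The $R$-algebra $S$ is solid, i.e. $\operatorname{Hom}_R(S,R)\neq 0$. Then (1), (2) and (3) are equivalent, and they imply (4) and (5), which are equivalent to each other. If moreover $R$ is a polynomial ring over $K$ and $K$ has positive characteristic, then (1)–(5) are all equivalent. -/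

import Mathlib

open scoped TensorProduct

universe u

/-- A commutative ring is *normal* if its localization at every prime ideal is an integrally
closed domain. -/
def IsNormalRing (A : Type u) [CommRing A] : Prop :=
  ∀ (P : Ideal A) [P.IsPrime],
    IsDomain (Localization.AtPrime P) ∧ IsIntegrallyClosed (Localization.AtPrime P)

section GradedModules

variable {K R : Type u} [Field K] [CommRing R] [Algebra K R]

/-- `ℳ` is a `ℤ`-grading on the `R`-module `M`, compatible with the `ℕ`-grading `𝒜` of `R`:
`M = ⨁ ℳ j` and `𝒜 i • ℳ j ⊆ ℳ (i + j)`. -/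
structure IsModuleGrading (𝒜 : ℕ → Submodule K R) {M : Type u} [AddCommGroup M] [Module R M]
    (ℳ : ℤ → AddSubgroup M) : Prop where
  isInternal : DirectSum.IsInternal ℳ
  smul_mem : ∀ (i : ℕ) (j : ℤ) (r : R) (m : M), r ∈ 𝒜 i → m ∈ ℳ j → r • m ∈ ℳ ((i : ℤ) + j)

/-- An `R`-linear map of graded modules is a morphism of graded modules if it preserves degrees. -/
def IsGradedHom {M N : Type u} [AddCommGroup M] [Module R M] [AddCommGroup N] [Module R N]
    (ℳ : ℤ → AddSubgroup M) (𝒩 : ℤ → AddSubgroup N) (f : M →ₗ[R] N) : Prop :=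
  ∀ (j : ℤ) (m : M), m ∈ ℳ j → f m ∈ 𝒩 j

/-- `(E, ℰ)` is an injective object of the category of `ℤ`-graded `R`-modules and degree-preserving
`R`-linear maps. -/
def IsGradedInjective (𝒜 : ℕ → Submodule K R) {E : Type u} [AddCommGroup E] [Module R E]
    (ℰ : ℤ → AddSubgroup E) : Prop :=
  ∀ (M N : Type u) [AddCommGroup M] [Module R M] [AddCommGroup N] [Module R N]
    (ℳ : ℤ → AddSubgroup M) (𝒩 : ℤ → AddSubgroup N),
    IsModuleGrading 𝒜 ℳ → IsModuleGrading 𝒜 𝒩 →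
    ∀ (f : M →ₗ[R] N) (g : M →ₗ[R] E),
      IsGradedHom ℳ 𝒩 f → Function.Injective f → IsGradedHom ℳ ℰ g →
      ∃ h : N →ₗ[R] E, IsGradedHom 𝒩 ℰ h ∧ h ∘ₗ f = g

/-- A graded submodule: one generated by homogeneous elements. -/
def IsGradedSubmodule {E : Type u} [AddCommGroup E] [Module R E]
    (ℰ : ℤ → AddSubgroup E) (N : Submodule R E) : Prop :=
  ∃ s : Set E, (∀ x ∈ s, ∃ j, x ∈ ℰ j) ∧ Submodule.span R s = N

/-- The homogeneous maximal ideal `⨁_{i > 0} 𝒜 i` (when `𝒜 0` is a field). -/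
noncomputable def homogeneousMaximalIdeal (𝒜 : ℕ → Submodule K R) [GradedAlgebra 𝒜] : Ideal R :=
  (HomogeneousIdeal.irrelevant 𝒜).toIdeal

/-- `(E, ℰ)` is an injective hull of `R / 𝔪` in the category of `ℤ`-graded `R`-modules, where
`𝔪` is the homogeneous maximal ideal and `R / 𝔪` carries the grading induced by `R`: `E` is an
injective graded module with a degree-preserving embedding `R / 𝔪 → E` that is essential, i.e.
every nonzero graded submodule of `E` meets its image nontrivially. -/
structure IsGradedInjectiveHull (𝒜 : ℕ → Submodule K R) [GradedAlgebra 𝒜]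
    {E : Type u} [AddCommGroup E] [Module R E] (ℰ : ℤ → AddSubgroup E) : Prop where
  grading : IsModuleGrading 𝒜 ℰ
  injective : IsGradedInjective 𝒜 ℰ
  essential : ∃ ι : (R ⧸ homogeneousMaximalIdeal 𝒜) →ₗ[R] E,
    Function.Injective ι ∧
    (∀ (i : ℕ) (a : R), a ∈ 𝒜 i → ι (Ideal.Quotient.mk _ a) ∈ ℰ (i : ℤ)) ∧
    ∀ N : Submodule R E, IsGradedSubmodule ℰ N → N ≠ ⊥ → N ⊓ LinearMap.range ι ≠ ⊥

end GradedModules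

section Algebras

variable (R S : Type u) [CommRing R] [CommRing S] [Algebra R S]

/-- `R` is a direct summand of `S`: the structure map `R → S` splits as a map of `R`-modules. -/
def IsDirectSummandOf : Prop :=
  ∃ φ : S →ₗ[R] R, φ ∘ₗ Algebra.linearMap R S = LinearMap.id

/-- The map `R ⊗ M → S ⊗ M` induced by the structure map `R → S` is injective. -/
def InjectiveAfterTensor (M : Type u) [AddCommGroup M] [Module R M] : Prop :=
  Function.Injective (LinearMap.rTensor M (Algebra.linearMap R S) : R ⊗[R] M →ₗ[R] S ⊗[R] M)

/-- `R → S` is pure: `R ⊗ M → S ⊗ M` is injective for every `R`-module `M`. -/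
def IsPureMap : Prop :=
  ∀ (M : Type u) [AddCommGroup M] [Module R M], InjectiveAfterTensor R S M

/-- `S` is a solid `R`-algebra: `Hom_R(S, R) ≠ 0`. -/
def IsSolidAlgebra : Prop :=
  ∃ φ : S →ₗ[R] R, φ ≠ 0

/-- The `i`-th local cohomology module of the `R`-module `S` with support in `I` is nonzero. -/
def LocalCohomologyNonzero (I : Ideal R) (i : ℕ) : Prop :=
  Nontrivial ((localCohomology I i).obj (ModuleCat.of R S))

end Algebras

/-! Normality makes `R` and `S` domains: each embeds in its localization at the homogeneous maximal
ideal. The implications (1) ⇒ (2) ⇒ (3) are formal.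

For (3) ⇒ (1), the graded `K`-dual `GradedDual 𝒜` is a concrete hull of `R/𝔪`, whose socle is
spanned by a functional `ε` of degree 0 with `ε(1) = 1`. Injectivity of the given hull `E` yields a
map from the graded dual to `E` that sends `ε` to the image of `1 ∈ R/𝔪`, so (3) forces `1 ⊗ ε ≠ 0`
over `S`. Choose a `K`-functional `l` with `l (1 ⊗ ε) ≠ 0`. For `s` of degree `i`, `f ↦ l (s ⊗ f)`
is a functional on the dual of the finite-dimensional space `R_i`, hence evaluation at an element of
`R_i`. The resulting map `S → R` is `R`-linear and sends `1` to a nonzero scalar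
(`isDirectSummandOf_of_tmul_ne_zero`).

For (4) ⇔ (5), let `y` be a homogeneous system of parameters; `R` is finite over the polynomial ring
`A = K[y]`. The top local cohomology of `S` is the limit of the `S/(y^t)` along multiplication by
the product of the `y_j`, so it is nonzero iff some `s` satisfies `IsTopClass` (`exists_topClass`,
`nontrivial_top_localCohomology_iff`). If an `A`-linear `ψ : S → A` has `ψ s ≠ 0`, comparing
monomial exponents shows that `s` gives a nonzero class. Conversely a nonzero class in the Čech
quotient of `Frac S` is detected by a `K`-functional, and evaluating it on the fractions `s / ∏
y_j^(a_j+1)`, one homogeneous component of `s` at a time, gives the coefficients of an `A`-linear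
map `S → A` (`exists_linearMap_of_isTopClass`). `exists_linearMap_base` and
`exists_linearMap_extension` pass between `A` and `R`.

If `R` is a polynomial ring, homogeneous generators of `𝔪` identify it with `A`. In characteristic
`p`, a functional with `ψ 1 ≠ 0` and iterates of Frobenius show that `1/(y_1⋯y_d)` is a nonzero
class; the functional built from this class sends `1` to `1`.

The top local cohomology is computed from Ext by adjoining one element at a time. A `CyclicSystem`
with multiplier `z` models cohomology localized at `z`. Adding `y_k` replaces `z` by `z * y_k` one
degree lower, and the long exact sequence presents the new top group as a cokernel. -/

section

/-! ### Direct limits of Ext groups of cyclic modules. -/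

open CategoryTheory Abelian

/-- A system of cyclic modules `R ⧸ ideal t`, with the multiplications by powers of `mult` as
transition maps. -/
structure CyclicSystem (R : Type u) [CommRing R] where
  ideal : ℕ → Ideal R
  mult : R
  pow_mul_mem : ∀ {s t : ℕ}, s ≤ t → ∀ a ∈ ideal t, mult ^ (t - s) * a ∈ ideal s

namespace CyclicSystem

variable {R : Type u} [CommRing R]

/-- Multiplication by `r`, as a map `R ⧸ I ⟶ R ⧸ J`. -/
noncomputable def mulMap (I J : Ideal R) (r : R) (h : ∀ a ∈ I, r * a ∈ J) :
    ModuleCat.of R (R ⧸ I) ⟶ ModuleCat.of R (R ⧸ J) :=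
  ModuleCat.ofHom (Submodule.mapQ I J (LinearMap.lsmul R R r) h)

lemma mulMap_comp {I J K : Ideal R} {r s : R} (h : ∀ a ∈ I, r * a ∈ J) (h' : ∀ a ∈ J, s * a ∈ K)
    {q : R} (hq : s * r = q) :
    mulMap I J r h ≫ mulMap J K s h' =
      mulMap I K q (fun a ha => by rw [← hq, mul_assoc]; exact h' _ (h a ha)) := by
  subst hq
  refine ModuleCat.hom_ext (LinearMap.ext fun x => ?_)
  obtain ⟨a, rfl⟩ := Ideal.Quotient.mk_surjective x
  change Ideal.Quotient.mk K (s * (r * a)) = Ideal.Quotient.mk K (s * r * a)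
  rw [mul_assoc]

lemma mulMap_congr {I J : Ideal R} {r s : R} (h : ∀ a ∈ I, r * a ∈ J) (e : r = s) :
    mulMap I J r h = mulMap I J s (fun a ha => e ▸ h a ha) := by
  subst e; rfl

lemma mulMap_one (I : Ideal R) {r : R} (hr : r = 1) (h) : mulMap I I r h = 𝟙 _ := by
  subst hr
  refine ModuleCat.hom_ext (LinearMap.ext fun x => ?_)
  obtain ⟨a, rfl⟩ := Ideal.Quotient.mk_surjective x
  change Ideal.Quotient.mk I (1 * a) = Ideal.Quotient.mk I a
  rw [one_mul]

/-- The pullback of extension classes along a morphism in the first variable. -/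
noncomputable def pull {X Y : ModuleCat.{u} R} (f : X ⟶ Y) (M : ModuleCat.{u} R) (n : ℕ) :
    Ext Y M n →+ Ext X M n :=
  (Ext.mk₀ f).precomp M (zero_add n)

lemma pull_apply {X Y : ModuleCat.{u} R} (f : X ⟶ Y) (M : ModuleCat.{u} R) (n : ℕ)
    (x : Ext Y M n) : pull f M n x = (Ext.mk₀ f).comp x (zero_add n) := rfl

lemma pull_id {X : ModuleCat.{u} R} (M : ModuleCat.{u} R) (n : ℕ) (x : Ext X M n) :
    pull (𝟙 X) M n x = x := by
  rw [pull_apply, Ext.mk₀_id_comp]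

lemma pull_pull {X Y Z : ModuleCat.{u} R} (f : X ⟶ Y) (g : Y ⟶ Z) (M : ModuleCat.{u} R) (n : ℕ)
    (x : Ext Z M n) : pull f M n (pull g M n x) = pull (f ≫ g) M n x := by
  simp only [pull_apply, Ext.mk₀_comp_mk₀_assoc]

lemma pull_comp_eq {X Y Y' Z : ModuleCat.{u} R} {f : X ⟶ Y} {g : Y ⟶ Z} {f' : X ⟶ Y'}
    {g' : Y' ⟶ Z} (h : f ≫ g = f' ≫ g') (M : ModuleCat.{u} R) (n : ℕ) (x : Ext Z M n) :
    pull f M n (pull g M n x) = pull f' M n (pull g' M n x) := by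
  rw [pull_pull, pull_pull, h]

variable (X Y : CyclicSystem R) (M : ModuleCat.{u} R) (n : ℕ)

/-- The `t`-th module of the system. -/
abbrev obj (t : ℕ) : ModuleCat.{u} R := ModuleCat.of R (R ⧸ X.ideal t)

/-- The transition map of the system. -/
noncomputable def trans {s t : ℕ} (h : s ≤ t) : X.obj t ⟶ X.obj s :=
  mulMap _ _ (X.mult ^ (t - s)) (X.pow_mul_mem h)

/-- The `t`-th extension group. -/
abbrev extObj (t : ℕ) : Type u := Ext (X.obj t) M n

/-- The transition map between extension groups. -/
noncomputable def extTrans (s t : ℕ) (h : s ≤ t) : X.extObj M n s →+ X.extObj M n t :=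
  pull (X.trans h) M n

instance : DirectedSystem (X.extObj M n) (fun s t h => X.extTrans M n s t h) where
  map_self t x := by
    rw [extTrans, trans, mulMap_one _ (by simp), pull_id]
  map_map r s t h h' x := by
    rw [extTrans, extTrans, extTrans, pull_pull]
    refine congrArg (fun f => pull f M n x) ?_
    exact mulMap_comp _ _ (by rw [← pow_add]; congr 1; omega)

/-- The colimit of the groups `Ext (X.obj t) M n`. -/
def ExtColim : Type u :=
  AddCommGroup.DirectLimit (X.extObj M n) (X.extTrans M n)

noncomputable instance : AddCommGroup (X.ExtColim M n) :=
  AddCommGroup.DirectLimit.addCommGroup (X.extObj M n) (X.extTrans M n)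

/-- The canonical map to the colimit. -/
noncomputable def of (t : ℕ) : Ext (X.obj t) M n →+ X.ExtColim M n :=
  AddCommGroup.DirectLimit.of (X.extObj M n) (X.extTrans M n) t

variable {X M n}

lemma of_trans {s t : ℕ} (h : s ≤ t) (x : Ext (X.obj s) M n) :
    X.of M n t (pull (X.trans h) M n x) = X.of M n s x :=
  AddCommGroup.DirectLimit.of_f (G := X.extObj M n) (f := X.extTrans M n) h x

lemma exists_of (x : X.ExtColim M n) : ∃ t y, X.of M n t y = x :=
  AddCommGroup.DirectLimit.induction_on (G := X.extObj M n) (f := X.extTrans M n)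
    (C := fun x => ∃ t y, X.of M n t y = x) x fun t y => ⟨t, y, rfl⟩

lemma of_eq_zero_iff {t : ℕ} (x : Ext (X.obj t) M n) :
    X.of M n t x = 0 ↔ ∃ (t' : ℕ) (h : t ≤ t'), pull (X.trans h) M n x = 0 := by
  constructor
  · intro h
    exact AddCommGroup.DirectLimit.of.zero_exact (G := X.extObj M n) (f := X.extTrans M n) t x h
  · rintro ⟨t', h, hx⟩
    rw [← of_trans h, hx, map_zero]

variable (X M n) in
/-- A homomorphism out of the colimit. -/
noncomputable def lift {P : Type u} [AddCommGroup P] (g : ∀ t, Ext (X.obj t) M n →+ P)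
    (hg : ∀ {s t : ℕ} (h : s ≤ t) x, g t (pull (X.trans h) M n x) = g s x) :
    X.ExtColim M n →+ P :=
  AddCommGroup.DirectLimit.lift (X.extObj M n) (X.extTrans M n) P g fun _ _ h x => hg h x

lemma lift_of {P : Type u} [AddCommGroup P] (g : ∀ t, Ext (X.obj t) M n →+ P)
    (hg : ∀ {s t : ℕ} (h : s ≤ t) x, g t (pull (X.trans h) M n x) = g s x) (t : ℕ)
    (x : Ext (X.obj t) M n) : X.lift M n g hg (X.of M n t x) = g t x :=
  AddCommGroup.DirectLimit.lift_of (G := X.extObj M n) (f := X.extTrans M n) P g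
    (fun _ _ h x => hg h x) t x

lemma mulMap_trans {X Y : CyclicSystem R} {r : R} (h : X.mult = Y.mult * r)
    (hr : ∀ t, ∀ a ∈ X.ideal t, r ^ t * a ∈ Y.ideal t) {s t : ℕ} (hst : s ≤ t) :
    mulMap (X.ideal t) (Y.ideal t) (r ^ t) (hr t) ≫ Y.trans hst =
      X.trans hst ≫ mulMap (X.ideal s) (Y.ideal s) (r ^ s) (hr s) := by
  rw [trans, trans, mulMap_comp _ _ rfl, mulMap_comp _ _ rfl]
  refine mulMap_congr _ ?_
  rw [h, mul_pow, mul_left_comm, ← pow_add, Nat.add_sub_cancel' hst]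

variable (M n) in
/-- The map on colimits induced by the multiplications by `r ^ t`. -/
noncomputable def extMap {X Y : CyclicSystem R} (r : R) (h : X.mult = Y.mult * r)
    (hr : ∀ t, ∀ a ∈ X.ideal t, r ^ t * a ∈ Y.ideal t) : Y.ExtColim M n →+ X.ExtColim M n :=
  Y.lift M n
    (fun t => (X.of M n t).comp (pull (mulMap (X.ideal t) (Y.ideal t) (r ^ t) (hr t)) M n))
    (fun {s t} hst x => by
      rw [AddMonoidHom.comp_apply, AddMonoidHom.comp_apply, ← of_trans hst,
        pull_comp_eq (mulMap_trans h hr hst)])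

lemma extMap_of {X Y : CyclicSystem R} (r : R) (h : X.mult = Y.mult * r)
    (hr : ∀ t, ∀ a ∈ X.ideal t, r ^ t * a ∈ Y.ideal t) (t : ℕ) (x : Ext (Y.obj t) M n) :
    extMap M n r h hr (Y.of M n t x) =
      X.of M n t (pull (mulMap (X.ideal t) (Y.ideal t) (r ^ t) (hr t)) M n x) :=
  lift_of _ (fun hst x => by 
      rw [AddMonoidHom.comp_apply, AddMonoidHom.comp_apply, ← of_trans hst,
        pull_comp_eq (mulMap_trans h hr hst)]) _ _

variable (X)

/-- The same modules, with transition maps multiplied by `w`. -/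
def twist (w : R) : CyclicSystem R where
  ideal := X.ideal
  mult := X.mult * w
  pow_mul_mem h a ha := by
    rw [mul_pow, mul_right_comm, mul_comm]
    exact Ideal.mul_mem_left _ _ (X.pow_mul_mem h a ha)

/-- The system of the images of the multiplications by `y ^ t`. -/
def colon (y : R) : CyclicSystem R where
  ideal t := Submodule.comap (LinearMap.lsmul R R (y ^ t)) (X.ideal t)
  mult := X.mult * y
  pow_mul_mem {s t} h a ha := by
    have := X.pow_mul_mem h _ ha
    have e : y ^ s * ((X.mult * y) ^ (t - s) * a) = X.mult ^ (t - s) * (y ^ t * a) := by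
      obtain ⟨k, rfl⟩ := Nat.exists_eq_add_of_le h
      rw [Nat.add_sub_cancel_left]; ring
    simpa [e] using this

/-- The system of the cokernels of the multiplications by `y ^ t`. -/
def quot (y : R) : CyclicSystem R where
  ideal t := X.ideal t ⊔ Ideal.span {y ^ t}
  mult := X.mult
  pow_mul_mem {s t} h a ha := by
    obtain ⟨b, hb, c, hc, rfl⟩ := Submodule.mem_sup.1 ha
    rw [mul_add]
    refine Submodule.add_mem_sup (X.pow_mul_mem h b hb) (Ideal.mul_mem_left _ _ ?_)
    rw [Ideal.mem_span_singleton] at hc ⊢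
    exact (pow_dvd_pow y h).trans hc

variable {X} in
lemma mul_mem_of_mem_colon {y : R} {t : ℕ} : ∀ a ∈ (X.colon y).ideal t, y ^ t * a ∈ X.ideal t :=
  fun _ h => h

variable {X} in
lemma one_pow_mul_mem_quot {y : R} {t : ℕ} :
    ∀ a ∈ X.ideal t, 1 ^ t * a ∈ (X.quot y).ideal t :=
  fun a ha => by rw [one_pow, one_mul]; exact Submodule.mem_sup_left ha

/-- The exact sequence `0 → R ⧸ (I : yᵗ) → R ⧸ I → R ⧸ (I + (yᵗ)) → 0`. -/
noncomputable def shortComplex (y : R) (t : ℕ) : ShortComplex (ModuleCat.{u} R) :=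
  ShortComplex.mk
    (mulMap ((X.colon y).ideal t) (X.ideal t) (y ^ t) mul_mem_of_mem_colon)
    (mulMap (X.ideal t) ((X.quot y).ideal t) (1 ^ t) one_pow_mul_mem_quot)
    (by
      refine ModuleCat.hom_ext (LinearMap.ext fun x => ?_)
      obtain ⟨a, rfl⟩ := Ideal.Quotient.mk_surjective x
      change Ideal.Quotient.mk ((X.quot y).ideal t) (1 ^ t * (y ^ t * a)) = 0
      rw [Ideal.Quotient.eq_zero_iff_mem, one_pow, one_mul]
      exact Submodule.mem_sup_right
        (Ideal.mul_mem_right _ _ (Ideal.mem_span_singleton_self _)))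

lemma shortComplex_shortExact (y : R) (t : ℕ) : (X.shortComplex y t).ShortExact where
  exact := by
    rw [ShortComplex.moduleCat_exact_iff]
    intro x hx
    obtain ⟨a, rfl⟩ := Ideal.Quotient.mk_surjective x
    change Ideal.Quotient.mk ((X.quot y).ideal t) (1 ^ t * a) = 0 at hx
    rw [Ideal.Quotient.eq_zero_iff_mem, one_pow, one_mul] at hx
    obtain ⟨b, hb, c, hc, rfl⟩ := Submodule.mem_sup.1 hx
    obtain ⟨e, rfl⟩ := Ideal.mem_span_singleton'.1 hc
    refine ⟨Ideal.Quotient.mk _ e, ?_⟩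
    change Ideal.Quotient.mk (X.ideal t) (y ^ t * e) = _
    rw [Ideal.Quotient.eq]
    have : y ^ t * e - (b + e * y ^ t) = - b := by ring
    rw [this]
    exact neg_mem hb
  mono_f := by
    rw [ModuleCat.mono_iff_injective, injective_iff_map_eq_zero]
    intro x hx
    obtain ⟨a, rfl⟩ := Ideal.Quotient.mk_surjective x
    change Ideal.Quotient.mk (X.ideal t) (y ^ t * a) = 0 at hx
    rw [Ideal.Quotient.eq_zero_iff_mem] at hx
    exact Ideal.Quotient.eq_zero_iff_mem.2 hx
  epi_g := by
    rw [ModuleCat.epi_iff_surjective]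
    intro x
    obtain ⟨a, rfl⟩ := Ideal.Quotient.mk_surjective x
    refine ⟨Ideal.Quotient.mk _ a, ?_⟩
    change Ideal.Quotient.mk ((X.quot y).ideal t) (1 ^ t * a) = _
    rw [one_pow, one_mul]

/-- Compatible multiplications give a morphism between the exact sequences. -/
noncomputable def shortComplexMap {X Y : CyclicSystem R} (y : R) {s t : ℕ} (q r : R)
    (e : y ^ s * r = q * y ^ t) (h : ∀ a ∈ X.ideal t, q * a ∈ Y.ideal s)
    (h₁ : ∀ a ∈ (X.colon y).ideal t, r * a ∈ (Y.colon y).ideal s)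
    (h₃ : ∀ a ∈ (X.quot y).ideal t, q * a ∈ (Y.quot y).ideal s) :
    X.shortComplex y t ⟶ Y.shortComplex y s where
  τ₁ := mulMap _ _ r h₁
  τ₂ := mulMap _ _ q h
  τ₃ := mulMap _ _ q h₃
  comm₁₂ := by
    dsimp only [shortComplex]
    rw [mulMap_comp _ _ rfl, mulMap_comp _ _ rfl]
    exact mulMap_congr _ e
  comm₂₃ := by
    dsimp only [shortComplex]
    rw [mulMap_comp _ _ rfl, mulMap_comp _ _ rfl]
    exact mulMap_congr _ (by ring)

variable (M n)

/-- The connecting homomorphism at level `t`. -/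
noncomputable def deltaAt (y : R) (t : ℕ) :
    Ext ((X.colon y).obj t) M n →+ Ext ((X.quot y).obj t) M (n + 1) :=
  (X.shortComplex_shortExact y t).extClass.precomp M (add_comm 1 n)

variable {X M n}

/-- The connecting map is composition with the extension class, so its naturality is that of the
class together with associativity of the Yoneda product. -/
lemma extClass_comp_pull {S₁ S₂ : ShortComplex (ModuleCat.{u} R)} (h₁ : S₁.ShortExact)
    (h₂ : S₂.ShortExact) (f : S₁ ⟶ S₂) (x : Ext S₂.X₁ M n) :
    h₁.extClass.comp ((Ext.mk₀ f.τ₁).comp x (zero_add n)) (add_comm 1 n) =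
      (Ext.mk₀ f.τ₃).comp (h₂.extClass.comp x (add_comm 1 n)) (zero_add (n + 1)) := by
  rw [← Ext.comp_assoc (a₁₂ := 1) _ _ _ (by omega) (by omega) (by omega),
    ← Ext.comp_assoc (a₁₂ := 1) _ _ _ (by omega) (by omega) (by omega),
    ShortComplex.ShortExact.extClass_naturality h₁ h₂ f]

lemma deltaAt_naturality {X Y : CyclicSystem R} (y : R) {s t : ℕ} (q r : R)
    (e : y ^ s * r = q * y ^ t) (h : ∀ a ∈ X.ideal t, q * a ∈ Y.ideal s)
    (h₁ : ∀ a ∈ (X.colon y).ideal t, r * a ∈ (Y.colon y).ideal s)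
    (h₃ : ∀ a ∈ (X.quot y).ideal t, q * a ∈ (Y.quot y).ideal s) (x : Ext ((Y.colon y).obj s) M n) :
    X.deltaAt M n y t (pull (mulMap _ _ r h₁) M n x) =
      pull (mulMap _ _ q h₃) M (n + 1) (Y.deltaAt M n y s x) := by
  exact extClass_comp_pull (X.shortComplex_shortExact y t) (Y.shortComplex_shortExact y s)
    (shortComplexMap y q r e h h₁ h₃) x

lemma deltaAt_pull_eq_zero (y : R) (t : ℕ) (x : Ext (X.obj t) M n) :
    X.deltaAt M n y t (pull (mulMap _ _ (y ^ t) mul_mem_of_mem_colon) M n x) = 0 :=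
  ShortComplex.ShortExact.extClass_comp_assoc (X.shortComplex_shortExact y t) x
    (h := add_comm 1 n)

lemma exists_pull_of_deltaAt_eq_zero (y : R) (t : ℕ) (x : Ext ((X.colon y).obj t) M n)
    (hx : X.deltaAt M n y t x = 0) :
    ∃ x' : Ext (X.obj t) M n, pull (mulMap _ _ (y ^ t) mul_mem_of_mem_colon) M n x' = x :=
  Ext.contravariant_sequence_exact₁ (X.shortComplex_shortExact y t) M x (add_comm 1 n) hx

lemma exists_deltaAt_of_pull_eq_zero (y : R) (t : ℕ) (x : Ext ((X.quot y).obj t) M (n + 1))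
    (hx : pull (mulMap _ _ (1 ^ t) (one_pow_mul_mem_quot (X := X))) M (n + 1) x = 0) :
    ∃ x', X.deltaAt M n y t x' = x :=
  Ext.contravariant_sequence_exact₃ (X.shortComplex_shortExact y t) M x hx (add_comm 1 n)

lemma deltaAt_trans (y : R) {s t : ℕ} (hst : s ≤ t) (x : Ext ((X.colon y).obj s) M n) :
    X.deltaAt M n y t (pull ((X.colon y).trans hst) M n x) =
      pull ((X.quot y).trans hst) M (n + 1) (X.deltaAt M n y s x) := by
  refine deltaAt_naturality y _ _ ?_ (X.pow_mul_mem hst) _ _ x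
  change y ^ s * (X.mult * y) ^ (t - s) = X.mult ^ (t - s) * y ^ t
  rw [mul_pow, mul_left_comm, ← pow_add, Nat.add_sub_cancel' hst]

variable (X M n) in
/-- The connecting homomorphism in the colimit. -/
noncomputable def delta (y : R) : (X.colon y).ExtColim M n →+ (X.quot y).ExtColim M (n + 1) :=
  (X.colon y).lift M n (fun t => ((X.quot y).of M (n + 1) t).comp (X.deltaAt M n y t))
    (fun hst x => by
      rw [AddMonoidHom.comp_apply, AddMonoidHom.comp_apply, deltaAt_trans, of_trans])

lemma delta_of (y : R) (t : ℕ) (x : Ext ((X.colon y).obj t) M n) :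
    X.delta M n y ((X.colon y).of M n t x) = (X.quot y).of M (n + 1) t (X.deltaAt M n y t x) :=
  lift_of _ (fun hst x => by 
      rw [AddMonoidHom.comp_apply, AddMonoidHom.comp_apply, deltaAt_trans, of_trans]) _ _

lemma delta_extMap {X Y : CyclicSystem R} (y w : R) (_ : X.mult = Y.mult * w)
    (hw : ∀ t, ∀ a ∈ X.ideal t, w ^ t * a ∈ Y.ideal t)
    (h' : (X.colon y).mult = (Y.colon y).mult * w)
    (hw' : ∀ t, ∀ a ∈ (X.colon y).ideal t, w ^ t * a ∈ (Y.colon y).ideal t)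
    (h'' : (X.quot y).mult = (Y.quot y).mult * w)
    (hw'' : ∀ t, ∀ a ∈ (X.quot y).ideal t, w ^ t * a ∈ (Y.quot y).ideal t)
    (x : (Y.colon y).ExtColim M n) :
    X.delta M n y (extMap M n w h' hw' x) = extMap M (n + 1) w h'' hw'' (Y.delta M n y x) := by
  obtain ⟨t, x, rfl⟩ := exists_of x
  rw [extMap_of, delta_of, delta_of, extMap_of]
  congr 1
  exact deltaAt_naturality y _ _ (mul_comm _ _) (hw t) _ _ x

lemma delta_extMap_eq_zero (y : R) (h hr) (x : X.ExtColim M n) :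
    X.delta M n y (extMap (X := X.colon y) (Y := X) M n y h hr x) = 0 := by
  obtain ⟨t, x, rfl⟩ := exists_of x
  rw [extMap_of, delta_of, deltaAt_pull_eq_zero, map_zero]

/-- Exactness at a finite level suffices: a class killed in the limit is already killed at some
later level, where the long exact Ext sequence applies. -/
lemma exists_extMap_of_delta_eq_zero (y : R) (h hr) (x : (X.colon y).ExtColim M n)
    (hx : X.delta M n y x = 0) :
    ∃ x', extMap (X := X.colon y) (Y := X) M n y h hr x' = x := by
  obtain ⟨s, x, rfl⟩ := exists_of x
  rw [delta_of, of_eq_zero_iff] at hx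
  obtain ⟨t, hst, hx⟩ := hx
  have key : X.deltaAt M n y t (pull ((X.colon y).trans hst) M n x) = 0 := by
    rw [deltaAt_trans, hx]
  obtain ⟨x', hx'⟩ := exists_pull_of_deltaAt_eq_zero y t _ key
  refine ⟨X.of M n t x', ?_⟩
  rw [extMap_of, ← of_trans hst, ← hx']

lemma exists_delta_of_extMap_eq_zero (y : R) (h hr) (x : (X.quot y).ExtColim M (n + 1))
    (hx : extMap (X := X) (Y := X.quot y) M (n + 1) 1 h hr x = 0) :
    ∃ x', X.delta M n y x' = x := by
  obtain ⟨s, x, rfl⟩ := exists_of x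
  rw [extMap_of, of_eq_zero_iff] at hx
  obtain ⟨t, hst, hx⟩ := hx
  have key : pull (mulMap _ _ (1 ^ t) (one_pow_mul_mem_quot (X := X))) M (n + 1)
      (pull ((X.quot y).trans hst) M (n + 1) x) = 0 := by
    rw [← hx]
    exact pull_comp_eq (mulMap_trans h hr hst) M (n + 1) x
  obtain ⟨x', hx'⟩ := exists_deltaAt_of_pull_eq_zero y t _ key
  refine ⟨(X.colon y).of M n t x', ?_⟩
  rw [delta_of, ← of_trans hst, ← hx']

/-- Systems whose modules are related by maps in both directions have the same colimit. -/
lemma extMap_one_bijective {X Y : CyclicSystem R} (h : X.mult = Y.mult * 1)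
    (hr : ∀ t, ∀ a ∈ X.ideal t, 1 ^ t * a ∈ Y.ideal t)
    (H : ∀ s, ∃ t, s ≤ t ∧ ∀ a ∈ Y.ideal t, X.mult ^ (t - s) * a ∈ X.ideal s) :
    Function.Bijective (extMap M n 1 h hr) := by
  have hm : X.mult = Y.mult := by rw [h, mul_one]
  constructor
  · rw [injective_iff_map_eq_zero]
    intro x hx
    obtain ⟨r, x, rfl⟩ := exists_of x
    rw [extMap_of, of_eq_zero_iff] at hx
    obtain ⟨s, hrs, hx⟩ := hx
    obtain ⟨t, hst, ht⟩ := H s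
    rw [of_eq_zero_iff]
    refine ⟨t, hrs.trans hst, ?_⟩
    have := congrArg (pull (mulMap _ _ _ ht) M n) hx
    rw [map_zero, pull_pull, pull_pull, trans, mulMap_comp _ _ rfl, mulMap_comp _ _ rfl] at this
    rw [← this, trans]
    refine congrArg (fun f => pull f M n x) (mulMap_congr _ ?_)
    rw [one_pow, one_mul, hm, ← pow_add]
    congr 1; omega
  · intro x
    obtain ⟨s, x, rfl⟩ := exists_of x
    obtain ⟨t, hst, ht⟩ := H s
    refine ⟨Y.of M n t (pull (mulMap _ _ _ ht) M n x), ?_⟩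
    rw [extMap_of, ← of_trans hst, pull_pull, mulMap_comp _ _ rfl]
    refine congrArg (fun f => X.of M n t (pull f M n x)) (mulMap_congr _ ?_)
    rw [one_pow, mul_one]

/-- For a Noetherian ring, the kernels of the multiplications `yᵗ` form a pro-zero system. -/
lemma exists_colon_le [IsNoetherianRing R] (X : CyclicSystem R) (y : R) (s : ℕ) :
    ∃ t, s ≤ t ∧ ∀ a ∈ (X.colon y).ideal t, (X.twist y).mult ^ (t - s) * a ∈
      (X.twist y).ideal s := by
  -- The ascending chain of colon ideals `(I_s : y^m)` stabilizes at some `m`, and then `t = s + m`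
  -- works: one may trade `y^(s+m)` for `y^m`.
  let f : ℕ →o Submodule R R :=
    { toFun := fun m => Submodule.comap (LinearMap.lsmul R R (y ^ m)) (X.ideal s)
      monotone' := by
        intro m m' h a ha
        obtain ⟨k, rfl⟩ := Nat.exists_eq_add_of_le h
        simp only [Submodule.mem_comap, LinearMap.lsmul_apply, smul_eq_mul] at ha ⊢
        rw [pow_add, mul_comm (y ^ m), mul_assoc]
        exact Ideal.mul_mem_left _ _ ha }
  obtain ⟨m, hm⟩ := monotone_stabilizes_iff_noetherian.2 ‹IsNoetherian R R› f
  refine ⟨s + m, by omega, fun a ha => ?_⟩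
  have h1 := X.pow_mul_mem (by omega : s ≤ s + m) _ ha
  rw [Nat.add_sub_cancel_left] at h1 ⊢
  have h2 : X.mult ^ m * a ∈ f (s + m) := by
    change y ^ (s + m) * (X.mult ^ m * a) ∈ X.ideal s
    rw [mul_left_comm]; exact h1
  rw [← hm _ (by omega)] at h2
  change (X.mult * y) ^ m * a ∈ X.ideal s
  rw [mul_pow, mul_comm (X.mult ^ m), mul_assoc]
  exact h2

end CyclicSystem

end

/-! ### The connecting homomorphism on the limit, and localization at one element. -/

section

open CategoryTheory Abelian

namespace CyclicSystem

variable {R : Type u} [CommRing R] {X Y Z : CyclicSystem R} {M : ModuleCat.{u} R} {n : ℕ}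

lemma extMap_extMap {r s q : R} (h : X.mult = Y.mult * r) (hr : ∀ t, ∀ a ∈ X.ideal t, r ^ t * a ∈ Y.ideal t)
    (h' : Y.mult = Z.mult * s) (hs : ∀ t, ∀ a ∈ Y.ideal t, s ^ t * a ∈ Z.ideal t)
    (h'' : X.mult = Z.mult * q) (hq : ∀ t, ∀ a ∈ X.ideal t, q ^ t * a ∈ Z.ideal t)
    (e : s * r = q) (x : Z.ExtColim M n) :
    extMap M n r h hr (extMap M n s h' hs x) = extMap M n q h'' hq x := by
  obtain ⟨t, x, rfl⟩ := exists_of x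
  rw [extMap_of, extMap_of, extMap_of, pull_pull, mulMap_comp _ _ (q := q ^ t) (by rw [← e, mul_pow])]

lemma twist_mult (y : R) : (X.twist y).mult = X.mult * y := rfl

lemma colon_mult (y : R) : (X.colon y).mult = X.mult * y := rfl

lemma twist_mult_eq (y : R) : (X.twist y).mult = (X.colon y).mult * 1 := (mul_one _).symm

lemma one_pow_mul_mem_colon (y : R) (t : ℕ) :
    ∀ a ∈ (X.twist y).ideal t, 1 ^ t * a ∈ (X.colon y).ideal t := fun a ha => by
  rw [one_pow, one_mul]
  exact Ideal.mul_mem_left (X.ideal t) _ ha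

variable [IsNoetherianRing R]

variable (X M n) in
/-- The colimits of the systems `X.twist y` and `X.colon y` agree. -/
noncomputable def twistEquiv (y : R) : (X.colon y).ExtColim M n ≃+ (X.twist y).ExtColim M n :=
  AddEquiv.ofBijective
    (extMap M n 1 (twist_mult_eq y) (one_pow_mul_mem_colon y))
    (extMap_one_bijective _ _ (X.exists_colon_le y))

lemma twistEquiv_apply (y : R) (x : (X.colon y).ExtColim M n) :
    X.twistEquiv M n y x = extMap M n 1 (twist_mult_eq y) (one_pow_mul_mem_colon y) x := rfl

variable (X M n) in
/-- The connecting homomorphism, in terms of the twisted system. -/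
noncomputable def connecting (y : R) : (X.twist y).ExtColim M n →+ (X.quot y).ExtColim M (n + 1) :=
  (X.delta M n y).comp (X.twistEquiv M n y).symm.toAddMonoidHom

lemma connecting_twistEquiv (y : R) (x : (X.colon y).ExtColim M n) :
    X.connecting M n y (X.twistEquiv M n y x) = X.delta M n y x := by
  change X.delta M n y ((X.twistEquiv M n y).symm _) = _
  rw [AddEquiv.symm_apply_apply]

/-- Exactness in the limit. Under `twistEquiv` the map induced by `R/(I : y^t) → R/I` becomes the
one from multiplier `X.mult` to multiplier `X.mult * y`, that is, a localization map. -/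
lemma connecting_eq_zero_iff (y : R) (hr) (x : (X.twist y).ExtColim M n) :
    X.connecting M n y x = 0 ↔ ∃ x', extMap (X := X.twist y) (Y := X) M n y (twist_mult y) hr x' = x := by
  obtain ⟨x, rfl⟩ := (X.twistEquiv M n y).surjective x
  rw [connecting_twistEquiv]
  have hc : ∀ x', extMap (X := X.twist y) (Y := X) M n y (twist_mult y) hr x' =
      X.twistEquiv M n y (extMap (X := X.colon y) (Y := X) M n y (colon_mult y)
        (fun t => mul_mem_of_mem_colon) x') := fun x' => by
    rw [twistEquiv_apply, extMap_extMap (q := y)]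
    rw [mul_one]
  constructor
  · intro h
    obtain ⟨x', rfl⟩ := exists_extMap_of_delta_eq_zero y (colon_mult y) (fun t => mul_mem_of_mem_colon) x h
    exact ⟨x', hc x'⟩
  · rintro ⟨x', hx'⟩
    rw [hc] at hx'
    rw [← (X.twistEquiv M n y).injective hx', delta_extMap_eq_zero]

/-- The next term of the long exact sequence is the limit for `X` itself in degree `n + 1`. -/
lemma connecting_surjective (y : R) (H : ∀ x : X.ExtColim M (n + 1), x = 0) :
    Function.Surjective (X.connecting M n y) := by
  intro x
  obtain ⟨x', rfl⟩ := exists_delta_of_extMap_eq_zero y (mul_one _).symm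
    (fun t => one_pow_mul_mem_quot) x (H _)
  exact ⟨_, connecting_twistEquiv y x'⟩

lemma connecting_extMap (y w : R) (h : X.mult = Y.mult * w)
    (hw : ∀ t, ∀ a ∈ X.ideal t, w ^ t * a ∈ Y.ideal t)
    (h' : (X.twist y).mult = (Y.twist y).mult * w)
    (hw' : ∀ t, ∀ a ∈ (X.twist y).ideal t, w ^ t * a ∈ (Y.twist y).ideal t)
    (h'' : (X.quot y).mult = (Y.quot y).mult * w)
    (hw'' : ∀ t, ∀ a ∈ (X.quot y).ideal t, w ^ t * a ∈ (Y.quot y).ideal t)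
    (x : (Y.twist y).ExtColim M n) :
    X.connecting M n y (extMap M n w h' hw' x) =
      extMap M (n + 1) w h'' hw'' (Y.connecting M n y x) := by
  obtain ⟨x, rfl⟩ := (Y.twistEquiv M n y).surjective x
  have hm : ∀ t, ∀ a ∈ (X.colon y).ideal t, w ^ t * a ∈ (Y.colon y).ideal t := fun t a ha => by
    change y ^ t * (w ^ t * a) ∈ Y.ideal t
    rw [mul_left_comm]
    exact hw t _ ha
  have hl : (X.colon y).mult = (Y.colon y).mult * w := by
    change X.mult * y = Y.mult * y * w
    rw [h, mul_right_comm]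
  have : extMap M n w h' hw' (Y.twistEquiv M n y x) =
      X.twistEquiv M n y (extMap M n w hl hm x) := by
    rw [twistEquiv_apply, twistEquiv_apply]
    rw [extMap_extMap (q := w) _ _ _ _ (by rw [h', twist_mult_eq, mul_one])
      (fun t a ha => by
        have := hm t a (by simpa using one_pow_mul_mem_colon y t a ha); exact this) (one_mul w),
      extMap_extMap (q := w) _ _ _ _ _ _ (mul_one w)]
  rw [this, connecting_twistEquiv, connecting_twistEquiv, delta_extMap y w h hw]

end CyclicSystem

/-! ### The limit of Ext for the powers of a sequence of elements. -/

section PowIdeal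

variable {R : Type u} [CommRing R] (y : ℕ → R)

/-- The ideal generated by `y 0 ^ t, …, y (k - 1) ^ t`. -/
def powIdeal : ℕ → ℕ → Ideal R
  | 0, _ => ⊥
  | k + 1, t => powIdeal k t ⊔ Ideal.span {y k ^ t}

lemma powIdeal_eq_span (k t : ℕ) :
    powIdeal y k t = Ideal.span ((fun j => y j ^ t) '' Set.Iio k) := by
  induction k with
  | zero => simp [powIdeal]
  | succ k ih =>
    rw [powIdeal, ih, ← Ideal.span_union]
    congr 1
    ext a
    simp only [Set.mem_union, Set.mem_image, Set.mem_Iio, Set.mem_singleton_iff,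
      Nat.lt_succ_iff_lt_or_eq]
    constructor
    · rintro (⟨j, hj, rfl⟩ | rfl)
      · exact ⟨j, Or.inl hj, rfl⟩
      · exact ⟨k, Or.inr rfl, rfl⟩
    · rintro ⟨j, hj | rfl, rfl⟩
      · exact Or.inl ⟨j, hj, rfl⟩
      · exact Or.inr rfl

lemma powIdeal_antitone (k : ℕ) : Antitone (powIdeal y k) := by
  intro s t h
  induction k with
  | zero => exact le_rfl
  | succ k ih =>
    refine sup_le_sup ih ?_
    rw [Ideal.span_singleton_le_span_singleton]
    exact pow_dvd_pow _ h

/-- The system of the quotients by powers of `y 0, …, y (k - 1)`. -/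
def powSystem (k : ℕ) (z : R) : CyclicSystem R where
  ideal := powIdeal y k
  mult := z
  pow_mul_mem h _ ha := Ideal.mul_mem_left _ _ (powIdeal_antitone y k h ha)

variable (M : ModuleCat.{u} R)

open CyclicSystem

variable {M} in
lemma pow_mul_mem_powIdeal {k : ℕ} (w : R) (t : ℕ) :
    ∀ a ∈ powIdeal y k t, w ^ t * a ∈ powIdeal y k t :=
  fun _ ha => Ideal.mul_mem_left _ _ ha

variable {y} in
/-- The map between the colimits for different multipliers. -/
noncomputable def powMap (k n : ℕ) {z v : R} (w : R) (h : v = z * w) :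
    (powSystem y k z).ExtColim M n →+ (powSystem y k v).ExtColim M n :=
  extMap (X := powSystem y k v) (Y := powSystem y k z) M n w h (pow_mul_mem_powIdeal y w)

variable [IsNoetherianRing R]

/-- The connecting homomorphism that adds the element `y k`. -/
noncomputable def powConnecting (k n : ℕ) (z : R) :
    (powSystem y k (z * y k)).ExtColim M n →+ (powSystem y (k + 1) z).ExtColim M (n + 1) :=
  (powSystem y k z).connecting M n (y k)

variable {y M}

lemma powConnecting_eq_zero_iff {k n : ℕ} {z : R} (x : (powSystem y k (z * y k)).ExtColim M n) :
    powConnecting y M k n z x = 0 ↔ ∃ x', powMap M k n (y k) (rfl : z * y k = z * y k) x' = x :=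
  connecting_eq_zero_iff (X := powSystem y k z) (y k) (pow_mul_mem_powIdeal y (y k)) x

lemma powConnecting_surjective {k n : ℕ} {z : R}
    (H : ∀ x : (powSystem y k z).ExtColim M (n + 1), x = 0) :
    Function.Surjective (powConnecting y M k n z) :=
  connecting_surjective (X := powSystem y k z) (y k) H

lemma powMap_powConnecting {k n : ℕ} {z v w : R} (h : v = z * w) (h' : v * y k = z * y k * w)
    (x : (powSystem y k (z * y k)).ExtColim M n) :
    powMap M (k + 1) (n + 1) w h (powConnecting y M k n z x) =
      powConnecting y M k n v (powMap M k n w h' x) :=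
  (connecting_extMap (X := powSystem y k v) (Y := powSystem y k z) (y k) w h
    (pow_mul_mem_powIdeal y w) h' (pow_mul_mem_powIdeal y w) h
    (pow_mul_mem_powIdeal (k := k + 1) y w) x).symm

variable (M) in
/-- The homomorphism from the cyclic module `R ⧸ ⊥` determined by an element. -/
noncomputable def botHom (m : M) : ModuleCat.of R (R ⧸ (⊥ : Ideal R)) ⟶ M :=
  ModuleCat.ofHom (Submodule.liftQ ⊥ (LinearMap.toSpanSingleton R M m) bot_le)

omit [IsNoetherianRing R] in
lemma botHom_ext {f g : ModuleCat.of R (R ⧸ (⊥ : Ideal R)) ⟶ M}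
    (h : f.hom (Ideal.Quotient.mk ⊥ 1) = g.hom (Ideal.Quotient.mk ⊥ 1)) : f = g := by
  refine ModuleCat.hom_ext (LinearMap.ext fun x => ?_)
  obtain ⟨a, rfl⟩ := Ideal.Quotient.mk_surjective x
  have : Ideal.Quotient.mk (⊥ : Ideal R) a = a • Ideal.Quotient.mk ⊥ 1 := by
    rw [← mul_one a]; simp [Algebra.smul_def]
  rw [this]
  exact (f.hom.map_smul a _).trans ((congrArg _ h).trans (g.hom.map_smul a _).symm)

omit [IsNoetherianRing R] in
lemma mulMap_botHom (m : M) (r : R) (h) :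
    mulMap ⊥ ⊥ r h ≫ botHom M m = botHom M (r • m) := by
  refine botHom_ext ?_
  change (r * 1) • m = (1 : R) • r • m
  rw [mul_one, one_smul]

omit [IsNoetherianRing R] in
lemma botHom_add (m m' : M) : botHom M (m + m') = botHom M m + botHom M m' := by
  refine botHom_ext ?_
  change (1 : R) • (m + m') = (1 : R) • m + (1 : R) • m'
  rw [smul_add]

omit [IsNoetherianRing R] in
lemma botHom_eq_zero_iff (m : M) : botHom M m = 0 ↔ m = 0 := by
  constructor
  · intro h
    have := congrArg (fun f => f.hom (Ideal.Quotient.mk ⊥ 1)) h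
    simpa using (one_smul R m).symm.trans this
  · rintro rfl
    refine botHom_ext ?_
    change (1 : R) • (0 : M) = 0
    rw [smul_zero]

variable (M) in
/-- The homomorphisms from the cyclic module `R ⧸ ⊥`, as extension classes of degree `0`. -/
noncomputable def botExt : M →+ Ext (ModuleCat.of R (R ⧸ (⊥ : Ideal R))) M 0 where
  toFun m := Ext.mk₀ (botHom M m)
  map_zero' := by rw [(botHom_eq_zero_iff (0 : M)).2 rfl, Ext.mk₀_zero]
  map_add' m m' := by rw [botHom_add, Ext.mk₀_add]

/-- The colimits for the empty family. -/
noncomputable def botClass (z : R) (t : ℕ) : M →+ (powSystem y 0 z).ExtColim M 0 :=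
  ((powSystem y 0 z).of M 0 t).comp (botExt M)

omit [IsNoetherianRing R] in
lemma pull_mk₀_botHom (m : M) (r : R) (h) :
    pull (mulMap ⊥ ⊥ r h) M 0 (Ext.mk₀ (botHom M m)) = Ext.mk₀ (botHom M (r • m)) := by
  rw [pull_apply, Ext.mk₀_comp_mk₀, mulMap_botHom]

omit [IsNoetherianRing R] in
lemma botClass_eq_zero_iff (z : R) (t : ℕ) (m : M) :
    botClass (y := y) z t m = 0 ↔ ∃ n, z ^ n • m = 0 := by
  have key : ∀ (t' : ℕ) (h : t ≤ t'),
      pull ((powSystem y 0 z).trans h) M 0 (Ext.mk₀ (botHom M m)) = 0 ↔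
        z ^ (t' - t) • m = 0 := by
    intro t' h
    rw [← botHom_eq_zero_iff, ← Ext.mk₀_eq_zero_iff]
    exact Iff.of_eq (congrArg (· = 0) (pull_mk₀_botHom m _ _))
  refine (of_eq_zero_iff (X := powSystem y 0 z) (Ext.mk₀ (botHom M m))).trans ?_
  constructor
  · rintro ⟨t', h, h'⟩
    exact ⟨_, (key t' h).1 h'⟩
  · rintro ⟨n, hn⟩
    exact ⟨t + n, Nat.le_add_right _ _, (key _ _).2 (by rwa [Nat.add_sub_cancel_left])⟩

omit [IsNoetherianRing R] in
lemma botClass_add (z : R) (t n : ℕ) (m : M) :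
    botClass (y := y) z (t + n) (z ^ n • m) = botClass (y := y) z t m := by
  refine Eq.trans ?_ (of_trans (X := powSystem y 0 z) (Nat.le_add_right t n)
    (Ext.mk₀ (botHom M m)))
  refine congrArg ((powSystem y 0 z).of M 0 (t + n)) ?_
  refine Eq.trans ?_ (pull_mk₀_botHom m (z ^ (t + n - t)) _).symm
  change botExt M _ = botExt M _
  rw [Nat.add_sub_cancel_left]

omit [IsNoetherianRing R] in
lemma powMap_botClass {z v w : R} (h : v = z * w) (t : ℕ) (m : M) :
    powMap M 0 0 w h (botClass (y := y) z t m) = botClass (y := y) v t (w ^ t • m) := by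
  refine (extMap_of (X := powSystem y 0 v) (Y := powSystem y 0 z) w h
    (pow_mul_mem_powIdeal y w) t (Ext.mk₀ (botHom M m))).trans ?_
  exact congrArg ((powSystem y 0 v).of M 0 t) (pull_mk₀_botHom m _ _)

omit [IsNoetherianRing R] in
lemma exists_botClass (z : R) (x : (powSystem y 0 z).ExtColim M 0) :
    ∃ t m, botClass (y := y) z t m = x := by
  obtain ⟨t, x, rfl⟩ := exists_of x
  obtain ⟨f, rfl⟩ := (Ext.mk₀_bijective _ _).2 x
  refine ⟨t, f.hom (Ideal.Quotient.mk _ 1), ?_⟩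
  refine congrArg ((powSystem y 0 z).of M 0 t) (congrArg Ext.mk₀ ?_)
  refine botHom_ext ?_
  exact one_smul R (f.hom (Ideal.Quotient.mk ⊥ 1))

omit [IsNoetherianRing R] in
lemma extColim_bot_eq_zero (z : R) (n : ℕ) (x : (powSystem y 0 z).ExtColim M (n + 1)) : x = 0 := by
  obtain ⟨t, x, rfl⟩ := exists_of x
  have : Projective ((powSystem y 0 z).obj t) := by
    rw [← IsProjective.iff_projective]
    exact Module.Projective.of_equiv
      (Submodule.quotEquivOfEqBot (⊥ : Ideal R) rfl).symm
  rw [Ext.eq_zero_of_projective x, map_zero]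

/-- Without elements the modules are free, so higher Ext vanishes. Each further element raises the
cohomological bound by one, because the connecting map from degree `n - 1` is onto. -/
lemma extColim_eq_zero {k n : ℕ} (h : k < n) (z : R) (x : (powSystem y k z).ExtColim M n) :
    x = 0 := by
  induction k generalizing n z with
  | zero =>
    obtain ⟨n, rfl⟩ := Nat.exists_eq_succ_of_ne_zero h.ne'
    exact extColim_bot_eq_zero z n x
  | succ k ih =>
    obtain ⟨n, rfl⟩ := Nat.exists_eq_succ_of_ne_zero (by omega : n ≠ 0)
    obtain ⟨x', rfl⟩ := powConnecting_surjective (ih (by omega) z) x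
    rw [ih (by omega) _ x', map_zero]

open Finset in
/-- The top colimit of `Ext` groups, described as a direct limit of `M ⧸ (y 0 ^ t, …) M`. -/
theorem exists_topClass (y : ℕ → R) (M : ModuleCat.{u} R) (k : ℕ) :
    ∃ c : ∀ (z : R) (_ : ℕ), M →+ (powSystem y k z).ExtColim M k,
      (∀ z x, ∃ t m, c z t m = x) ∧
      (∀ z t n m, c z (t + n) ((z * ∏ j ∈ range k, y j) ^ n • m) = c z t m) ∧
      (∀ z t m, c z t m = 0 ↔ ∃ n, (z * ∏ j ∈ range k, y j) ^ n • m ∈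
        powIdeal y k (t + n) • (⊤ : Submodule R M)) ∧
      ∀ z v w (h : v = z * w) t m, powMap M k k w h (c z t m) = c v t (w ^ t • m) := by
  -- All multipliers are treated at once, since adding `y k` changes `z` into `z * y k`. The last
  -- clause describes the image of a change of multiplier, which is the kernel of the connecting map
  -- in the inductive step.
  induction k with
  | zero =>
    refine ⟨fun z t => botClass z t, exists_botClass, fun z t n m => ?_, fun z t m => ?_,
      fun z v w h t m => powMap_botClass h t m⟩
    · simpa using botClass_add z t n m
    · rw [botClass_eq_zero_iff]
      simp only [powIdeal, Submodule.bot_smul, Submodule.mem_bot, Finset.range_zero,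
        Finset.prod_empty, mul_one]
  | succ k ih =>
    obtain ⟨c, hsurj, hadd, hzero, hmap⟩ := ih
    have hprod : ∀ z, z * ∏ j ∈ range (k + 1), y j = z * y k * ∏ j ∈ range k, y j := fun z => by
      rw [prod_range_succ]; ring
    refine ⟨fun z t => (powConnecting y M k k z).comp (c (z * y k) t), fun z x => ?_,
      fun z t n m => ?_, fun z t m => ?_, fun z v w h t m => ?_⟩
    · obtain ⟨x', rfl⟩ := powConnecting_surjective
        (fun x => extColim_eq_zero (Nat.lt_succ_self k) z x) x
      obtain ⟨t, m, rfl⟩ := hsurj _ x'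
      exact ⟨t, m, rfl⟩
    · rw [AddMonoidHom.comp_apply, AddMonoidHom.comp_apply, hprod, hadd]
    · rw [AddMonoidHom.comp_apply, powConnecting_eq_zero_iff, hprod]
      set q := z * y k * ∏ j ∈ range k, y j with hq
      constructor
      · rintro ⟨x', hx'⟩
        obtain ⟨s, m', rfl⟩ := hsurj _ x'
        -- Both classes are moved to the common level `t + s` before being compared.
        obtain ⟨m'', hm''⟩ : ∃ m'', c z (t + s) m'' = c z s m' :=
          ⟨_, (by rw [add_comm t s]; exact hadd z s t m')⟩
        rw [← hm'', hmap, ← hadd (z * y k) t s m, ← sub_eq_zero, ← map_sub, hzero] at hx'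
        obtain ⟨n, hn⟩ := hx'
        refine ⟨s + n, ?_⟩
        rw [← hq] at hn
        -- The first summand lies in the ideal of the first `k` powers by `hn`. The second is a
        -- multiple of `y k ^ (t + s + n)`, because `y k` divides `q`.
        have e : q ^ (s + n) • m = - (q ^ n • (y k ^ (t + s) • m'' - q ^ s • m)) +
            q ^ n • y k ^ (t + s) • m'' := by
          rw [smul_sub, smul_smul (q ^ n) (q ^ s), ← pow_add, add_comm n s]
          abel
        rw [e, ← add_assoc]
        refine add_mem (Submodule.smul_mono_left le_sup_left (neg_mem hn)) ?_
        rw [smul_smul]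
        refine Submodule.smul_mem_smul ?_ trivial
        refine Ideal.mem_sup_right (Ideal.mem_span_singleton.2 ?_)
        rw [pow_add _ (t + s) n, mul_comm]
        refine mul_dvd_mul ?_ (dvd_refl _)
        refine pow_dvd_pow_of_dvd ?_ n
        exact ⟨z * ∏ j ∈ range k, y j, by rw [hq]; ring⟩
      · rintro ⟨n, hn⟩
        rw [powIdeal, Submodule.sup_smul] at hn
        obtain ⟨b, hb, b', hb', e⟩ := Submodule.mem_sup.1 hn
        obtain ⟨m', -, rfl⟩ := Submodule.mem_smul_pointwise_iff_exists _ _ _ |>.1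
          (Submodule.ideal_span_singleton_smul (y k ^ (t + n)) (⊤ : Submodule R M) ▸ hb')
        refine ⟨c z (t + n) m', ?_⟩
        rw [hmap, ← hadd (z * y k) t n m, ← hq, ← e, map_add, eq_comm, add_eq_right, hzero]
        exact ⟨0, by simpa using hb⟩
    · rw [AddMonoidHom.comp_apply, AddMonoidHom.comp_apply,
        powMap_powConnecting h (by rw [h]; ring), hmap]

end PowIdeal

end

/-! ### Derived-functor Ext, Yoneda Ext, and local cohomology as a limit. -/

section

open CategoryTheory Limits Opposite HomologicalComplex

noncomputable section
variable {R : Type u} [CommRing R]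

namespace OldExt

variable {X X' : ModuleCat.{u} R}

/-- The functor whose derived functors define `Ext`. -/
abbrev homFunctor (Y : ModuleCat.{u} R) : ModuleCat.{u} R ⥤ (ModuleCat.{u} R)ᵒᵖ :=
  ((linearYoneda R (ModuleCat.{u} R)).obj Y).rightOp

/-- The map of cochain complexes induced by a map of chain complexes. -/
def yonedaMap {C D : ChainComplex (ModuleCat.{u} R) ℕ} (φ : C ⟶ D) (Y : ModuleCat.{u} R) :
    D.linearYonedaObj R Y ⟶ C.linearYonedaObj R Y :=
  (HomologicalComplex.unopFunctor _ _).map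
    (((homFunctor Y).mapHomologicalComplex (ComplexShape.down ℕ)).map φ).op

lemma homologyUnop_naturality {ι : Type*} {V : Type*} [Category* V] [Abelian V]
    {c : ComplexShape ι} {K L : HomologicalComplex Vᵒᵖ c} (φ : K ⟶ L) (i : ι) :
    homologyMap ((HomologicalComplex.unopFunctor _ _).map φ.op) i ≫ (K.homologyUnop i).hom =
      (L.homologyUnop i).hom ≫ (homologyMap φ i).unop := by
  have := HomologicalComplex.homologyOp_hom_naturality
    ((HomologicalComplex.unopFunctor _ _).map φ.op) i
  exact (congrArg Quiver.Hom.unop this).symm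

lemma comp_trans_symm_hom {C : Type*} [Category* C] {A A' B B' D D' : C} (m : A' ⟶ A)
    (a' : A' ≅ B') (a : A ≅ B) (e : D ≅ B) (e' : D' ≅ B') (q : B' ⟶ B) (r : D' ⟶ D)
    (h : a'.hom ≫ q = m ≫ a.hom) (h' : r ≫ e.hom = e'.hom ≫ q) :
    m ≫ (a ≪≫ e.symm).hom = (a' ≪≫ e'.symm).hom ≫ r := by
  rw [← cancel_mono e.hom]
  simp [h, h', ← reassoc_of% h]

/-- Computing `Ext` from a resolution is natural in the first variable: a lift of `g` to the
resolutions acts on cocycles by precomposition. -/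
lemma map_app_isoExt (P : ProjectiveResolution X) (P' : ProjectiveResolution X') (g : X ⟶ X')
    (φ : P.complex ⟶ P'.complex) (comm : φ.f 0 ≫ P'.π.f 0 = P.π.f 0 ≫ g) (n : ℕ)
    (Y : ModuleCat.{u} R) :
    ((Ext R (ModuleCat.{u} R) n).map g.op).app Y ≫ (P.isoExt n Y).hom =
      (P'.isoExt n Y).hom ≫ homologyMap (yonedaMap φ Y) n := by
  have h := ProjectiveResolution.isoLeftDerivedObj_inv_naturality g P P' φ comm (homFunctor Y) n
  have h1 := congrArg Quiver.Hom.unop h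
  have h2 := homologyUnop_naturality
    (((homFunctor Y).mapHomologicalComplex (ComplexShape.down ℕ)).map φ) n
  exact comp_trans_symm_hom (((Ext R (ModuleCat.{u} R) n).map g.op).app Y)
    (P'.isoLeftDerivedObj (homFunctor Y) n).unop.symm
    (P.isoLeftDerivedObj (homFunctor Y) n).unop.symm _ _ _ _ h1.symm h2

variable (K : CochainComplex (ModuleCat.{u} R) ℕ)

lemma homologyπ_surjective (n : ℕ) : Function.Surjective (K.homologyπ n) :=
  (ModuleCat.epi_iff_surjective _).1 inferInstance

lemma iCycles_injective (n : ℕ) : Function.Injective (K.iCycles n) :=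
  (ModuleCat.mono_iff_injective _).1 inferInstance

lemma exists_iCycles (n : ℕ) (x : K.X n) (hx : K.d n (n + 1) x = 0) :
    ∃ z : K.cycles n, K.iCycles n z = x := by
  refine ⟨K.cyclesMk x (n + 1) (by simp) hx, ?_⟩
  exact K.i_cyclesMk x (n + 1) (by simp) hx

lemma d_iCycles (n j : ℕ) (z : K.cycles n) : K.d n j (K.iCycles n z) = 0 := by
  rw [← ModuleCat.comp_apply, HomologicalComplex.iCycles_d]; rfl

lemma homologyπ_eq_zero_iff (n : ℕ) (z : K.cycles n) :
    K.homologyπ n z = 0 ↔ ∃ j, ∃ w : K.X j, K.d j n w = K.iCycles n z := by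
  constructor
  · intro h
    have hex : (ShortComplex.mk (K.toCycles _ n) (K.homologyπ n)
        (K.toCycles_comp_homologyπ _ n)).Exact :=
      ShortComplex.exact_of_g_is_cokernel _
        (K.homologyIsCokernel ((ComplexShape.up ℕ).prev n) n rfl)
    rw [ShortComplex.moduleCat_exact_iff] at hex
    obtain ⟨w, hw⟩ := hex z h
    refine ⟨_, w, ?_⟩
    rw [← hw, ← ModuleCat.comp_apply]
    simp
  · rintro ⟨j, w, hw⟩
    have : z = K.toCycles j n w := by
      apply iCycles_injective
      rw [← hw, ← ModuleCat.comp_apply]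
      simp
    rw [this, ← ModuleCat.comp_apply, K.toCycles_comp_homologyπ]; rfl

variable {K}

variable {n : ℕ} {Y : ModuleCat.{u} R}

/-- The cocycle `f` represents the class `x`. -/
def Represents (P : ProjectiveResolution X) (f : P.complex.X n ⟶ Y)
    (x : ((Ext R (ModuleCat.{u} R) n).obj (op X)).obj Y) : Prop :=
  ∃ z : (P.complex.linearYonedaObj R Y).cycles n,
    (P.complex.linearYonedaObj R Y).iCycles n z = f ∧
      (P.complex.linearYonedaObj R Y).homologyπ n z = (P.isoExt n Y).hom x

lemma exists_represents (P : ProjectiveResolution X)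
    (x : ((Ext R (ModuleCat.{u} R) n).obj (op X)).obj Y) :
    ∃ f : P.complex.X n ⟶ Y, P.complex.d (n + 1) n ≫ f = 0 ∧ Represents P f x := by
  obtain ⟨z, hz⟩ := homologyπ_surjective _ n ((P.isoExt n Y).hom x)
  exact ⟨_, d_iCycles _ n (n + 1) z, z, rfl, hz⟩

lemma exists_represented (P : ProjectiveResolution X) (f : P.complex.X n ⟶ Y)
    (hf : P.complex.d (n + 1) n ≫ f = 0) :
    ∃ x : ((Ext R (ModuleCat.{u} R) n).obj (op X)).obj Y, Represents P f x := by
  obtain ⟨z, hz⟩ := exists_iCycles (P.complex.linearYonedaObj R Y) n f hf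
  refine ⟨(P.isoExt n Y).inv ((P.complex.linearYonedaObj R Y).homologyπ n z), z, hz, ?_⟩
  rw [← ModuleCat.comp_apply, Iso.inv_hom_id]; rfl

lemma Represents.eq_zero_iff {P : ProjectiveResolution X} {f : P.complex.X n ⟶ Y}
    {x : ((Ext R (ModuleCat.{u} R) n).obj (op X)).obj Y} (h : Represents P f x) :
    x = 0 ↔ ∃ j, ∃ g : P.complex.X j ⟶ Y, P.complex.d n j ≫ g = f := by
  obtain ⟨z, rfl, hz⟩ := h
  refine Iff.trans ?_ (homologyπ_eq_zero_iff (P.complex.linearYonedaObj R Y) n z)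
  rw [hz]
  constructor
  · rintro rfl; exact map_zero _
  · intro h
    have := congrArg (P.isoExt n Y).inv h
    rw [← ModuleCat.comp_apply, Iso.hom_inv_id, map_zero] at this
    exact this

lemma Represents.map {P : ProjectiveResolution X} {P' : ProjectiveResolution X'} {g : X ⟶ X'}
    (φ : ProjectiveResolution.Hom P P' g) {f : P'.complex.X n ⟶ Y}
    {x : ((Ext R (ModuleCat.{u} R) n).obj (op X')).obj Y} (h : Represents P' f x) :
    Represents P (φ.hom.f n ≫ f) (((Ext R (ModuleCat.{u} R) n).map g.op).app Y x) := by
  obtain ⟨z, rfl, hz⟩ := h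
  refine ⟨cyclesMap (yonedaMap φ.hom Y) n z, ?_, ?_⟩
  · rw [← ModuleCat.comp_apply, cyclesMap_i]
    rfl
  · have := map_app_isoExt P P' g φ.hom φ.hom_f_zero_comp_π_f_zero n Y
    refine Eq.trans ?_ (congrArg (fun f => f.hom x) this).symm
    change _ = homologyMap (yonedaMap φ.hom Y) n ((P'.isoExt n Y).hom x)
    rw [← hz, ← ModuleCat.comp_apply, ← ModuleCat.comp_apply, homologyπ_naturality]

/-- The right-hand side lets `j` vary so that it agrees with `Represents.eq_zero_iff`; differentials
to a degree other than `n - 1` vanish. Degree 0 is separate: no differential leaves `X 0`, so only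
the zero cocycle is a coboundary. -/
lemma extMk_eq_zero_iff (P : ProjectiveResolution X) (f : P.complex.X n ⟶ Y)
    (hf : P.complex.d (n + 1) n ≫ f = 0) :
    P.extMk f (n + 1) rfl hf = 0 ↔ ∃ j, ∃ g : P.complex.X j ⟶ Y, P.complex.d n j ≫ g = f := by
  have h0 : P.extMk f (n + 1) rfl hf = 0 ↔
      ∃ g : P.cochainComplex.X (-n + 1 : ℤ) ⟶ Y, P.cochainComplex.d (-n : ℤ) (-n + 1) ≫ g =
        (P.cochainComplexXIso (-n) n rfl).hom ≫ f := by
    rw [← P.extEquivCohomologyClass.apply_eq_iff_eq,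
      ProjectiveResolution.extEquivCohomologyClass_extMk,
      ProjectiveResolution.extEquivCohomologyClass_zero,
      CochainComplex.HomComplex.CohomologyClass.mk_eq_zero_iff]
    exact CochainComplex.HomComplex.Cocycle.toSingleMk_mem_coboundaries_iff _ _ _ _ _ _ rfl
  obtain _ | p := n
  · have h1 : f = 0 ↔ ∃ j, ∃ g : P.complex.X j ⟶ Y, P.complex.d 0 j ≫ g = f := by
      constructor
      · rintro rfl
        exact ⟨0, 0, by simp⟩
      · rintro ⟨j, g, rfl⟩
        rw [P.complex.shape _ _ (by simp), zero_comp]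
    rw [← h1, h0]
    have hz : IsZero (P.cochainComplex.X (-(0 : ℕ) + 1 : ℤ)) :=
      CochainComplex.isZero_of_isStrictlyLE _ 0 _ (by simp)
    constructor
    · rintro ⟨g, hg⟩
      rw [hz.eq_of_src g 0, comp_zero] at hg
      rw [← cancel_epi (P.cochainComplexXIso (-(0 : ℕ)) 0 rfl).hom, ← hg, comp_zero]
    · rintro rfl
      exact ⟨0, by simp⟩
  · rw [P.extMk_eq_zero_iff f _ rfl hf p rfl]
    refine ⟨fun h => ⟨p, h⟩, ?_⟩
    rintro ⟨j, g, rfl⟩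
    by_cases hj : j = p
    · subst hj; exact ⟨g, rfl⟩
    · have hj' : P.complex.d (p + 1) j = 0 :=
        P.complex.shape _ _ (by simp only [ComplexShape.down_Rel]; omega)
      exact ⟨0, by rw [hj', zero_comp, comp_zero]⟩

/-- A derived functor class and an extension class are represented by the same cocycle. -/
def Matches (x : ((Ext R (ModuleCat.{u} R) n).obj (op X)).obj Y) (ξ : Abelian.Ext X Y n) : Prop :=
  ∃ (f : (projectiveResolution X).complex.X n ⟶ Y)
    (hf : (projectiveResolution X).complex.d (n + 1) n ≫ f = 0),
    Represents (projectiveResolution X) f x ∧ (projectiveResolution X).extMk f (n + 1) rfl hf = ξ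

lemma exists_matches_left (x : ((Ext R (ModuleCat.{u} R) n).obj (op X)).obj Y) :
    ∃ ξ, Matches x ξ := by
  obtain ⟨f, hf, h⟩ := exists_represents (projectiveResolution X) x
  exact ⟨_, f, hf, h, rfl⟩

lemma exists_matches_right (ξ : Abelian.Ext X Y n) :
    ∃ x : ((Ext R (ModuleCat.{u} R) n).obj (op X)).obj Y, Matches x ξ := by
  obtain ⟨f, hf, h⟩ := (projectiveResolution X).extMk_surjective ξ (n + 1) rfl
  obtain ⟨x, hx⟩ := exists_represented _ f hf
  exact ⟨x, f, hf, hx, h⟩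

/-- Nonvanishing of a limit depends only on which classes die under pullback, so this replaces an
isomorphism between the two kinds of Ext. Both sides say that the cocycle pulled back along a lift
of `g` is a coboundary. -/
lemma Matches.map_eq_zero_iff {x : ((Ext R (ModuleCat.{u} R) n).obj (op X')).obj Y}
    {ξ : Abelian.Ext X' Y n} (h : Matches x ξ) (g : X ⟶ X') :
    ((Ext R (ModuleCat.{u} R) n).map g.op).app Y x = 0 ↔ CyclicSystem.pull g Y n ξ = 0 := by
  obtain ⟨f, hf, hr, rfl⟩ := h
  let φ : ProjectiveResolution.Hom (projectiveResolution X) (projectiveResolution X') g :=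
    { hom := ProjectiveResolution.lift g _ _
      hom_f_zero_comp_π_f_zero :=
        ProjectiveResolution.lift_commutes_zero g (projectiveResolution X) (projectiveResolution X') }
  rw [(hr.map φ).eq_zero_iff, CyclicSystem.pull_apply,
    ProjectiveResolution.mk₀_comp_extMk f (n + 1) rfl hf φ, extMk_eq_zero_iff]

end OldExt

/-- The forgetful functor preserves filtered colimits, so an element comes from some stage and is
zero iff it dies at a later one. -/
lemma ModuleCat.nontrivial_colimit_iff {J : Type} [SmallCategory J] [IsFiltered J]
    (F : J ⥤ ModuleCat.{u} R) :
    Nontrivial (colimit F : ModuleCat.{u} R) ↔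
      ∃ j, ∃ x : F.obj j, ∀ (k : J) (f : j ⟶ k), F.map f x ≠ 0 := by
  have : PreservesFilteredColimitsOfSize.{0, 0} (CategoryTheory.forget (ModuleCat.{u} R)) :=
    preservesFilteredColimitsOfSize_shrink.{0, u, 0, u} _
  have key : ∀ (j : J) (x : F.obj j), colimit.ι F j x = 0 ↔ ∃ (k : J) (f : j ⟶ k), F.map f x = 0 := by
    intro j x
    constructor
    · intro h
      have h' : colimit.ι F j x = colimit.ι F j 0 := by rw [h, map_zero]
      obtain ⟨k, f, g, hk⟩ := (Concrete.colimit_rep_eq_iff_exists F x (0 : F.obj j)).1 h'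
      refine ⟨k, f, hk.trans ?_⟩
      exact map_zero _
    · rintro ⟨k, f, hf⟩
      rw [← colimit.w F f, ModuleCat.comp_apply, hf, map_zero]
  constructor
  · intro h
    obtain ⟨z, hz⟩ := exists_ne (0 : (colimit F : ModuleCat.{u} R))
    obtain ⟨j, x, rfl⟩ := Concrete.colimit_exists_rep F z
    exact ⟨j, x, fun k f hf => hz ((key j x).2 ⟨k, f, hf⟩)⟩
  · rintro ⟨j, x, hx⟩
    refine ⟨colimit.ι F j x, 0, fun h => ?_⟩
    obtain ⟨k, f, hf⟩ := (key j x).1 h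
    exact hx k f hf

open CyclicSystem in
/-- Non-vanishing of local cohomology in terms of extension classes. -/
theorem nontrivial_localCohomology_iff (I : Ideal R) (n : ℕ) (Y : ModuleCat.{u} R) :
    Nontrivial ((localCohomology I n).obj Y) ↔
      ∃ t, ∃ ξ : Abelian.Ext (ModuleCat.of R (R ⧸ I ^ t)) Y n,
        ∀ (t' : ℕ) (h : t ≤ t'), pull (mulMap (I ^ t') (I ^ t) 1
          (fun a ha => by rw [one_mul]; exact Ideal.pow_le_pow_right h ha)) Y n ξ ≠ 0 := by
  let F := localCohomology.diagram (localCohomology.idealPowersDiagram I) n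
  let e : (localCohomology I n).obj Y ≅ colimit (F ⋙ (evaluation _ _).obj Y) :=
    colimitObjIsoColimitCompEvaluation F Y
  rw [e.toLinearEquiv.toEquiv.nontrivial_congr, ModuleCat.nontrivial_colimit_iff]
  have hm : ∀ (t t' : ℕ) (h : t ≤ t') (h'), mulMap (I ^ t') (I ^ t) 1 h' =
      (localCohomology.ringModIdeals (localCohomology.idealPowersDiagram I)).map
        (homOfLE h).op := by
    intro t t' h h'
    refine ModuleCat.hom_ext (LinearMap.ext fun x => ?_)
    obtain ⟨a, rfl⟩ := Ideal.Quotient.mk_surjective x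
    change Ideal.Quotient.mk (I ^ t) (1 * a) = Ideal.Quotient.mk (I ^ t) a
    rw [one_mul]
  constructor
  · rintro ⟨j, x, hx⟩
    obtain ⟨ξ, hξ⟩ := OldExt.exists_matches_left x
    refine ⟨j.unop.unop, ξ, fun t' h hp => ?_⟩
    rw [hm _ _ h] at hp
    exact hx (op (op t')) (homOfLE h).op.op ((hξ.map_eq_zero_iff _).2 hp)
  · rintro ⟨t, ξ, hξ⟩
    obtain ⟨x, hx⟩ := OldExt.exists_matches_right ξ
    refine ⟨op (op t), x, fun k f hf => ?_⟩
    refine hξ k.unop.unop (leOfHom f.unop.unop) ?_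
    rw [hm _ _ (leOfHom f.unop.unop)]
    exact (hx.map_eq_zero_iff _).1 hf

end


/-! ### Top local cohomology from a sequence generating the ideal up to radical. -/

section LocalCohomology

variable {R : Type u} [CommRing R] [IsNoetherianRing R] {y : ℕ → R} {d : ℕ} {I : Ideal R}

open CyclicSystem

omit [IsNoetherianRing R] in
lemma powIdeal_le_pow (hy : ∀ j < d, y j ∈ I) (t : ℕ) : powIdeal y d t ≤ I ^ t := by
  rw [powIdeal_eq_span, Ideal.span_le]
  rintro _ ⟨j, hj, rfl⟩
  exact Ideal.pow_mem_pow (hy j hj) t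

lemma exists_pow_le_powIdeal (hI : I ≤ (powIdeal y d 1).radical) (t : ℕ) :
    ∃ s, I ^ s ≤ powIdeal y d t := by
  refine Ideal.exists_pow_le_of_le_radical_of_fg ?_ (IsNoetherian.noetherian I)
  refine hI.trans (Ideal.radical_le_radical_iff.2 ?_)
  rw [powIdeal_eq_span, powIdeal_eq_span, Ideal.span_le]
  rintro _ ⟨j, hj, rfl⟩
  exact ⟨t, Ideal.subset_span ⟨j, hj, by simp⟩⟩

omit [IsNoetherianRing R] in
lemma pull_mulMap_one {J J' J'' : Ideal R} (h : ∀ a ∈ J, 1 * a ∈ J') (h' : ∀ a ∈ J', 1 * a ∈ J'')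
    (h'' : ∀ a ∈ J, 1 * a ∈ J'') {Y : ModuleCat.{u} R} {n : ℕ}
    (ξ : Abelian.Ext (ModuleCat.of R (R ⧸ J'')) Y n) :
    pull (mulMap J J' 1 h) Y n (pull (mulMap J' J'' 1 h') Y n ξ) = pull (mulMap J J'' 1 h'') Y n ξ := by
  rw [pull_pull, mulMap_comp h h' (one_mul 1)]

omit [IsNoetherianRing R] in
lemma powSystem_trans {s t : ℕ} (h : s ≤ t) :
    (powSystem y d 1).trans h = mulMap (powIdeal y d t) (powIdeal y d s) 1
      (fun a ha => by rw [one_mul]; exact powIdeal_antitone y d h ha) :=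
  mulMap_congr _ (one_pow _)

/-- The top local cohomology, with support in an ideal generated by `d` elements up to radical. -/
theorem nontrivial_top_localCohomology_iff (hI : I ≤ (powIdeal y d 1).radical)
    (hy : ∀ j < d, y j ∈ I) (Y : ModuleCat.{u} R) :
    Nontrivial ((localCohomology I d).obj Y) ↔ ∃ (t : ℕ) (m : Y), ∀ n,
      (∏ j ∈ Finset.range d, y j) ^ n • m ∉ powIdeal y d (t + n) • (⊤ : Submodule R Y) := by
  -- The powers of `I` and the ideals `powIdeal y d t` are cofinal in each other. A class surviving
  -- in one system is transported to the other, and its death there would come back by a further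
  -- pullback.
  have h1 : Nontrivial ((localCohomology I d).obj Y) ↔
      ∃ x : (powSystem y d 1).ExtColim Y d, x ≠ 0 := by
    rw [nontrivial_localCohomology_iff]
    constructor
    · rintro ⟨t, ξ, hξ⟩
      have hle : ∀ a ∈ powIdeal y d t, 1 * a ∈ I ^ t := fun a ha => by
        rw [one_mul]; exact powIdeal_le_pow hy t ha
      refine ⟨(powSystem y d 1).of Y d t (pull (mulMap _ _ 1 hle) Y d ξ), fun h => ?_⟩
      obtain ⟨t', htt', h⟩ := (of_eq_zero_iff (X := powSystem y d 1) _).1 h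
      obtain ⟨s, hs⟩ := exists_pow_le_powIdeal hI t'
      refine hξ (s + t') (by omega) ?_
      have hle' : ∀ a ∈ I ^ (s + t'), 1 * a ∈ powIdeal y d t' := fun a ha => by
        rw [one_mul]; exact hs (Ideal.pow_le_pow_right (by omega) ha)
      rw [powSystem_trans] at h
      have h2 := congrArg (pull (mulMap _ _ 1 hle') Y d) h
      replace h2 := h2.trans (map_zero _)
      refine Eq.trans ?_ h2
      have hle2 : ∀ a ∈ powIdeal y d t', 1 * a ∈ I ^ t := fun a ha => by
        rw [one_mul]; exact powIdeal_le_pow hy t (powIdeal_antitone y d htt' ha)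
      exact ((congrArg _ (pull_mulMap_one _ _ hle2 ξ)).trans (pull_mulMap_one _ _ _ ξ)).symm
    · rintro ⟨x, hx⟩
      obtain ⟨t, ξ, rfl⟩ := exists_of x
      obtain ⟨s, hs⟩ := exists_pow_le_powIdeal hI t
      have hle : ∀ a ∈ I ^ s, 1 * a ∈ powIdeal y d t := fun a ha => by
        rw [one_mul]; exact hs ha
      refine ⟨s, pull (mulMap _ _ 1 hle) Y d ξ, fun s' hs' h => hx ?_⟩
      refine (of_eq_zero_iff (X := powSystem y d 1) ξ).2 ⟨s' + t, by omega, ?_⟩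
      rw [powSystem_trans]
      have hle' : ∀ a ∈ powIdeal y d (s' + t), 1 * a ∈ I ^ s' := fun a ha => by
        rw [one_mul]; exact powIdeal_le_pow hy s' (powIdeal_antitone y d (by omega) ha)
      have h2 := congrArg (pull (mulMap _ _ 1 hle') Y d) h
      replace h2 := h2.trans (map_zero _)
      refine Eq.trans ?_ h2
      have hle2 : ∀ a ∈ I ^ s', 1 * a ∈ powIdeal y d t := fun a ha => by
        rw [one_mul]; exact hs (Ideal.pow_le_pow_right hs' ha)
      exact ((congrArg _ (pull_mulMap_one _ _ hle2 ξ)).trans (pull_mulMap_one _ _ _ ξ)).symm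
  obtain ⟨c, hsurj, -, hzero, -⟩ := exists_topClass y Y d
  rw [h1]
  constructor
  · rintro ⟨x, hx⟩
    obtain ⟨t, m, rfl⟩ := hsurj 1 x
    refine ⟨t, m, fun n hn => hx ?_⟩
    rw [hzero]
    exact ⟨n, by rwa [one_mul]⟩
  · rintro ⟨t, m, hm⟩
    refine ⟨c 1 t m, fun h => ?_⟩
    rw [hzero] at h
    obtain ⟨n, hn⟩ := h
    rw [one_mul] at hn
    exact hm n hn

end LocalCohomology

end

/-! ### Graded algebras over a field and homogeneous systems of parameters. -/

section

open DirectSum GradedAlgebra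

section GradedRings

variable {K R : Type u} [Field K] [CommRing R] [Algebra K R] (𝒜 : ℕ → Submodule K R)
  [GradedAlgebra 𝒜]

namespace GradedAlgebra

lemma proj_mem (n : ℕ) (x : R) : proj 𝒜 n x ∈ 𝒜 n := by
  rw [proj_apply]; exact SetLike.coe_mem _

variable {𝒜}

lemma proj_of_mem {n : ℕ} {x : R} (hx : x ∈ 𝒜 n) : proj 𝒜 n x = x := by
  rw [proj_apply]; exact decompose_of_mem_same 𝒜 hx

lemma proj_of_mem_ne {n m : ℕ} {x : R} (hx : x ∈ 𝒜 n) (h : n ≠ m) : proj 𝒜 m x = 0 := by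
  rw [proj_apply]; exact decompose_of_mem_ne 𝒜 hx h

lemma proj_add_mul_of_left_mem {i : ℕ} {a : R} (ha : a ∈ 𝒜 i) (n : ℕ) (b : R) :
    proj 𝒜 (i + n) (a * b) = a * proj 𝒜 n b := by
  rw [proj_apply, proj_apply]; exact coe_decompose_mul_add_of_left_mem 𝒜 ha

lemma proj_mul_of_left_mem_of_lt {i n : ℕ} {a : R} (ha : a ∈ 𝒜 i) (h : n < i) (b : R) :
    proj 𝒜 n (a * b) = 0 := by
  rw [proj_apply]; exact coe_decompose_mul_of_left_mem_of_not_le 𝒜 ha (not_le.2 h)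

lemma eq_zero_of_proj {x : R} (h : ∀ n, proj 𝒜 n x = 0) : x = 0 := by
  refine (decompose 𝒜).injective ?_
  rw [decompose_zero]
  exact DFinsupp.ext fun n => Subtype.ext ((proj_apply 𝒜 n x).symm.trans (h n))

lemma proj_mul (n : ℕ) (a b : R) :
    proj 𝒜 n (a * b) = ∑ ij ∈ Finset.HasAntidiagonal.antidiagonal n, proj 𝒜 ij.1 a * proj 𝒜 ij.2 b := by
  simp only [proj_apply, decompose_mul]
  exact coe_mul_apply_eq_sum_antidiagonal (A := 𝒜) _ _ n

variable (𝒜) in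
lemma exists_eq_sum_proj (x : R) : ∃ s : Finset ℕ, x = ∑ n ∈ s, proj 𝒜 n x := by
  classical
  refine ⟨(decompose 𝒜 x).support, ?_⟩
  simp only [proj_apply]
  exact (sum_support_decompose 𝒜 x).symm

end GradedAlgebra

variable {𝒜}

lemma mem_homogeneousMaximalIdeal_iff {x : R} :
    x ∈ homogeneousMaximalIdeal 𝒜 ↔ proj 𝒜 0 x = 0 :=
  HomogeneousIdeal.mem_irrelevant_iff 𝒜 x

lemma mem_homogeneousMaximalIdeal_of_mem {x : R} {i : ℕ} (hi : 0 < i) (hx : x ∈ 𝒜 i) :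
    x ∈ homogeneousMaximalIdeal 𝒜 :=
  HomogeneousIdeal.mem_irrelevant_of_mem 𝒜 hi hx

lemma algebraMap_mem_zero (c : K) : algebraMap K R c ∈ 𝒜 0 :=
  SetLike.algebraMap_mem_graded 𝒜 c

omit [GradedAlgebra 𝒜] in
lemma exists_algebraMap_eq (h0 : 𝒜 0 = 1) {x : R} (hx : x ∈ 𝒜 0) : ∃ c : K, algebraMap K R c = x := by
  rw [h0, Submodule.mem_one] at hx
  exact hx

lemma exists_sub_algebraMap_mem (h0 : 𝒜 0 = 1) (x : R) :
    ∃ c : K, x - algebraMap K R c ∈ homogeneousMaximalIdeal 𝒜 := by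
  obtain ⟨c, hc⟩ := exists_algebraMap_eq h0 (proj_mem 𝒜 0 x)
  refine ⟨c, ?_⟩
  rw [mem_homogeneousMaximalIdeal_iff, map_sub, proj_of_mem (algebraMap_mem_zero c), hc, sub_self]

lemma homogeneousMaximalIdeal_ne_top [Nontrivial R] : homogeneousMaximalIdeal 𝒜 ≠ ⊤ := by
  rw [Ideal.ne_top_iff_one, mem_homogeneousMaximalIdeal_iff,
    proj_of_mem (SetLike.GradedOne.one_mem)]
  exact one_ne_zero

lemma algebraMap_notMem [Nontrivial R] {c : K} (hc : c ≠ 0) :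
    algebraMap K R c ∉ homogeneousMaximalIdeal 𝒜 := by
  rw [mem_homogeneousMaximalIdeal_iff, proj_of_mem (algebraMap_mem_zero c)]
  exact (map_ne_zero (algebraMap K R)).2 hc

lemma homogeneousMaximalIdeal_isMaximal [Nontrivial R] (h0 : 𝒜 0 = 1) :
    (homogeneousMaximalIdeal 𝒜).IsMaximal := by
  refine Ideal.isMaximal_iff.2 ⟨(Ideal.ne_top_iff_one _).1 homogeneousMaximalIdeal_ne_top,
    fun J x hJ hx hxJ => ?_⟩
  obtain ⟨c, hc⟩ := exists_sub_algebraMap_mem h0 x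
  have hc0 : c ≠ 0 := by
    rintro rfl
    exact hx (by simpa using hc)
  have h1 : algebraMap K R c ∈ J := by
    have := J.sub_mem hxJ (hJ hc)
    simpa using this
  have h2 := J.mul_mem_left (algebraMap K R c⁻¹) h1
  rwa [← map_mul, inv_mul_cancel₀ hc0, map_one] at h2

lemma homogeneousMaximalIdeal_isHomogeneous : (homogeneousMaximalIdeal 𝒜).IsHomogeneous 𝒜 :=
  HomogeneousIdeal.isHomogeneous _

lemma Ideal.IsHomogeneous.proj_mem {J : Ideal R} (hJ : J.IsHomogeneous 𝒜) {x : R} (hx : x ∈ J)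
    (n : ℕ) : proj 𝒜 n x ∈ J := by
  rw [proj_apply]; exact hJ n hx

lemma Ideal.IsHomogeneous.le_homogeneousMaximalIdeal (h0 : 𝒜 0 = 1) {J : Ideal R}
    (hJ : J.IsHomogeneous 𝒜) (h : J ≠ ⊤) : J ≤ homogeneousMaximalIdeal 𝒜 := by
  intro x hx
  rw [mem_homogeneousMaximalIdeal_iff]
  have h1 := hJ.proj_mem hx 0
  obtain ⟨c, hc⟩ := exists_algebraMap_eq h0 (GradedAlgebra.proj_mem 𝒜 0 x)
  rw [← hc] at h1 ⊢
  by_contra hne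
  refine h (Ideal.eq_top_of_isUnit_mem _ h1 (IsUnit.map _ (isUnit_iff_ne_zero.2 ?_)))
  rintro rfl
  exact hne (map_zero _)

/-- The degree-0 part of `s` is a nonzero scalar `c`. If the components of `a` below degree `n`
vanish, the degree `n` part of `a * s` is `c` times that of `a`. -/
lemma eq_zero_of_mul_eq_zero_of_notMem (h0 : 𝒜 0 = 1) {a s : R}
    (hs : s ∉ homogeneousMaximalIdeal 𝒜) (h : a * s = 0) : a = 0 := by
  obtain ⟨c, hc⟩ := exists_algebraMap_eq h0 (GradedAlgebra.proj_mem 𝒜 0 s)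
  have hc0 : c ≠ 0 := by
    rintro rfl
    exact hs (mem_homogeneousMaximalIdeal_iff.2 (hc.symm.trans (map_zero _)))
  refine eq_zero_of_proj (𝒜 := 𝒜) fun n => ?_
  induction n using Nat.strong_induction_on with
  | _ n ih =>
    have h1 := congrArg (proj 𝒜 n) h
    rw [proj_mul, map_zero, Finset.sum_eq_single (n, 0), ← hc, mul_comm, ← Algebra.smul_def] at h1
    · exact (smul_eq_zero.1 h1).resolve_left hc0
    · rintro ⟨i, j⟩ hij hne
      rw [Finset.HasAntidiagonal.mem_antidiagonal] at hij
      simp only at hij ⊢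
      rw [ih i, zero_mul]
      refine lt_of_le_of_ne (by omega) fun hi => hne ?_
      subst hi
      simpa using hij
    · intro hn
      simp at hn

/-- Elements outside `𝔪` are nonzerodivisors, so `R` embeds in `R_𝔪`, which is a domain by
normality. -/
lemma isDomain_of_isNormalRing [Nontrivial R] (h0 : 𝒜 0 = 1) (h : IsNormalRing R) : IsDomain R := by
  have := (homogeneousMaximalIdeal_isMaximal (𝒜 := 𝒜) h0).isPrime
  have := (h (homogeneousMaximalIdeal 𝒜)).1
  refine Function.Injective.isDomain
    (algebraMap R (Localization.AtPrime (homogeneousMaximalIdeal 𝒜))) ?_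
  refine IsLocalization.injective _ (M := (homogeneousMaximalIdeal 𝒜).primeCompl) ?_
  intro s hs
  rw [mem_nonZeroDivisors_iff_right]
  exact fun a ha => eq_zero_of_mul_eq_zero_of_notMem h0 hs ha

lemma Ideal.IsHomogeneous.exists_mem_notMem {I J : Ideal R} (hI : I.IsHomogeneous 𝒜)
    (h : ¬ I ≤ J) : ∃ n, ∃ x ∈ 𝒜 n, x ∈ I ∧ x ∉ J := by
  obtain ⟨x, hx, hxJ⟩ := SetLike.not_le_iff_exists.1 h
  by_contra hc
  push Not at hc
  obtain ⟨s, hs⟩ := exists_eq_sum_proj 𝒜 x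
  refine hxJ ?_
  rw [hs]
  exact J.sum_mem fun n _ => hc n _ (GradedAlgebra.proj_mem 𝒜 n x) (hI.proj_mem hx n)

/-- The homogeneous core of a prime is prime and still contains `J`, so minimality forces it to
equal `P`. -/
lemma Ideal.isHomogeneous_of_mem_minimalPrimes {J P : Ideal R} (hJ : J.IsHomogeneous 𝒜)
    (hP : P ∈ J.minimalPrimes) : P.IsHomogeneous 𝒜 := by
  have h1 : (P.homogeneousCore 𝒜).toIdeal.IsPrime := Ideal.IsPrime.homogeneousCore hP.1.1
  have h2 : J ≤ (P.homogeneousCore 𝒜).toIdeal := by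
    rw [← hJ.toIdeal_homogeneousCore_eq_self]
    exact Ideal.homogeneousCore_mono 𝒜 hP.1.2
  have h3 := hP.2 ⟨h1, h2⟩ (Ideal.toIdeal_homogeneousCore_le 𝒜 P)
  have h4 : (P.homogeneousCore 𝒜).toIdeal = P :=
    le_antisymm (Ideal.toIdeal_homogeneousCore_le 𝒜 P) h3
  rw [← h4]
  exact HomogeneousIdeal.isHomogeneous _

/-- Homogeneous prime avoidance. -/
lemma exists_homogeneous_notMem (F : Finset (Ideal R)) (hprime : ∀ P ∈ F, P.IsPrime)
    (hhom : ∀ P ∈ F, P.IsHomogeneous 𝒜) (hanti : ∀ P ∈ F, ∀ Q ∈ F, P ≤ Q → P = Q)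
    (hF : ∀ P ∈ F, ¬ homogeneousMaximalIdeal 𝒜 ≤ P) :
    ∃ e > 0, ∃ x ∈ 𝒜 e, ∀ P ∈ F, x ∉ P := by
  classical
  induction F using Finset.induction_on with
  | empty => exact ⟨1, one_pos, 0, zero_mem _, by simp⟩
  | insert Q F hQF ih =>
    obtain ⟨e, he, u, hu, huF⟩ := ih (fun P hP => hprime P (Finset.mem_insert_of_mem hP))
      (fun P hP => hhom P (Finset.mem_insert_of_mem hP))
      (fun P hP P' hP' => hanti P (Finset.mem_insert_of_mem hP) P' (Finset.mem_insert_of_mem hP'))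
      (fun P hP => hF P (Finset.mem_insert_of_mem hP))
    by_cases huQ : u ∈ Q
    swap
    · refine ⟨e, he, u, hu, fun P hP => ?_⟩
      rcases Finset.mem_insert.1 hP with rfl | hP
      exacts [huQ, huF P hP]
    have hQ : Q.IsPrime := hprime Q (Finset.mem_insert_self _ _)
    -- When `u` falls into `Q`, it is corrected by a homogeneous `v` in all the other primes but not
    -- in `Q`. The product defining `v` starts with an element of `𝔪` outside `Q`, which makes its
    -- degree positive.
    have key : ∃ f > 0, ∃ v ∈ 𝒜 f, (∀ P ∈ F, v ∈ P) ∧ v ∉ Q := by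
      have h1 : ∀ G : Finset (Ideal R), G ⊆ F → ∃ f > 0, ∃ v ∈ 𝒜 f, (∀ P ∈ G, v ∈ P) ∧ v ∉ Q := by
        intro G
        induction G using Finset.induction_on with
        | empty =>
          intro _
          obtain ⟨n, w, hw, hwm, hwQ⟩ :=
            (homogeneousMaximalIdeal_isHomogeneous (𝒜 := 𝒜)).exists_mem_notMem
              (hF Q (Finset.mem_insert_self _ _))
          refine ⟨n, Nat.pos_of_ne_zero ?_, w, hw, by simp, hwQ⟩
          rintro rfl
          rw [mem_homogeneousMaximalIdeal_iff, proj_of_mem hw] at hwm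
          exact hwQ (hwm ▸ Q.zero_mem)
        | insert P G _ ih2 =>
          intro hG
          obtain ⟨f, hf, v, hv, hvG, hvQ⟩ := ih2 fun x hx => hG (Finset.mem_insert_of_mem hx)
          have hPF : P ∈ F := hG (Finset.mem_insert_self _ _)
          have hPQ : ¬ P ≤ Q := fun h => hQF ((hanti P (Finset.mem_insert_of_mem hPF) Q
            (Finset.mem_insert_self _ _) h) ▸ hPF)
          obtain ⟨n, w, hw, hwP, hwQ⟩ :=
            (hhom P (Finset.mem_insert_of_mem hPF)).exists_mem_notMem hPQ
          refine ⟨f + n, by omega, v * w, SetLike.mul_mem_graded hv hw, fun P' hP' => ?_,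
            fun h => (hQ.mem_or_mem h).elim hvQ hwQ⟩
          rcases Finset.mem_insert.1 hP' with rfl | hP'
          exacts [Ideal.mul_mem_left _ _ hwP, Ideal.mul_mem_right _ _ (hvG P' hP')]
      exact h1 F subset_rfl
    obtain ⟨f, hf, v, hv, hvF, hvQ⟩ := key
    -- The exponents are exchanged so that both terms have degree `e * f`.
    refine ⟨e * f, Nat.mul_pos he hf, u ^ f + v ^ e, add_mem ?_ ?_, fun P hP h => ?_⟩
    · have := SetLike.pow_mem_graded f hu
      rwa [smul_eq_mul, mul_comm] at this
    · have := SetLike.pow_mem_graded e hv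
      rwa [smul_eq_mul] at this
    · rcases Finset.mem_insert.1 hP with rfl | hPF
      · have h1 : v ^ e ∈ P := (Ideal.add_mem_iff_right P (Ideal.pow_mem_of_mem P huQ f hf)).1 h
        exact hvQ (hQ.mem_of_pow_mem e h1)
      · have h1 : u ^ f ∈ P :=
          (Ideal.add_mem_iff_left P (Ideal.pow_mem_of_mem P (hvF P hPF) e he)).1 h
        exact huF P hPF ((hprime P hP).mem_of_pow_mem f h1)


/-- Dimension is bounded through chains of primes over `J`. A homogeneous element avoiding the
minimal primes of `J` other than `𝔪` lowers the bound by one. At bound 0 every minimal prime, being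
homogeneous and thus inside `𝔪`, equals `𝔪`. -/
lemma exists_homogeneous_le_radical [Nontrivial R] [IsNoetherianRing R] (h0 : 𝒜 0 = 1) (n : ℕ) :
    ∀ J : Ideal R, J.IsHomogeneous 𝒜 →
      (∀ l : LTSeries (PrimeSpectrum.zeroLocus (J : Set R)), l.length ≤ n) →
      ∃ y : ℕ → R, (∀ j, ∃ e > 0, y j ∈ 𝒜 e) ∧
        homogeneousMaximalIdeal 𝒜 ≤ (J ⊔ Ideal.span (y '' Set.Iio n)).radical := by
  have hmax := homogeneousMaximalIdeal_isMaximal (𝒜 := 𝒜) h0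
  induction n with
  | zero =>
    intro J hJ hdim
    refine ⟨0, fun j => ⟨1, one_pos, zero_mem _⟩, ?_⟩
    have h1 : ∀ P ∈ J.minimalPrimes, homogeneousMaximalIdeal 𝒜 ≤ P := by
      intro P hP
      have h2 := (Ideal.isHomogeneous_of_mem_minimalPrimes hJ hP).le_homogeneousMaximalIdeal h0
        hP.1.1.ne_top
      by_contra h
      have h3 : P < homogeneousMaximalIdeal 𝒜 := lt_of_le_not_ge h2 h
      let p : PrimeSpectrum.zeroLocus (J : Set R) := ⟨⟨P, hP.1.1⟩, hP.1.2⟩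
      let q : PrimeSpectrum.zeroLocus (J : Set R) :=
        ⟨⟨homogeneousMaximalIdeal 𝒜, hmax.isPrime⟩, hP.1.2.trans h2⟩
      have hpq : p < q := h3
      let l : LTSeries (PrimeSpectrum.zeroLocus (J : Set R)) := (RelSeries.singleton _ q).cons p hpq
      have h4 := hdim l
      have h5 : l.length = 0 + 1 := RelSeries.cons_length _ _ _
      omega
    refine le_trans ?_ (Ideal.radical_mono le_sup_left)
    rw [← Ideal.sInf_minimalPrimes]
    exact le_sInf h1
  | succ n ih =>
    intro J hJ hdim
    have hfin : {P ∈ J.minimalPrimes | P ≠ homogeneousMaximalIdeal 𝒜}.Finite :=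
      (Ideal.finite_minimalPrimes_of_isNoetherianRing R J).subset fun P hP => hP.1
    obtain ⟨e, he, x, hx, hxF⟩ := exists_homogeneous_notMem (𝒜 := 𝒜) hfin.toFinset
      (fun P hP => (hfin.mem_toFinset.1 hP).1.1.1)
      (fun P hP => Ideal.isHomogeneous_of_mem_minimalPrimes hJ (hfin.mem_toFinset.1 hP).1)
      (fun P hP Q hQ h => le_antisymm h ((hfin.mem_toFinset.1 hQ).1.2 (hfin.mem_toFinset.1 hP).1.1 h))
      (fun P hP h => (hfin.mem_toFinset.1 hP).2
        (hmax.eq_of_le (hfin.mem_toFinset.1 hP).1.1.1.ne_top h).symm)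
    obtain ⟨y, hy, hyr⟩ := ih (J ⊔ Ideal.span {x})
      (hJ.sup (Ideal.homogeneous_span 𝒜 _ (by rintro _ rfl; exact ⟨e, hx⟩))) (fun l => by
        rcases Nat.eq_zero_or_pos l.length with hl | hl
        · omega
        have hJl : J ≤ l.head.1.asIdeal := le_sup_left.trans l.head.2
        have hxl : x ∈ l.head.1.asIdeal :=
          l.head.2 (Ideal.mem_sup_right (Ideal.mem_span_singleton_self x))
        have := l.head.1.isPrime
        obtain ⟨q, hq, hql⟩ := Ideal.exists_minimalPrimes_le hJl
        have hsub : ∀ p : PrimeSpectrum.zeroLocus ((J ⊔ Ideal.span {x} : Ideal R) : Set R),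
            p.1 ∈ PrimeSpectrum.zeroLocus (J : Set R) :=
          fun p => (le_sup_left : J ≤ J ⊔ Ideal.span {x}).trans p.2
        let q' : PrimeSpectrum.zeroLocus (J : Set R) := ⟨⟨q, hq.1.1⟩, hq.1.2⟩
        let l' : LTSeries (PrimeSpectrum.zeroLocus (J : Set R)) :=
          l.map (fun p => ⟨p.1, hsub p⟩) (fun _ _ h => h)
        -- A chain over `J + (x)` is prolonged downwards by a minimal prime `q` of `J`. Equality is
        -- excluded: `x` avoids `q` unless `q = 𝔪`, and a chain of positive length cannot start at a
        -- maximal ideal.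
        have hlt : q < l.head.1.asIdeal := by
          refine lt_of_le_of_ne hql fun h => ?_
          by_cases hqm : q = homogeneousMaximalIdeal 𝒜
          · have h1 : l.head < l.last := l.strictMono (Fin.lt_def.2 hl)
            have h2 : l.head.1.asIdeal < l.last.1.asIdeal := h1
            rw [← h, hqm] at h2
            exact l.last.1.isPrime.ne_top (hmax.1.2 _ h2)
          · exact hxF q (hfin.mem_toFinset.2 ⟨hq, hqm⟩) (h ▸ hxl)
        have hlt' : q' < l'.head := hlt
        have := hdim (l'.cons q' hlt')
        have h2 : (l'.cons q' hlt').length = l.length + 1 := RelSeries.cons_length _ _ _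
        omega)
    refine ⟨fun j => Nat.casesOn j x y, fun j => ?_, hyr.trans (Ideal.radical_mono ?_)⟩
    · cases j
      exacts [⟨e, he, hx⟩, hy _]
    · refine sup_le (sup_le le_sup_left ?_) ?_
      · refine le_trans ?_ le_sup_right
        rw [Ideal.span_singleton_le_iff_mem]
        exact Ideal.subset_span ⟨0, Nat.succ_pos n, rfl⟩
      · refine le_trans (Ideal.span_mono ?_) le_sup_right
        rintro _ ⟨j, hj, rfl⟩
        exact ⟨j + 1, Nat.succ_lt_succ hj, rfl⟩

lemma exists_homogeneous_parameters [Nontrivial R] [IsNoetherianRing R] (h0 : 𝒜 0 = 1) {d : ℕ}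
    (hd : ringKrullDim R = d) :
    ∃ y : ℕ → R, (∀ j, ∃ e > 0, y j ∈ 𝒜 e) ∧
      homogeneousMaximalIdeal 𝒜 ≤ (Ideal.span (y '' Set.Iio d)).radical := by
  obtain ⟨y, hy, h⟩ := exists_homogeneous_le_radical h0 d ⊥ (Ideal.IsHomogeneous.bot 𝒜) (fun l => by
    have h1 : ((l.map Subtype.val (fun _ _ h => h) : LTSeries (PrimeSpectrum R)).length : WithBot ℕ∞)
      ≤ d := hd ▸ Order.LTSeries.length_le_krullDim _
    exact_mod_cast h1)
  exact ⟨y, hy, by rwa [bot_sup_eq] at h⟩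

end GradedRings

end

/-! ### Graded Nakayama, Noether normalization and dimension. -/

section

open GradedAlgebra

section GradedGeneration

variable {K R : Type u} [Field K] [CommRing R] [Algebra K R] {𝒜 : ℕ → Submodule K R}
  [GradedAlgebra 𝒜] {d : ℕ} {y : Fin d → R}

lemma proj_mem_span {W : Set R} (hW : ∀ w ∈ W, ∃ n, w ∈ 𝒜 n) {w : R}
    (hw : w ∈ Submodule.span K W) (n : ℕ) : proj 𝒜 n w ∈ Submodule.span K W := by
  induction hw using Submodule.span_induction with
  | mem x hx =>
    obtain ⟨m, hm⟩ := hW x hx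
    by_cases h : m = n
    · subst h
      rw [proj_of_mem hm]; exact Submodule.subset_span hx
    · rw [proj_of_mem_ne hm h]; exact zero_mem _
  | zero => rw [map_zero]; exact zero_mem _
  | add a b _ _ ha hb => rw [map_add]; exact add_mem ha hb
  | smul c a _ ha => rw [map_smul]; exact Submodule.smul_mem _ _ ha

/-- A graded Nakayama lemma: a subspace stable under multiplication by the `y j` and containing
homogeneous generators modulo `(y)` is everything. -/
lemma eq_top_of_graded_generators (hy : ∀ j, ∃ e > 0, y j ∈ 𝒜 e) {W : Set R}
    (hW : ∀ w ∈ W, ∃ n, w ∈ 𝒜 n)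
    (h : ∀ r, ∃ w ∈ Submodule.span K W, r - w ∈ Ideal.span (Set.range y))
    {N : Submodule K R} (hWN : W ⊆ N) (hyN : ∀ j, ∀ x ∈ N, y j * x ∈ N) : N = ⊤ := by
  have key : ∀ n, ∀ r ∈ 𝒜 n, r ∈ N := by
    intro n
    induction n using Nat.strong_induction_on with
    | _ n ih =>
      intro r hr
      obtain ⟨w, hw, hrw⟩ := h r
      obtain ⟨c, hc⟩ := Ideal.mem_span_range_iff_exists_fun.1 hrw
      have h1 : r = proj 𝒜 n w + ∑ j, proj 𝒜 n (c j * y j) := by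
        rw [← map_sum, hc, ← map_add, add_sub_cancel, proj_of_mem hr]
      rw [h1]
      refine add_mem (Submodule.span_le.2 hWN (proj_mem_span hW hw n)) (sum_mem fun j _ => ?_)
      obtain ⟨e, he, hye⟩ := hy j
      rw [mul_comm]
      rcases lt_or_ge n e with hne | hne
      · rw [proj_mul_of_left_mem_of_lt hye hne]; exact zero_mem _
      · obtain ⟨k, rfl⟩ := Nat.exists_eq_add_of_le hne
        rw [proj_add_mul_of_left_mem hye]
        exact hyN j _ (ih k (by omega) _ (proj_mem 𝒜 k _))
  refine eq_top_iff.2 fun x _ => ?_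
  obtain ⟨s, hs⟩ := exists_eq_sum_proj 𝒜 x
  rw [hs]
  exact sum_mem fun n _ => key n _ (proj_mem 𝒜 n x)

/-- Modulo `I` every element is a scalar plus a nilpotent, hence integral over `K`; a finitely
generated integral algebra is finite. -/
lemma finite_quotient_of_le_radical [Algebra.FiniteType K R] (h0 : 𝒜 0 = 1) {I : Ideal R}
    (hI : homogeneousMaximalIdeal 𝒜 ≤ I.radical) : Module.Finite K (R ⧸ I) := by
  have : Algebra.IsIntegral K (R ⧸ I) := by
    refine ⟨fun x => ?_⟩
    obtain ⟨x, rfl⟩ := Ideal.Quotient.mk_surjective x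
    obtain ⟨c, hc⟩ := exists_sub_algebraMap_mem h0 x
    obtain ⟨n, hn⟩ := hI hc
    have h1 : IsIntegral K (Ideal.Quotient.mk I (x - algebraMap K R c)) := by
      refine IsIntegral.of_pow (n := n + 1) n.succ_pos ?_
      rw [← map_pow, Ideal.Quotient.eq_zero_iff_mem.2 (pow_succ (x - algebraMap K R c) n ▸
        Ideal.mul_mem_right _ _ hn)]
      exact isIntegral_zero
    have h2 : Ideal.Quotient.mk I x
        = Ideal.Quotient.mk I (x - algebraMap K R c) + algebraMap K (R ⧸ I) c := by
      rw [map_sub]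
      exact (sub_add_cancel _ _).symm
    rw [h2]
    exact h1.add isIntegral_algebraMap
  exact Algebra.IsIntegral.finite

/-- The homogeneous components of lifts of `K`-generators of `R/(y)` generate `R` over the
polynomial ring, by graded Nakayama. -/
lemma finite_of_parameters [Algebra.FiniteType K R] (h0 : 𝒜 0 = 1)
    (hy : ∀ j, ∃ e > 0, y j ∈ 𝒜 e)
    (hrad : homogeneousMaximalIdeal 𝒜 ≤ (Ideal.span (Set.range y)).radical)
    [Algebra (MvPolynomial (Fin d) K) R] [IsScalarTower K (MvPolynomial (Fin d) K) R]
    (hX : ∀ j, algebraMap (MvPolynomial (Fin d) K) R (MvPolynomial.X j) = y j) :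
    Module.Finite (MvPolynomial (Fin d) K) R := by
  classical
  have := finite_quotient_of_le_radical h0 hrad
  obtain ⟨s, hs⟩ := Module.Finite.fg_top (R := K) (M := R ⧸ Ideal.span (Set.range y))
  choose g hg using Ideal.Quotient.mk_surjective (I := Ideal.span (Set.range y))
  choose σ hσ using exists_eq_sum_proj 𝒜
  let W : Finset R := s.biUnion fun t => (σ (g t)).image fun n => proj 𝒜 n (g t)
  have hW : ∀ w ∈ (W : Set R), ∃ n, w ∈ 𝒜 n := by
    intro w hw
    obtain ⟨t, -, hw⟩ := Finset.mem_biUnion.1 hw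
    obtain ⟨n, -, rfl⟩ := Finset.mem_image.1 hw
    exact ⟨n, proj_mem 𝒜 n _⟩
  have hspan : ∀ r, ∃ w ∈ Submodule.span K (W : Set R), r - w ∈ Ideal.span (Set.range y) := by
    intro r
    have h1 : Submodule.span K (s : Set (R ⧸ Ideal.span (Set.range y))) ≤
        (Submodule.span K (W : Set R)).map
          (Ideal.Quotient.mkₐ K (Ideal.span (Set.range y))).toLinearMap := by
      refine Submodule.span_le.2 fun t ht => ⟨g t, ?_, hg t⟩
      rw [hσ (g t)]
      exact sum_mem fun n hn => Submodule.subset_span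
        (Finset.mem_biUnion.2 ⟨t, ht, Finset.mem_image.2 ⟨n, hn, rfl⟩⟩)
    obtain ⟨w, hw, hwr⟩ := h1 (hs ▸ Submodule.mem_top : Ideal.Quotient.mk _ r ∈ _)
    exact ⟨w, hw, Ideal.Quotient.eq.1 hwr.symm⟩
  have htop := eq_top_of_graded_generators hy hW hspan
    (N := (Submodule.span (MvPolynomial (Fin d) K) (W : Set R)).restrictScalars K)
    Submodule.subset_span (fun j x hx => by
      rw [← hX, ← Algebra.smul_def]
      exact Submodule.smul_mem (Submodule.span (MvPolynomial (Fin d) K) (W : Set R)) _ hx)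
  refine ⟨W, ?_⟩
  rw [eq_top_iff] at htop ⊢
  exact htop

lemma algebraMap_surjective_of_generators (h0 : 𝒜 0 = 1) (hy : ∀ j, ∃ e > 0, y j ∈ 𝒜 e)
    (hm : homogeneousMaximalIdeal 𝒜 ≤ Ideal.span (Set.range y))
    [Algebra (MvPolynomial (Fin d) K) R] [IsScalarTower K (MvPolynomial (Fin d) K) R]
    (hX : ∀ j, algebraMap (MvPolynomial (Fin d) K) R (MvPolynomial.X j) = y j) :
    Function.Surjective (algebraMap (MvPolynomial (Fin d) K) R) := by
  have htop := eq_top_of_graded_generators (𝒜 := 𝒜) hy (W := {1})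
    (N := LinearMap.range (IsScalarTower.toAlgHom K (MvPolynomial (Fin d) K) R).toLinearMap)
    (by rintro _ rfl; exact ⟨0, SetLike.GradedOne.one_mem⟩)
    (fun r => by
      obtain ⟨c, hc⟩ := exists_sub_algebraMap_mem h0 r
      refine ⟨algebraMap K R c, ?_, hm hc⟩
      rw [Algebra.algebraMap_eq_smul_one]
      exact Submodule.smul_mem _ _ (Submodule.subset_span rfl))
    (by rintro _ rfl; exact ⟨1, map_one (algebraMap (MvPolynomial (Fin d) K) R)⟩)
    (by
      rintro j _ ⟨a, rfl⟩
      refine ⟨MvPolynomial.X j * a, ?_⟩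
      rw [← hX]
      exact map_mul (algebraMap (MvPolynomial (Fin d) K) R) _ _)
  intro x
  obtain ⟨a, ha⟩ := htop.ge (Submodule.mem_top : x ∈ ⊤)
  exact ⟨a, ha⟩

end GradedGeneration

/-- Incomparability: contraction along an integral map is strictly monotone on primes. Injectivity
is not needed. -/
lemma ringKrullDim_le_of_isIntegral (A B : Type*) [CommRing A] [CommRing B] [Algebra A B]
    [Algebra.IsIntegral A B] : ringKrullDim B ≤ ringKrullDim A := by
  refine Order.krullDim_le_of_strictMono (PrimeSpectrum.comap (algebraMap A B)) fun p q h => ?_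
  have := p.isPrime
  exact Ideal.IsIntegral.comap_lt_comap (R := A) (show p.asIdeal < q.asIdeal from h)

section Dimension

variable {K R : Type u} [Field K] [CommRing R] {d : ℕ}

lemma MvPolynomial.ringKrullDim_field (n : ℕ) : ringKrullDim (MvPolynomial (Fin n) K) = n := by
  rw [MvPolynomial.ringKrullDim_of_isNoetherianRing, ringKrullDim_eq_zero_of_field, zero_add,
    Nat.card_eq_fintype_card, Fintype.card_fin]

/-- A nonzero `f` in the kernel would make `R` integral over `K[X]/(f)`, whose dimension is less
than `d`. -/
lemma algebraMap_injective_of_ringKrullDim [Algebra (MvPolynomial (Fin d) K) R]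
    [Module.Finite (MvPolynomial (Fin d) K) R] (hd : ringKrullDim R = d) :
    Function.Injective (algebraMap (MvPolynomial (Fin d) K) R) := by
  rw [injective_iff_map_eq_zero]
  intro f hf
  by_contra hne
  have h1 := ringKrullDim_quotient_succ_le_of_nonZeroDivisor (mem_nonZeroDivisors_of_ne_zero hne)
  let φ : MvPolynomial (Fin d) K ⧸ Ideal.span {f} →+* R :=
    Ideal.Quotient.lift (Ideal.span {f}) (algebraMap (MvPolynomial (Fin d) K) R) (fun a ha => by
      obtain ⟨b, rfl⟩ := Ideal.mem_span_singleton.1 ha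
      rw [map_mul, hf, zero_mul])
  let _ := φ.toAlgebra
  have : Algebra.IsIntegral (MvPolynomial (Fin d) K ⧸ Ideal.span {f}) R := by
    refine algebraMap_isIntegral_iff.1 (RingHom.IsIntegral.tower_top
      (Ideal.Quotient.mk (Ideal.span {f})) φ ?_)
    exact algebraMap_isIntegral_iff.2 (inferInstance : Algebra.IsIntegral (MvPolynomial (Fin d) K) R)
  have h2 := ringKrullDim_le_of_isIntegral (MvPolynomial (Fin d) K ⧸ Ideal.span {f}) R
  rw [MvPolynomial.ringKrullDim_field] at h1
  have h3 : ((d + 1 : ℕ) : WithBot ℕ∞) ≤ (d : ℕ) := by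
    push_cast
    exact (add_le_add (hd ▸ h2) le_rfl).trans h1
  have h4 : d + 1 ≤ d := by exact_mod_cast h3
  omega

end Dimension

/-! ### Homogeneous coordinates on a graded polynomial ring. -/

section PolynomialRing

variable {K R : Type u} [Field K] [CommRing R] [Algebra K R] {𝒜 : ℕ → Submodule K R}
  [GradedAlgebra 𝒜]

/-- The isomorphism need not respect the grading, so the variables are translated by constants into
`𝔪`. Every element is then a constant modulo the translated variables, and the only constant in `𝔪`
is 0. -/
lemma exists_span_range_eq_of_algEquiv [Nontrivial R] (h0 : 𝒜 0 = 1) {n : ℕ}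
    (e : R ≃ₐ[K] MvPolynomial (Fin n) K) :
    ∃ g : Fin n → R, homogeneousMaximalIdeal 𝒜 = Ideal.span (Set.range g) := by
  choose c hc using exists_sub_algebraMap_mem (𝒜 := 𝒜) h0
  let g : Fin n → R := fun i => e.symm (.X i) - algebraMap K R (c (e.symm (.X i)))
  refine ⟨g, le_antisymm ?_ (Ideal.span_le.2 ?_)⟩
  swap
  · rintro _ ⟨i, rfl⟩
    exact hc _
  have key : ∀ p : MvPolynomial (Fin n) K, ∃ a : K,
      e.symm p - algebraMap K R a ∈ Ideal.span (Set.range g) := by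
    intro p
    induction p using MvPolynomial.induction_on with
    | C a =>
      refine ⟨a, ?_⟩
      have : e.symm (MvPolynomial.C a) = algebraMap K R a := e.symm.commutes a
      rw [this, sub_self]
      exact zero_mem _
    | add p q hp hq =>
      obtain ⟨a, ha⟩ := hp
      obtain ⟨b, hb⟩ := hq
      refine ⟨a + b, ?_⟩
      have := add_mem ha hb
      rw [map_add, map_add]
      convert this using 1
      ring
    | mul_X p i hp =>
      obtain ⟨a, ha⟩ := hp
      refine ⟨a * c (e.symm (.X i)), ?_⟩
      have h1 := Ideal.mul_mem_right (e.symm (.X i)) _ ha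
      have h2 := Ideal.mul_mem_left _ (algebraMap K R a)
        (Ideal.subset_span (Set.mem_range_self i) : g i ∈ Ideal.span (Set.range g))
      have := add_mem h1 h2
      rw [map_mul, map_mul]
      convert this using 1
      simp only [g]
      ring
  intro x hx
  obtain ⟨a, ha⟩ := key (e x)
  rw [e.symm_apply_apply] at ha
  have hle : Ideal.span (Set.range g) ≤ homogeneousMaximalIdeal 𝒜 := by
    refine Ideal.span_le.2 ?_
    rintro _ ⟨i, rfl⟩
    exact hc _
  have h1 : algebraMap K R a ∈ homogeneousMaximalIdeal 𝒜 := by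
    have := sub_mem hx (hle ha)
    rwa [sub_sub_cancel] at this
  have h2 : a = 0 := by
    by_contra h
    exact algebraMap_notMem h h1
  rwa [h2, map_zero, sub_zero] at ha

/-- Nakayama by induction on degree: the degree `n` part of an element of `𝔪²` involves only
components of `𝔪` of degree strictly between 0 and `n`. -/
lemma le_span_of_le_sup_sq {J : Ideal R} (hJ : J.IsHomogeneous 𝒜)
    (h : homogeneousMaximalIdeal 𝒜 ≤
      J ⊔ homogeneousMaximalIdeal 𝒜 * homogeneousMaximalIdeal 𝒜) :
    homogeneousMaximalIdeal 𝒜 ≤ J := by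
  have key : ∀ n > 0, ∀ x ∈ 𝒜 n, x ∈ J := by
    intro n
    induction n using Nat.strong_induction_on with
    | _ n ih =>
      intro hn x hx
      obtain ⟨a, ha, b, hb, hab⟩ := Submodule.mem_sup.1 (h (mem_homogeneousMaximalIdeal_of_mem hn hx))
      have hb' : proj 𝒜 n b ∈ J := by
        clear hab
        refine Submodule.mul_induction_on hb (fun p hp q hq => ?_) fun p q hp hq => by
          rw [map_add]; exact add_mem hp hq
        rw [mem_homogeneousMaximalIdeal_iff] at hp hq
        rw [proj_mul]
        refine sum_mem fun ij hij => ?_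
        rw [Finset.HasAntidiagonal.mem_antidiagonal] at hij
        rcases Nat.eq_zero_or_pos ij.1 with h1 | h1
        · rw [h1, hp, zero_mul]; exact zero_mem _
        rcases Nat.eq_zero_or_pos ij.2 with h2 | h2
        · rw [h2, hq, mul_zero]; exact zero_mem _
        exact Ideal.mul_mem_right _ _ (ih ij.1 (by omega) h1 _ (proj_mem 𝒜 _ _))
      rw [← proj_of_mem hx, ← hab, map_add]
      exact add_mem (hJ.proj_mem ha n) hb'
  intro x hx
  obtain ⟨s, hs⟩ := exists_eq_sum_proj 𝒜 x
  rw [hs]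
  refine sum_mem fun n _ => ?_
  rcases Nat.eq_zero_or_pos n with rfl | hn
  · rw [mem_homogeneousMaximalIdeal_iff.1 hx]; exact zero_mem _
  · exact key n hn _ (proj_mem 𝒜 n x)

lemma Set.Finite.exists_fin_enumeration {α : Type*} [Zero α] {b : Set α} {n : ℕ} (hb : b.Finite)
    (hn : b.ncard ≤ n) : ∃ f : Fin n → α, b ⊆ Set.range f ∧ ∀ i, f i = 0 ∨ f i ∈ b := by
  classical
  have := hb.fintype
  let e := Fintype.equivFin b
  have hcard : Fintype.card b ≤ n := by rwa [← Set.toFinset_card, ← Set.ncard_eq_toFinset_card']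
  refine ⟨fun i => if h : (i : ℕ) < Fintype.card b then e.symm ⟨i, h⟩ else 0, fun x hx => ?_,
    fun i => ?_⟩
  · refine ⟨⟨e ⟨x, hx⟩, (e ⟨x, hx⟩).2.trans_le hcard⟩, ?_⟩
    refine (dif_pos (e ⟨x, hx⟩).2).trans ?_
    rw [Fin.eta, e.symm_apply_apply]
  · by_cases h : (i : ℕ) < Fintype.card b
    · refine Or.inr ?_
      beta_reduce
      rw [dif_pos h]
      exact Subtype.coe_prop _
    · exact Or.inl (dif_neg h)

/-- The space `𝔪/𝔪²` is spanned by the `n` classes of `g` and also by homogeneous classes. A basis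
chosen among the latter has at most `n` members; its homogeneous lifts, padded with zeros, generate
`𝔪` by Nakayama. -/
lemma exists_homogeneous_generators [Nontrivial R] (h0 : 𝒜 0 = 1) {n : ℕ} {g : Fin n → R}
    (hg : homogeneousMaximalIdeal 𝒜 = Ideal.span (Set.range g)) :
    ∃ y : Fin n → R, (∀ j, ∃ e > 0, y j ∈ 𝒜 e) ∧
      homogeneousMaximalIdeal 𝒜 ≤ Ideal.span (Set.range y) := by
  classical
  let M2 : Submodule K R :=
    (homogeneousMaximalIdeal 𝒜 * homogeneousMaximalIdeal 𝒜).restrictScalars K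
  let π : R →ₗ[K] R ⧸ M2 := M2.mkQ
  let s : Set (R ⧸ M2) := π '' {x | ∃ e > 0, x ∈ 𝒜 e}
  obtain ⟨b, hbs, hspan, hli⟩ := exists_linearIndependent K s
  have hmem : ∀ x ∈ homogeneousMaximalIdeal 𝒜, π x ∈ Submodule.span K (Set.range (π ∘ g)) := by
    intro x hx
    rw [hg] at hx
    obtain ⟨c, rfl⟩ := Ideal.mem_span_range_iff_exists_fun.1 hx
    rw [map_sum]
    refine sum_mem fun i _ => ?_
    obtain ⟨a, ha⟩ := exists_sub_algebraMap_mem (𝒜 := 𝒜) h0 (c i)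
    have h1 : π (c i * g i) = a • π (g i) := by
      rw [← map_smul, ← sub_eq_zero, ← map_sub, Algebra.smul_def, ← sub_mul]
      exact (Submodule.Quotient.mk_eq_zero _).2 (Ideal.mul_mem_mul ha
        (hg ▸ Ideal.subset_span (Set.mem_range_self i)))
    rw [h1]
    exact Submodule.smul_mem _ _ (Submodule.subset_span ⟨i, rfl⟩)
  have hle : Set.range (Subtype.val : b → R ⧸ M2) ≤ Submodule.span K (Set.range (π ∘ g)) := by
    rintro _ ⟨⟨x, hx⟩, rfl⟩
    obtain ⟨x, ⟨e, he, hxe⟩, rfl⟩ := hbs hx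
    exact hmem x (mem_homogeneousMaximalIdeal_of_mem he hxe)
  have hcard := linearIndependent_le_span' _ hli _ hle
  have hb : b.Finite := Cardinal.lt_aleph0_iff_set_finite.1 (hcard.trans_lt (Cardinal.natCast_lt_aleph0))
  have hncard : b.ncard ≤ n := by
    have h1 : Cardinal.mk b = (b.ncard : Cardinal) := (Set.cast_ncard hb).symm
    rw [h1] at hcard
    refine (Nat.cast_le.1 hcard).trans ?_
    calc _ ≤ Fintype.card (Fin n) := Fintype.card_range_le _
      _ = n := Fintype.card_fin n
  obtain ⟨f, hbf, hf⟩ := hb.exists_fin_enumeration hncard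
  have hlift : ∀ i, ∃ x, (∃ e > 0, x ∈ 𝒜 e) ∧ π x = f i := by
    intro i
    rcases hf i with h | h
    · exact ⟨0, ⟨1, one_pos, zero_mem _⟩, by rw [h, map_zero]⟩
    · exact hbs h
  choose y hy hyf using hlift
  refine ⟨y, hy, le_span_of_le_sup_sq (Ideal.homogeneous_span 𝒜 _ ?_) ?_⟩
  · rintro _ ⟨i, rfl⟩
    obtain ⟨e, -, he⟩ := hy i
    exact ⟨e, he⟩
  · intro x hx
    have h1 : π x ∈ Submodule.span K s := by
      obtain ⟨t, ht⟩ := exists_eq_sum_proj 𝒜 x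
      rw [ht, map_sum]
      refine sum_mem fun m _ => ?_
      rcases Nat.eq_zero_or_pos m with rfl | hm
      · rw [mem_homogeneousMaximalIdeal_iff.1 hx, map_zero]; exact zero_mem _
      · exact Submodule.subset_span ⟨_, ⟨m, hm, proj_mem 𝒜 m x⟩, rfl⟩
    have h2 : Submodule.span K b ≤ (Submodule.span K (Set.range y)).map π := by
      rw [Submodule.map_span]
      refine Submodule.span_mono fun z hz => ?_
      obtain ⟨i, rfl⟩ := hbf hz
      exact ⟨y i, ⟨i, rfl⟩, hyf i⟩
    obtain ⟨w, hw, hwx⟩ := h2 (hspan ▸ h1)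
    have hw' : w ∈ Ideal.span (Set.range y) := by
      have : Submodule.span K (Set.range y) ≤ (Ideal.span (Set.range y)).restrictScalars K :=
        Submodule.span_le.2 Submodule.subset_span
      exact this hw
    have h3 : x - w ∈ M2 := by
      rw [← Submodule.Quotient.mk_eq_zero]
      exact (map_sub π x w).trans (sub_eq_zero.2 hwx.symm)
    rw [← add_sub_cancel w x]
    exact add_mem (Ideal.mem_sup_left hw') (Ideal.mem_sup_right h3)

end PolynomialRing

end

section

/-! ### Functionals on finite torsion-free modules. -/

section TorsionFree

open scoped nonZeroDivisors

/-- Nonzero elements of finitely generated torsion-free modules over a domain are detected by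
linear functionals. -/
lemma exists_linearMap_apply_ne_zero {D M : Type*} [CommRing D] [IsDomain D] [AddCommGroup M]
    [Module D M] [Module.Finite D M] (htf : ∀ (a : D) (m : M), a • m = 0 → a = 0 ∨ m = 0)
    {m : M} (hm : m ≠ 0) : ∃ f : M →ₗ[D] D, f m ≠ 0 := by
  classical
  let F := FractionRing D
  let ι := LocalizedModule.mkLinearMap D⁰ M
  have h1 : ι m ≠ 0 := by
    intro h
    obtain ⟨c, hc⟩ := (IsLocalizedModule.eq_zero_iff D⁰ ι).1 h
    exact (htf c m hc).elim (nonZeroDivisors.ne_zero c.2) hm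
  obtain ⟨g, hg⟩ : ∃ g : Module.Dual F (LocalizedModule D⁰ M), g (ι m) ≠ 0 := by
    by_contra h
    push Not at h
    exact h1 ((Module.forall_dual_apply_eq_zero_iff F (ι m)).1 h)
  let g' : M →ₗ[D] F := (g.restrictScalars D).comp ι
  obtain ⟨s, hs⟩ := Module.Finite.fg_top (R := D) (M := M)
  obtain ⟨b, hb⟩ := IsLocalization.exist_integer_multiples D⁰ s g'
  have hrange : ∀ x, ((b : D) • g') x ∈ LinearMap.range (Algebra.linearMap D F) := by
    have h2 : (⊤ : Submodule D M) ≤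
        (LinearMap.range (Algebra.linearMap D F)).comap ((b : D) • g') := by
      rw [← hs, Submodule.span_le]
      intro x hx
      exact hb x hx
    exact fun x => h2 Submodule.mem_top
  let e := LinearEquiv.ofInjective (Algebra.linearMap D F) (IsFractionRing.injective D F)
  refine ⟨e.symm.toLinearMap.comp (LinearMap.codRestrict _ ((b : D) • g') hrange), fun h => ?_⟩
  have h2 : (LinearMap.codRestrict _ ((b : D) • g') hrange) m = 0 :=
    (map_eq_zero_iff e.symm e.symm.injective).1 h
  have h3 : (b : D) • g' m = 0 := congrArg Subtype.val h2
  rw [Algebra.smul_def, mul_eq_zero] at h3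
  refine h3.elim (fun h4 => ?_) hg
  exact nonZeroDivisors.ne_zero b.2 ((map_eq_zero_iff _ (IsFractionRing.injective D F)).1 h4)

end TorsionFree

/-! ### Fractions representing nonzero top Čech classes. -/

section TopClass

variable {S : Type*} [CommRing S] {d : ℕ}

/-- The element `s / (z₁ ⋯ z_d) ^ t` represents a nonzero class in top Čech cohomology. -/
def IsTopClass (z : Fin d → S) (t : ℕ) (s : S) : Prop :=
  ∀ n, (∏ j, z j) ^ n * s ∉ Ideal.span (Set.range fun j => z j ^ (t + n))

lemma prod_pow_mul_mem_span_mono {z : Fin d → S} {t n m : ℕ} {s : S} (h : n ≤ m)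
    (hs : (∏ j, z j) ^ n * s ∈ Ideal.span (Set.range fun j => z j ^ (t + n))) :
    (∏ j, z j) ^ m * s ∈ Ideal.span (Set.range fun j => z j ^ (t + m)) := by
  obtain ⟨k, rfl⟩ := Nat.exists_eq_add_of_le h
  rw [add_comm n k, pow_add, mul_assoc]
  obtain ⟨c, hc⟩ := Ideal.mem_span_range_iff_exists_fun.1 hs
  rw [← hc, Finset.mul_sum]
  refine sum_mem fun j _ => ?_
  have h2 : (∏ j, z j) ^ k * (c j * z j ^ (t + n)) =
      (c j * (∏ i ∈ Finset.univ.erase j, z i) ^ k) * z j ^ (t + (k + n)) := by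
    rw [← Finset.mul_prod_erase _ _ (Finset.mem_univ j), mul_pow]
    ring
  rw [h2]
  exact Ideal.mul_mem_left _ _ (Ideal.subset_span ⟨j, rfl⟩)

/-- The fraction is unchanged; its denominator only gets a positive exponent. -/
lemma IsTopClass.mul_prod {z : Fin d → S} {t : ℕ} {s : S} (h : IsTopClass z t s) :
    IsTopClass z (t + 1) ((∏ j, z j) * s) := by
  intro n hn
  refine h (n + 1) ?_
  rw [pow_succ, mul_assoc]
  convert hn using 5
  omega

/-- Vanishing persists at later levels, so finitely many vanishing summands vanish at a common one.
This allows passing to a homogeneous component. -/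
lemma IsTopClass.exists_of_sum {z : Fin d → S} {t : ℕ} {ι : Type*} {a : Finset ι} {f : ι → S}
    (h : IsTopClass z t (∑ i ∈ a, f i)) : ∃ i ∈ a, IsTopClass z t (f i) := by
  classical
  by_contra hc
  unfold IsTopClass at hc
  push Not at hc
  choose! n hn using hc
  refine h (a.sup n) ?_
  rw [Finset.mul_sum]
  exact sum_mem fun i hi => prod_pow_mul_mem_span_mono (Finset.le_sup hi) (hn i hi)

end TopClass

section MonomialIdeals

variable {K : Type*} [Field K] {d : ℕ}

lemma MvPolynomial.exists_le_of_mem_span_pow {f : MvPolynomial (Fin d) K} {m : ℕ}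
    (hf : f ∈ Ideal.span (Set.range fun j : Fin d => (X j : MvPolynomial (Fin d) K) ^ m))
    {a : Fin d →₀ ℕ} (ha : coeff a f ≠ 0) : ∃ j, m ≤ a j := by
  have h1 : (Set.range fun j : Fin d => (X j : MvPolynomial (Fin d) K) ^ m) =
      (fun s => monomial s (1 : K)) '' (Set.range fun j => Finsupp.single j m) := by
    rw [← Set.range_comp]
    congr 1
    funext j
    exact X_pow_eq_monomial
  rw [h1, mem_ideal_span_monomial_image] at hf
  obtain ⟨_, ⟨j, rfl⟩, hj⟩ := hf a (mem_support_iff.2 ha)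
  exact ⟨j, by simpa using hj j⟩

lemma MvPolynomial.exists_le_of_prod_pow_mul_mem {f : MvPolynomial (Fin d) K} {t n : ℕ}
    (hf : (∏ j : Fin d, (X j : MvPolynomial (Fin d) K)) ^ n * f ∈
      Ideal.span (Set.range fun j : Fin d => (X j : MvPolynomial (Fin d) K) ^ (t + n)))
    {a : Fin d →₀ ℕ} (ha : coeff a f ≠ 0) : ∃ j, t ≤ a j := by
  have h1 : (∏ j : Fin d, (X j : MvPolynomial (Fin d) K)) ^ n =
      monomial (Finsupp.equivFunOnFinite.symm fun _ => n) 1 := by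
    rw [monomial_eq, map_one, one_mul, Finsupp.prod_fintype _ _ (fun _ => pow_zero _),
      ← Finset.prod_pow]
    rfl
  have h2 : coeff ((Finsupp.equivFunOnFinite.symm fun _ => n) + a)
      ((∏ j : Fin d, (X j : MvPolynomial (Fin d) K)) ^ n * f) ≠ 0 := by
    rw [h1, coeff_monomial_mul, one_mul]
    exact ha
  obtain ⟨j, hj⟩ := exists_le_of_mem_span_pow hf h2
  refine ⟨j, ?_⟩
  have h3 : ((Finsupp.equivFunOnFinite.symm fun _ => n) + a : Fin d →₀ ℕ) j = n + a j := rfl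
  omega

variable {S : Type*} [CommRing S] [Algebra (MvPolynomial (Fin d) K) S] {z : Fin d → S}

lemma map_mem_span_pow (hX : ∀ j, algebraMap (MvPolynomial (Fin d) K) S (.X j) = z j)
    (ψ : S →ₗ[MvPolynomial (Fin d) K] MvPolynomial (Fin d) K) {s : S} {m : ℕ}
    (hs : s ∈ Ideal.span (Set.range fun j => z j ^ m)) :
    ψ s ∈ Ideal.span (Set.range fun j : Fin d => (.X j : MvPolynomial (Fin d) K) ^ m) := by
  obtain ⟨c, rfl⟩ := Ideal.mem_span_range_iff_exists_fun.1 hs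
  rw [map_sum]
  refine sum_mem fun j _ => ?_
  have h1 : ψ (c j * z j ^ m) = (.X j : MvPolynomial (Fin d) K) ^ m * ψ (c j) := by
    rw [← hX, ← map_pow, mul_comm, ← Algebra.smul_def, map_smul, smul_eq_mul]
  rw [h1]
  exact Ideal.mul_mem_right _ _ (Ideal.subset_span ⟨j, rfl⟩)

lemma map_prod_pow_mul (hX : ∀ j, algebraMap (MvPolynomial (Fin d) K) S (.X j) = z j)
    (ψ : S →ₗ[MvPolynomial (Fin d) K] MvPolynomial (Fin d) K) (s : S) (n : ℕ) :
    ψ ((∏ j, z j) ^ n * s) = (∏ j : Fin d, (.X j : MvPolynomial (Fin d) K)) ^ n * ψ s := by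
  have h1 : (∏ j, z j) ^ n =
      algebraMap (MvPolynomial (Fin d) K) S ((∏ j : Fin d, (.X j)) ^ n) := by
    rw [map_pow, map_prod]
    simp only [hX]
  rw [h1, ← Algebra.smul_def, map_smul, smul_eq_mul]

/-- Elements on which a functional to the polynomial ring does not vanish give nonzero classes. -/
lemma exists_isTopClass_of_apply_ne_zero
    (hX : ∀ j, algebraMap (MvPolynomial (Fin d) K) S (.X j) = z j)
    (ψ : S →ₗ[MvPolynomial (Fin d) K] MvPolynomial (Fin d) K) {s : S} (hs : ψ s ≠ 0) :
    ∃ t, IsTopClass z t s := by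
  obtain ⟨a, ha⟩ := MvPolynomial.ne_zero_iff.1 hs
  -- The level strictly exceeds every exponent of a monomial occurring in `ψ s`, so that monomial
  -- cannot satisfy `t ≤ a j` for any `j`.
  refine ⟨Finset.univ.sup a + 1, fun n hn => ?_⟩
  have h1 := map_mem_span_pow hX ψ hn
  rw [map_prod_pow_mul hX] at h1
  obtain ⟨j, hj⟩ := MvPolynomial.exists_le_of_prod_pow_mul_mem h1 ha
  have := Finset.le_sup (f := a) (Finset.mem_univ j)
  omega

lemma pow_mem_span_pow_of_mem_span (p : ℕ) [Fact p.Prime] [CharP S p] {x : S} {m : ℕ}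
    (hx : x ∈ Ideal.span (Set.range fun j => z j ^ m)) (e : ℕ) :
    x ^ p ^ e ∈ Ideal.span (Set.range fun j => z j ^ (m * p ^ e)) := by
  obtain ⟨c, rfl⟩ := Ideal.mem_span_range_iff_exists_fun.1 hx
  rw [sum_pow_char_pow]
  refine sum_mem fun j _ => ?_
  rw [mul_pow, ← pow_mul]
  exact Ideal.mul_mem_left _ _ (Ideal.subset_span ⟨j, rfl⟩)

/-- In positive characteristic, the Frobenius shows that `1 / (z₁ ⋯ z_d)` is nonzero in top
cohomology as soon as `1` is not killed by some functional. -/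
lemma isTopClass_one_of_apply_one_ne_zero (p : ℕ) [Fact p.Prime] [CharP S p]
    (hX : ∀ j, algebraMap (MvPolynomial (Fin d) K) S (.X j) = z j)
    (ψ : S →ₗ[MvPolynomial (Fin d) K] MvPolynomial (Fin d) K) (h : ψ 1 ≠ 0) :
    IsTopClass z 1 1 := by
  obtain ⟨a, ha⟩ := MvPolynomial.ne_zero_iff.1 h
  intro n hn
  -- The `p^e`-th power of the relation has exponents `(1 + n) p^e = p^e + n p^e`. Applying `ψ`
  -- forces each monomial of `ψ 1` to have an exponent at least `p^e`, impossible for large `e`.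
  obtain ⟨e, he⟩ : ∃ e, Finset.univ.sup a < p ^ e :=
    ⟨_, Nat.lt_pow_self (Fact.out : p.Prime).one_lt⟩
  have h1 := pow_mem_span_pow_of_mem_span p hn e
  rw [mul_one, ← pow_mul, ← mul_one ((∏ j, z j) ^ (n * p ^ e)), add_mul, one_mul] at h1
  have h2 := map_mem_span_pow hX ψ h1
  rw [map_prod_pow_mul hX] at h2
  obtain ⟨j, hj⟩ := MvPolynomial.exists_le_of_prod_pow_mul_mem h2 ha
  have := Finset.le_sup (f := a) (Finset.mem_univ j)
  omega

end MonomialIdeals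

section FiniteExtension

variable {A R S : Type*} [CommRing A] [IsDomain A] [IsNoetherianRing A] [CommRing R] [IsDomain R]
  [CommRing S] [Algebra A R] [Algebra A S] [Algebra R S] [IsScalarTower A R S] [Module.Finite A R]

omit [IsNoetherianRing A] in
lemma exists_linearMap_base (hinj : Function.Injective (algebraMap A R)) {φ : S →ₗ[R] R}
    (hφ : φ ≠ 0) : ∃ ψ : S →ₗ[A] A, ψ ≠ 0 := by
  obtain ⟨s, hs⟩ := DFunLike.ne_iff.1 hφ
  obtain ⟨g, hg⟩ := exists_linearMap_apply_ne_zero (D := A) (M := R) (fun a r h => by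
    rwa [Algebra.smul_def, mul_eq_zero, map_eq_zero_iff _ hinj] at h) hs
  exact ⟨g.comp (φ.restrictScalars A), fun h => hg (DFunLike.congr_fun h s)⟩

/-- Let `Q` be the largest `R`-submodule inside the kernel of `ψ`. Finitely many translates of `ψ`
embed `S/Q` in a free `A`-module, so it is finite. It is torsion-free over `R` because every nonzero
`r` divides a nonzero element of `A`. Hence it has enough functionals to `R`. -/
lemma exists_linearMap_extension {ψ : S →ₗ[A] A}
    (hψ : ψ ≠ 0) : ∃ φ : S →ₗ[R] R, φ ≠ 0 := by
  obtain ⟨s, hs⟩ := DFunLike.ne_iff.1 hψ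
  let Q : Submodule R S :=
    { carrier := {x | ∀ r : R, ψ (r • x) = 0}
      add_mem' := fun ha hb r => by rw [smul_add, map_add, ha r, hb r, add_zero]
      zero_mem' := fun r => by rw [smul_zero, map_zero]
      smul_mem' := fun c x hx r => by rw [smul_smul]; exact hx _ }
  obtain ⟨G, hG⟩ := Module.Finite.fg_top (R := A) (M := R)
  let ev : S →ₗ[A] (G → A) := LinearMap.pi fun g => ψ.comp (LinearMap.lsmul R S (g : R) |>.restrictScalars A)
  have hev : ∀ x, ev x = 0 ↔ x ∈ Q := by
    intro x
    constructor
    · intro h r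
      have h1 : (⊤ : Submodule A R) ≤
          LinearMap.ker (ψ.comp ((LinearMap.toSpanSingleton R S x).restrictScalars A)) := by
        rw [← hG, Submodule.span_le]
        intro g hg
        exact congrFun h ⟨g, hg⟩
      exact h1 (Submodule.mem_top : r ∈ ⊤)
    · intro h
      funext g
      exact h g
  have hfin : Module.Finite A (S ⧸ Q) := by
    let ev' : (S ⧸ Q) →ₗ[A] (G → A) :=
      (Q.restrictScalars A).liftQ ev (fun x hx => (hev x).2 hx)
    refine Module.Finite.of_injective ev' ?_
    rw [injective_iff_map_eq_zero]
    intro x hx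
    obtain ⟨x, rfl⟩ := Submodule.Quotient.mk_surjective Q x
    exact (Submodule.Quotient.mk_eq_zero Q).2 ((hev x).1 hx)
  have hfin' : Module.Finite R (S ⧸ Q) := Module.Finite.of_restrictScalars_finite A R (S ⧸ Q)
  have hint : Algebra.IsIntegral A R := inferInstance
  obtain ⟨f, hf⟩ := exists_linearMap_apply_ne_zero (D := R) (M := S ⧸ Q) (fun r x h => by
    rw [or_iff_not_imp_left]
    intro hr
    obtain ⟨x, rfl⟩ := Submodule.Quotient.mk_surjective Q x
    rw [← Submodule.Quotient.mk_smul, Submodule.Quotient.mk_eq_zero] at h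
    rw [Submodule.Quotient.mk_eq_zero]
    obtain ⟨a, ha, hra⟩ : ∃ a : A, a ≠ 0 ∧ r ∣ algebraMap A R a :=
      (hint.1 r).isAlgebraic.exists_nonzero_dvd (mem_nonZeroDivisors_of_ne_zero hr)
    obtain ⟨b, hb⟩ := hra
    intro c
    have h1 := h (c * b)
    rw [smul_smul, mul_assoc, mul_comm b r, ← hb, mul_comm, mul_smul, algebraMap_smul, map_smul,
      smul_eq_mul] at h1
    exact (mul_eq_zero.1 h1).resolve_left ha)
    (m := Submodule.Quotient.mk s) (fun h => hs (by
      simpa using (Submodule.Quotient.mk_eq_zero Q).1 h 1))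
  exact ⟨f.comp Q.mkQ, fun h => hf (DFunLike.congr_fun h s)⟩

end FiniteExtension

end

/-! ### The Čech quotient inside the fraction field, and functionals built from it. -/

section

open GradedAlgebra

section CechQuotient

variable {S : Type*} [CommRing S] {d : ℕ} (z : Fin d → S) (L : Type*) [Field L] [Algebra S L]

/-- The elements of `L` that become integral after multiplication by a power of the product of
all `z i` with `i ≠ j`. -/
def cechPart (j : Fin d) : Submodule S L where
  carrier := {x | ∃ N : ℕ, ∃ s : S,
    x * algebraMap S L (∏ i ∈ Finset.univ.erase j, z i) ^ N = algebraMap S L s}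
  zero_mem' := ⟨0, 0, by simp⟩
  add_mem' := by
    rintro x x' ⟨N, s, h⟩ ⟨N', s', h'⟩
    refine ⟨N + N', s * (∏ i ∈ Finset.univ.erase j, z i) ^ N' +
      s' * (∏ i ∈ Finset.univ.erase j, z i) ^ N, ?_⟩
    rw [map_add, map_mul, map_mul, ← h, ← h', map_pow, map_pow]
    ring
  smul_mem' := by
    rintro c x ⟨N, s, h⟩
    refine ⟨N, c * s, ?_⟩
    rw [map_mul, ← h, Algebra.smul_def]
    ring

variable {z L}

lemma exists_mul_prod_pow_of_mem_cechPart {x : L} (hx : x ∈ ⨆ j, cechPart z L j) :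
    ∃ N, ∀ m ≥ N, ∃ s ∈ Ideal.span (Set.range fun j => z j ^ m),
      x * algebraMap S L (∏ j, z j) ^ m = algebraMap S L s := by
  induction hx using Submodule.iSup_induction' with
  | mem j x hx =>
    obtain ⟨N, s, h⟩ := hx
    refine ⟨N, fun m hm => ⟨s * (∏ i ∈ Finset.univ.erase j, z i) ^ (m - N) * z j ^ m,
      Ideal.mul_mem_left _ _ (Ideal.subset_span ⟨j, rfl⟩), ?_⟩⟩
    obtain ⟨k, rfl⟩ := Nat.exists_eq_add_of_le hm
    rw [← Finset.mul_prod_erase _ _ (Finset.mem_univ j), Nat.add_sub_cancel_left]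
    simp only [map_mul, map_pow]
    rw [← h]
    ring
  | zero => exact ⟨0, fun m _ => ⟨0, zero_mem _, by simp⟩⟩
  | add x x' _ _ hx hx' =>
    obtain ⟨N, hN⟩ := hx
    obtain ⟨N', hN'⟩ := hx'
    refine ⟨max N N', fun m hm => ?_⟩
    obtain ⟨s, hs, h⟩ := hN m (le_of_max_le_left hm)
    obtain ⟨s', hs', h'⟩ := hN' m (le_of_max_le_right hm)
    exact ⟨s + s', add_mem hs hs', by rw [add_mul, h, h', map_add]⟩

lemma IsTopClass.notMem_cechPart [IsDomain S] [IsFractionRing S L] (hz : ∀ j, z j ≠ 0) {t : ℕ} {s : S}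
    (h : IsTopClass z t s) :
    algebraMap S L s / algebraMap S L (∏ j, z j) ^ t ∉ ⨆ j, cechPart z L j := by
  intro hx
  obtain ⟨N, hN⟩ := exists_mul_prod_pow_of_mem_cechPart hx
  obtain ⟨s', hs', h'⟩ := hN (t + N) (by omega)
  refine h N ?_
  have h0 : algebraMap S L (∏ j, z j) ≠ 0 :=
    (map_ne_zero_iff _ (IsFractionRing.injective S L)).2 (Finset.prod_ne_zero_iff.2 fun j _ => hz j)
  have h1 : algebraMap S L ((∏ j, z j) ^ N * s) = algebraMap S L s' := by
    rw [← h', map_mul, map_pow]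
    field_simp
    ring
  rwa [IsFractionRing.injective S L h1]

/-- Since `a k = 0`, the factor `z k` cancels the only `z k` in the denominator. -/
lemma div_mem_cechPart [IsDomain S] [IsFractionRing S L] (hz : ∀ j, z j ≠ 0) {a : Fin d →₀ ℕ}
    {k : Fin d} (ha : a k = 0) (s : S) :
    algebraMap S L (z k * s) / algebraMap S L (∏ j, z j ^ (a j + 1)) ∈ cechPart z L k := by
  refine ⟨Finset.univ.sup a + 1, s * ∏ j ∈ Finset.univ.erase k, z j ^ (Finset.univ.sup a - a j), ?_⟩
  have h1 : (∏ j, z j ^ (a j + 1)) = z k * ∏ j ∈ Finset.univ.erase k, z j ^ (a j + 1) := by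
    rw [← Finset.mul_prod_erase _ _ (Finset.mem_univ k), ha, zero_add, pow_one]
  have h2 : (∏ j ∈ Finset.univ.erase k, z j) ^ (Finset.univ.sup a + 1) =
      (∏ j ∈ Finset.univ.erase k, z j ^ (a j + 1)) *
        ∏ j ∈ Finset.univ.erase k, z j ^ (Finset.univ.sup a - a j) := by
    rw [← Finset.prod_pow, ← Finset.prod_mul_distrib]
    refine Finset.prod_congr rfl fun j _ => ?_
    rw [← pow_add]
    have := Finset.le_sup (f := a) (Finset.mem_univ j)
    congr 1
    omega
  have hne : ∀ {x : S}, x ≠ 0 → algebraMap S L x ≠ 0 :=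
    fun hx => (map_ne_zero_iff _ (IsFractionRing.injective S L)).2 hx
  have h3 := hne (hz k)
  have h4 : algebraMap S L (∏ j ∈ Finset.univ.erase k, z j ^ (a j + 1)) ≠ 0 :=
    hne (Finset.prod_ne_zero_iff.2 fun j _ => pow_ne_zero _ (hz j))
  rw [← map_pow, h1, h2]
  simp only [map_mul]
  field_simp

end CechQuotient

section GradedDual

variable {K S : Type u} [Field K] [CommRing S] [Algebra K S] (ℬ : ℕ → Submodule K S)
  [GradedAlgebra ℬ]

/-- The projection to the homogeneous component of degree `m - q`, which is zero for `m < q`. -/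
noncomputable def shiftProj (q m : ℕ) : S →ₗ[K] S := if q ≤ m then proj ℬ (m - q) else 0

variable {ℬ}

lemma shiftProj_add_mul {e : ℕ} {z : S} (hz : z ∈ ℬ e) (q m : ℕ) (s : S) :
    shiftProj ℬ q (m + e) (z * s) = z * shiftProj ℬ q m s := by
  unfold shiftProj
  by_cases h : q ≤ m
  · rw [if_pos h, if_pos (by omega), show m + e - q = e + (m - q) by omega,
      proj_add_mul_of_left_mem hz]
  · rw [if_neg h, LinearMap.zero_apply, mul_zero]
    split_ifs with h'
    · exact proj_mul_of_left_mem_of_lt hz (by omega) s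
    · rfl

lemma exists_shiftProj_mul {e : ℕ} {z : S} (hz : z ∈ ℬ e) (q m : ℕ) (s : S) :
    ∃ s', shiftProj ℬ q m (z * s) = z * s' := by
  rcases lt_or_ge m e with h | h
  · refine ⟨0, ?_⟩
    rw [mul_zero]
    unfold shiftProj
    split_ifs with h'
    · exact proj_mul_of_left_mem_of_lt hz (by omega) s
    · rfl
  · obtain ⟨k, rfl⟩ := Nat.exists_eq_add_of_le' h
    exact ⟨_, shiftProj_add_mul hz q k s⟩

lemma shiftProj_of_mem {i : ℕ} {s : S} (hs : s ∈ ℬ i) (q : ℕ) : shiftProj ℬ q (q + i) s = s := by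
  unfold shiftProj
  rw [if_pos (by omega), Nat.add_sub_cancel_left, proj_of_mem hs]

lemma shiftProj_of_mem_ne {i : ℕ} {s : S} (hs : s ∈ ℬ i) {q m : ℕ} (h : m ≠ q + i) :
    shiftProj ℬ q m s = 0 := by
  unfold shiftProj
  split_ifs with h'
  · exact proj_of_mem_ne hs (by omega)
  · rfl

variable (ℬ) in
lemma exists_shiftProj_eq_zero (q : ℕ) (s : S) : ∃ M, ∀ m > M, shiftProj ℬ q m s = 0 := by
  obtain ⟨σ, hσ⟩ := exists_eq_sum_proj ℬ s
  refine ⟨q + σ.sup id, fun m hm => ?_⟩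
  rw [hσ, map_sum]
  refine Finset.sum_eq_zero fun n hn => shiftProj_of_mem_ne (proj_mem ℬ n s) ?_
  have : id n ≤ σ.sup id := Finset.le_sup hn
  simp only [id] at this
  omega

lemma MvPolynomial.exists_coeff_eq {d : ℕ} (f : (Fin d →₀ ℕ) → K) (hf : f.support.Finite) :
    ∃ p : MvPolynomial (Fin d) K, ∀ a, coeff a p = f a := by
  classical
  refine ⟨∑ a ∈ hf.toFinset, monomial a (f a), fun a => ?_⟩
  rw [coeff_sum]
  simp only [coeff_monomial]
  rw [Finset.sum_ite_eq']
  split_ifs with h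
  · rfl
  · by_contra hne
    exact h (hf.mem_toFinset.2 fun h0 => hne h0.symm)

variable {d : ℕ} {z : Fin d → S} {e : Fin d → ℕ}

/-- A nonzero class in top cohomology given by a homogeneous element yields a functional to the
polynomial ring. -/
lemma exists_linearMap_of_isTopClass [IsDomain S]
    [Algebra (MvPolynomial (Fin d) K) S] [IsScalarTower K (MvPolynomial (Fin d) K) S]
    (hX : ∀ j, algebraMap (MvPolynomial (Fin d) K) S (.X j) = z j)
    (hz : ∀ j, z j ∈ ℬ (e j)) (he : ∀ j, 0 < e j) (hz0 : ∀ j, z j ≠ 0)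
    {t i : ℕ} {s₀ : S} (hs₀ : s₀ ∈ ℬ i) (h : IsTopClass z (t + 1) s₀) :
    ∃ φ : S →ₗ[MvPolynomial (Fin d) K] MvPolynomial (Fin d) K,
      MvPolynomial.coeff (Finsupp.equivFunOnFinite.symm fun _ => t) (φ s₀) = 1 ∧
      ∀ a : Fin d →₀ ℕ, ∑ j, a j * e j ≠ ∑ j, t * e j → MvPolynomial.coeff a (φ s₀) = 0 := by
  classical
  let L := FractionRing S
  let a₀ : Fin d →₀ ℕ := Finsupp.equivFunOnFinite.symm fun _ => t
  have ha₀ : ∀ j, a₀ j = t := fun j => rfl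
  let U : Submodule K L := (⨆ j, cechPart z L j).restrictScalars K
  have hx₀ : algebraMap S L s₀ / algebraMap S L (∏ j, z j) ^ (t + 1) ∉ U := h.notMem_cechPart hz0
  obtain ⟨l, hl, hUl⟩ := Submodule.exists_le_ker_of_notMem hx₀
  let l' : L →ₗ[K] K := (l (algebraMap S L s₀ / algebraMap S L (∏ j, z j) ^ (t + 1)))⁻¹ • l
  have hl' : l' (algebraMap S L s₀ / algebraMap S L (∏ j, z j) ^ (t + 1)) = 1 := inv_mul_cancel₀ hl
  have hU : ∀ x ∈ U, l' x = 0 := fun x hx => by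
    have : l x = 0 := hUl hx
    simp only [l', LinearMap.smul_apply, this, smul_zero]
  let wt : (Fin d →₀ ℕ) → ℕ := fun a => ∑ j, a j * e j
  let Q : (Fin d →₀ ℕ) → L := fun a => algebraMap S L (∏ j, z j ^ (a j + 1))
  -- The future coefficient of `X^a`: the functional applied to one homogeneous component of `s`
  -- over `∏ z_j^(a_j+1)`. The component has degree `wt a + i - wt a₀`, so `s₀` contributes only in
  -- weight `wt a₀`, and multiplication by `z k` shifts both degrees by `e k`.
  let κ : (Fin d →₀ ℕ) → S →ₗ[K] K := fun a =>
    l'.comp ((LinearMap.mulRight K (Q a)⁻¹).comp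
      ((IsScalarTower.toAlgHom K S L).toLinearMap.comp (shiftProj ℬ (wt a₀) (wt a + i))))
  have hκ : ∀ a s, κ a s = l' (algebraMap S L (shiftProj ℬ (wt a₀) (wt a + i) s) / Q a) := by
    intro a s
    rw [div_eq_mul_inv]
    rfl
  -- As all `e j` are positive, a large exponent means a large weight, beyond every component of
  -- `s`.
  have hfin : ∀ s, (Function.support fun a => κ a s).Finite := by
    intro s
    obtain ⟨M, hM⟩ := exists_shiftProj_eq_zero ℬ (wt a₀) s
    refine (Set.finite_Iic (Finsupp.equivFunOnFinite.symm fun _ => M : Fin d →₀ ℕ)).subset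
      fun a ha j => ?_
    change a j ≤ M
    by_contra hj
    refine ha ?_
    have h1 : a j * e j ≤ wt a :=
      Finset.single_le_sum (f := fun j => a j * e j) (fun _ _ => Nat.zero_le _) (Finset.mem_univ j)
    have h2 : a j ≤ a j * e j := Nat.le_mul_of_pos_right _ (he j)
    change κ a s = 0
    rw [hκ, hM _ (by omega), map_zero, zero_div, map_zero]
  choose φ hφ using fun s => MvPolynomial.exists_coeff_eq _ (hfin s)
  have hadd : ∀ s s', φ (s + s') = φ s + φ s' := fun s s' => by
    ext a
    rw [MvPolynomial.coeff_add, hφ, hφ, hφ, map_add]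
  have hC : ∀ (c : K) s, φ (c • s) = MvPolynomial.C c * φ s := fun c s => by
    ext a
    rw [MvPolynomial.coeff_C_mul, hφ, hφ, map_smul, smul_eq_mul]
  have hXφ : ∀ k s, φ (z k * s) = MvPolynomial.X k * φ s := fun k s => by
    ext a
    rw [MvPolynomial.coeff_X_mul', hφ]
    split_ifs with hk
    · rw [Finsupp.mem_support_iff] at hk
      obtain ⟨b, rfl⟩ : ∃ b, a = b + Finsupp.single k 1 := by
        refine ⟨a - Finsupp.single k 1, (tsub_add_cancel_of_le ?_).symm⟩
        rw [Finsupp.single_le_iff]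
        omega
      rw [add_tsub_cancel_right, hφ, hκ, hκ]
      have h1 : wt (b + Finsupp.single k 1) = wt b + e k := by
        simp only [wt, Finsupp.add_apply, add_mul, Finset.sum_add_distrib]
        congr 1
        rw [Finset.sum_eq_single k]
        · rw [Finsupp.single_eq_same, one_mul]
        · intro j _ hj
          rw [Finsupp.single_eq_of_ne hj, zero_mul]
        · intro hk
          exact absurd (Finset.mem_univ k) hk
      have h2 : Q (b + Finsupp.single k 1) = algebraMap S L (z k) * Q b := by
        simp only [Q]
        rw [← map_mul]
        congr 1
        have h3 : ∀ j, z j ^ ((b + Finsupp.single k 1 : Fin d →₀ ℕ) j + 1) =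
            z j ^ (Finsupp.single k 1 j) * z j ^ (b j + 1) := fun j => by
          rw [← pow_add, Finsupp.add_apply]
          congr 1
          omega
        rw [Finset.prod_congr rfl fun j _ => h3 j, Finset.prod_mul_distrib]
        congr 1
        rw [Finset.prod_eq_single k]
        · rw [Finsupp.single_eq_same, pow_one]
        · intro j _ hj
          rw [Finsupp.single_eq_of_ne hj, pow_zero]
        · intro hk
          exact absurd (Finset.mem_univ k) hk
      have h4 : algebraMap S L (z k) ≠ 0 :=
        (map_ne_zero_iff _ (IsFractionRing.injective S L)).2 (hz0 k)
      rw [h1, h2, add_right_comm, shiftProj_add_mul (hz k), map_mul, mul_div_mul_left _ _ h4]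
    -- The coefficient of `X^a` in `X_k φ(s)` is 0 here; on the other side the fraction lies in
    -- `cechPart z L k`, which the functional kills.
    · rw [Finsupp.notMem_support_iff] at hk
      rw [hκ]
      obtain ⟨s', hs'⟩ := exists_shiftProj_mul (hz k) (wt a₀) (wt a + i) s
      rw [hs']
      exact hU _ ((le_iSup (cechPart z L) k) (div_mem_cechPart hz0 hk s'))
  have hsmul : ∀ (p : MvPolynomial (Fin d) K) s, φ (p • s) = p * φ s := by
    intro p
    induction p using MvPolynomial.induction_on with
    | C c =>
      intro s
      rw [← hC, ← algebraMap_smul (MvPolynomial (Fin d) K) c s]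
      rfl
    | add p q hp hq => intro s; rw [add_smul, hadd, hp, hq, add_mul]
    | mul_X p k hp =>
      intro s
      rw [mul_smul, hp, Algebra.smul_def, hX, hXφ, mul_assoc]
  refine ⟨{ toFun := φ, map_add' := hadd, map_smul' := hsmul }, ?_, fun a ha => ?_⟩
  · refine (hφ s₀ a₀).trans ?_
    rw [hκ, shiftProj_of_mem hs₀, ← hl', ← map_pow, ← Finset.prod_pow]
    rfl
  · refine (hφ s₀ a).trans ?_
    rw [hκ, shiftProj_of_mem_ne hs₀, map_zero, zero_div, map_zero]
    intro h1
    exact ha (Nat.add_right_cancel h1)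

/-- If some element gives a nonzero class in top cohomology, there is a nonzero functional. -/
lemma IsTopClass.exists_linearMap_ne_zero [IsDomain S]
    [Algebra (MvPolynomial (Fin d) K) S] [IsScalarTower K (MvPolynomial (Fin d) K) S]
    (hX : ∀ j, algebraMap (MvPolynomial (Fin d) K) S (.X j) = z j)
    (hz : ∀ j, z j ∈ ℬ (e j)) (he : ∀ j, 0 < e j) (hz0 : ∀ j, z j ≠ 0)
    {t : ℕ} {s : S} (h : IsTopClass z t s) :
    ∃ φ : S →ₗ[MvPolynomial (Fin d) K] MvPolynomial (Fin d) K, φ ≠ 0 := by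
  obtain ⟨σ, hσ⟩ := exists_eq_sum_proj ℬ s
  rw [hσ] at h
  obtain ⟨i, -, hi⟩ := h.exists_of_sum
  have hprod : (∏ j, z j) ∈ ℬ (∑ j, e j) := SetLike.prod_mem_graded _ _ _ fun j _ => hz j
  obtain ⟨φ, hφ, -⟩ := exists_linearMap_of_isTopClass hX hz he hz0
    (SetLike.mul_mem_graded hprod (proj_mem ℬ i s)) hi.mul_prod
  refine ⟨φ, ?_⟩
  rintro rfl
  simp at hφ

/-- If `1 / (z₁ ⋯ z_d)` is nonzero in top cohomology, the polynomial ring splits off. -/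
lemma IsTopClass.exists_linearMap_apply_one [IsDomain S]
    [Algebra (MvPolynomial (Fin d) K) S] [IsScalarTower K (MvPolynomial (Fin d) K) S]
    (hX : ∀ j, algebraMap (MvPolynomial (Fin d) K) S (.X j) = z j)
    (hz : ∀ j, z j ∈ ℬ (e j)) (he : ∀ j, 0 < e j) (hz0 : ∀ j, z j ≠ 0)
    (h : IsTopClass z 1 1) :
    ∃ φ : S →ₗ[MvPolynomial (Fin d) K] MvPolynomial (Fin d) K, φ 1 = 1 := by
  classical
  obtain ⟨φ, hφ, hφ'⟩ := exists_linearMap_of_isTopClass hX hz he hz0 (t := 0)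
    SetLike.GradedOne.one_mem h
  refine ⟨φ, ?_⟩
  ext a
  rw [MvPolynomial.coeff_one]
  split_ifs with ha
  · rw [← ha, ← hφ]
    congr 1
    ext j
    rfl
  · refine hφ' a fun h1 => ha ?_
    simp only [zero_mul, Finset.sum_const_zero] at h1
    rw [Finset.sum_eq_zero_iff] at h1
    ext j
    have := h1 j (Finset.mem_univ j)
    rcases Nat.mul_eq_zero.1 this with h2 | h2
    · exact h2.symm
    · exact absurd h2 (he j).ne'

end GradedDual

end

/-! ### Solidity and top local cohomology. -/

section

section TopClassCriterion

variable {R S : Type u} [CommRing R] [CommRing S] [Algebra R S]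

lemma localCohomologyNonzero_iff_exists_isTopClass [IsNoetherianRing R] {y : ℕ → R} {d : ℕ}
    {I : Ideal R} (hI : I ≤ (Ideal.span (y '' Set.Iio d)).radical) (hy : ∀ j < d, y j ∈ I) :
    LocalCohomologyNonzero R S I d ↔
      ∃ t s, IsTopClass (fun j : Fin d => algebraMap R S (y j)) t s := by
  have h1 : I ≤ (powIdeal y d 1).radical := by
    rw [powIdeal_eq_span]
    simpa only [pow_one] using hI
  refine (nontrivial_top_localCohomology_iff h1 hy (ModuleCat.of R S)).trans
    (exists_congr fun t => exists_congr fun s => forall_congr' fun n => not_congr ?_)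
  change (∏ j ∈ Finset.range d, y j) ^ n • s ∈ powIdeal y d (t + n) • (⊤ : Submodule R S) ↔ _
  have h2 : (powIdeal y d (t + n)).map (algebraMap R S) =
      Ideal.span (Set.range fun j : Fin d => algebraMap R S (y j) ^ (t + n)) := by
    rw [powIdeal_eq_span, Ideal.map_span]
    congr 1
    ext x
    constructor
    · rintro ⟨_, ⟨j, hj, rfl⟩, rfl⟩
      exact ⟨⟨j, hj⟩, (map_pow _ _ _).symm⟩
    · rintro ⟨j, rfl⟩
      exact ⟨_, ⟨j, j.2, rfl⟩, map_pow _ _ _⟩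
  rw [Ideal.smul_top_eq_map, h2, Submodule.restrictScalars_mem, Algebra.smul_def, map_pow,
    map_prod, Finset.prod_range]

end TopClassCriterion

section Parameters

variable {K R S : Type u} [Field K] [CommRing R] [CommRing S] [IsDomain R] [IsDomain S]
  [Algebra K R] [Algebra K S] [Algebra R S] [IsScalarTower K R S]
  {ℬ : ℕ → Submodule K S} [GradedAlgebra ℬ] {d : ℕ} {y : Fin d → R} {e : Fin d → ℕ}
  [Algebra (MvPolynomial (Fin d) K) R] [Algebra (MvPolynomial (Fin d) K) S]
  [IsScalarTower K (MvPolynomial (Fin d) K) S]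
  [IsScalarTower (MvPolynomial (Fin d) K) R S]

omit [IsDomain R] [IsDomain S] [Algebra K R] [Algebra K S] [IsScalarTower K R S]
  [IsScalarTower K (MvPolynomial (Fin d) K) S] in
lemma algebraMap_X_tower (hX : ∀ j, algebraMap (MvPolynomial (Fin d) K) R (.X j) = y j) (j : Fin d) :
    algebraMap (MvPolynomial (Fin d) K) S (.X j) = algebraMap R S (y j) := by
  rw [IsScalarTower.algebraMap_apply (MvPolynomial (Fin d) K) R S, hX]

omit [IsDomain R] [IsDomain S] [Algebra K R] [Algebra K S] [IsScalarTower K R S]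
  [Algebra (MvPolynomial (Fin d) K) S] [IsScalarTower K (MvPolynomial (Fin d) K) S]
  [IsScalarTower (MvPolynomial (Fin d) K) R S] in
lemma algebraMap_parameter_ne_zero
    (hX : ∀ j, algebraMap (MvPolynomial (Fin d) K) R (.X j) = y j)
    (hA : Function.Injective (algebraMap (MvPolynomial (Fin d) K) R))
    (hinj : Function.Injective (algebraMap R S)) (j : Fin d) : algebraMap R S (y j) ≠ 0 := by
  rw [← hX, map_ne_zero_iff _ hinj, map_ne_zero_iff _ hA]
  exact MvPolynomial.X_ne_zero j

omit [Algebra K R] [IsScalarTower K R S] in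
lemma exists_isTopClass_iff_isSolidAlgebra [Module.Finite (MvPolynomial (Fin d) K) R]
    (hX : ∀ j, algebraMap (MvPolynomial (Fin d) K) R (.X j) = y j)
    (hA : Function.Injective (algebraMap (MvPolynomial (Fin d) K) R))
    (hinj : Function.Injective (algebraMap R S))
    (hy : ∀ j, algebraMap R S (y j) ∈ ℬ (e j)) (he : ∀ j, 0 < e j) :
    (∃ t s, IsTopClass (fun j => algebraMap R S (y j)) t s) ↔ IsSolidAlgebra R S := by
  constructor
  · rintro ⟨t, s, h⟩
    obtain ⟨φ, hφ⟩ := h.exists_linearMap_ne_zero (ℬ := ℬ) (algebraMap_X_tower hX) hy he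
      (algebraMap_parameter_ne_zero hX hA hinj)
    exact exists_linearMap_extension hφ
  · rintro ⟨φ, hφ⟩
    obtain ⟨ψ, hψ⟩ := exists_linearMap_base (A := MvPolynomial (Fin d) K) hA hφ
    obtain ⟨s, hs⟩ := DFunLike.ne_iff.1 hψ
    obtain ⟨t, ht⟩ := exists_isTopClass_of_apply_ne_zero
      (algebraMap_X_tower (R := R) (S := S) hX) ψ hs
    exact ⟨t, s, ht⟩

omit [IsDomain R] [Algebra K R] [IsScalarTower K R S] in
lemma IsSolidAlgebra.isDirectSummandOf (p : ℕ) [Fact p.Prime] [CharP S p]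
    (hX : ∀ j, algebraMap (MvPolynomial (Fin d) K) R (.X j) = y j)
    (hA : Function.Bijective (algebraMap (MvPolynomial (Fin d) K) R))
    (hinj : Function.Injective (algebraMap R S))
    (hy : ∀ j, algebraMap R S (y j) ∈ ℬ (e j)) (he : ∀ j, 0 < e j)
    (h : IsSolidAlgebra R S) : IsDirectSummandOf R S := by
  obtain ⟨φ, hφ⟩ := h
  obtain ⟨s, hs⟩ := DFunLike.ne_iff.1 hφ
  let E : MvPolynomial (Fin d) K ≃ₗ[MvPolynomial (Fin d) K] R :=
    LinearEquiv.ofBijective (Algebra.linearMap (MvPolynomial (Fin d) K) R) hA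
  -- Precomposing with multiplication by `s` moves the nonvanishing of `φ` from `s` to `1`.
  let ψ : S →ₗ[MvPolynomial (Fin d) K] MvPolynomial (Fin d) K :=
    E.symm.toLinearMap.comp ((φ.restrictScalars (MvPolynomial (Fin d) K)).comp
      (LinearMap.mulLeft (MvPolynomial (Fin d) K) s))
  have hψ : ψ 1 ≠ 0 := by
    intro h0
    have h1 : φ (s * 1) = 0 := (map_eq_zero_iff E.symm E.symm.injective).1 h0
    rw [mul_one] at h1
    exact hs h1
  have htop := isTopClass_one_of_apply_one_ne_zero p (algebraMap_X_tower hX) ψ hψ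
  obtain ⟨ρ, hρ⟩ := htop.exists_linearMap_apply_one (ℬ := ℬ) (algebraMap_X_tower hX) hy he
    (algebraMap_parameter_ne_zero hX hA.1 hinj)
  refine ⟨{ toFun := fun x => algebraMap _ R (ρ x), map_add' := fun a b => by rw [map_add, map_add],
            map_smul' := fun r x => ?_ }, LinearMap.ext_ring ?_⟩
  · obtain ⟨a, rfl⟩ := hA.2 r
    rw [algebraMap_smul, map_smul, smul_eq_mul, map_mul]
    rfl
  · change algebraMap _ R (ρ (algebraMap R S 1)) = 1
    rw [map_one, hρ, map_one]

end Parameters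

section GradedSetting

variable {K R S : Type u} [Field K] [CommRing R] [CommRing S] [IsDomain R] [IsDomain S]
  [Algebra K R] [Algebra K S] [Algebra R S] [IsScalarTower K R S]
  {𝒜 : ℕ → Submodule K R} [GradedAlgebra 𝒜] {ℬ : ℕ → Submodule K S} [GradedAlgebra ℬ]

/-- For a graded extension `R → S`, the top local cohomology of `S` is nonzero if and only if `S`
is a solid `R`-algebra. -/
lemma localCohomologyNonzero_iff_isSolidAlgebra (h0 : 𝒜 0 = 1) [Algebra.FiniteType K R]
    (hinj : Function.Injective (algebraMap R S))
    (hdeg : ∀ (i : ℕ) (a : R), a ∈ 𝒜 i → algebraMap R S a ∈ ℬ i)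
    {d : ℕ} (hd : ringKrullDim R = d) :
    LocalCohomologyNonzero R S (homogeneousMaximalIdeal 𝒜) d ↔ IsSolidAlgebra R S := by
  have : IsNoetherianRing R := Algebra.FiniteType.isNoetherianRing K R
  obtain ⟨y, hy, hrad⟩ := exists_homogeneous_parameters (𝒜 := 𝒜) h0 hd
  choose e he hye using hy
  rw [localCohomologyNonzero_iff_exists_isTopClass hrad
    fun j _ => mem_homogeneousMaximalIdeal_of_mem (he j) (hye j)]
  let f : MvPolynomial (Fin d) K →ₐ[K] R := MvPolynomial.aeval fun j : Fin d => y j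
  let _ : Algebra (MvPolynomial (Fin d) K) R := f.toAlgebra
  let _ : Algebra (MvPolynomial (Fin d) K) S := ((algebraMap R S).comp f.toRingHom).toAlgebra
  have : IsScalarTower (MvPolynomial (Fin d) K) R S := IsScalarTower.of_algebraMap_eq fun _ => rfl
  have : IsScalarTower K (MvPolynomial (Fin d) K) R :=
    IsScalarTower.of_algebraMap_eq fun c => (f.commutes c).symm
  have : IsScalarTower K (MvPolynomial (Fin d) K) S := IsScalarTower.of_algebraMap_eq fun c => by
    rw [IsScalarTower.algebraMap_apply K R S, ← f.commutes c]
    rfl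
  have hX : ∀ j : Fin d, algebraMap (MvPolynomial (Fin d) K) R (.X j) = y j :=
    fun j => MvPolynomial.aeval_X _ j
  have hrange : (Set.range fun j : Fin d => y j) = y '' Set.Iio d := by
    ext x
    constructor
    · rintro ⟨j, rfl⟩
      exact ⟨j, j.2, rfl⟩
    · rintro ⟨j, hj, rfl⟩
      exact ⟨⟨j, hj⟩, rfl⟩
  have : Module.Finite (MvPolynomial (Fin d) K) R :=
    finite_of_parameters (𝒜 := 𝒜) h0 (fun j => ⟨e j, he j, hye j⟩) (by rwa [hrange]) hX
  exact exists_isTopClass_iff_isSolidAlgebra (ℬ := ℬ) (e := fun j => e j) hX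
    (algebraMap_injective_of_ringKrullDim hd) hinj (fun j => hdeg _ _ (hye j)) fun j => he j

/-- In positive characteristic, solid graded algebras over polynomial rings split. -/
lemma IsSolidAlgebra.isDirectSummandOf_of_polynomial (h0 : 𝒜 0 = 1) [Algebra.FiniteType K R]
    (hinj : Function.Injective (algebraMap R S))
    (hdeg : ∀ (i : ℕ) (a : R), a ∈ 𝒜 i → algebraMap R S a ∈ ℬ i)
    {d : ℕ} (eqv : R ≃ₐ[K] MvPolynomial (Fin d) K) (hchar : ringChar K ≠ 0)
    (h : IsSolidAlgebra R S) : IsDirectSummandOf R S := by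
  have hd : ringKrullDim R = d := by
    rw [ringKrullDim_eq_of_ringEquiv eqv.toRingEquiv, MvPolynomial.ringKrullDim_field]
  obtain ⟨g, hg⟩ := exists_span_range_eq_of_algEquiv (𝒜 := 𝒜) h0 eqv
  obtain ⟨y, hy, hm⟩ := exists_homogeneous_generators h0 hg
  choose e he hye using hy
  let f : MvPolynomial (Fin d) K →ₐ[K] R := MvPolynomial.aeval y
  let _ : Algebra (MvPolynomial (Fin d) K) R := f.toAlgebra
  let _ : Algebra (MvPolynomial (Fin d) K) S := ((algebraMap R S).comp f.toRingHom).toAlgebra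
  have : IsScalarTower (MvPolynomial (Fin d) K) R S := IsScalarTower.of_algebraMap_eq fun _ => rfl
  have : IsScalarTower K (MvPolynomial (Fin d) K) R :=
    IsScalarTower.of_algebraMap_eq fun c => (f.commutes c).symm
  have : IsScalarTower K (MvPolynomial (Fin d) K) S := IsScalarTower.of_algebraMap_eq fun c => by
    rw [IsScalarTower.algebraMap_apply K R S, ← f.commutes c]
    rfl
  have hX : ∀ j : Fin d, algebraMap (MvPolynomial (Fin d) K) R (.X j) = y j :=
    fun j => MvPolynomial.aeval_X _ j
  have hy : ∀ j, ∃ i > 0, y j ∈ 𝒜 i := fun j => ⟨e j, he j, hye j⟩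
  have : Module.Finite (MvPolynomial (Fin d) K) R :=
    finite_of_parameters h0 hy (hm.trans Ideal.le_radical) hX
  have hbij : Function.Bijective (algebraMap (MvPolynomial (Fin d) K) R) :=
    ⟨algebraMap_injective_of_ringKrullDim hd, algebraMap_surjective_of_generators h0 hy hm hX⟩
  have : Fact (ringChar K).Prime :=
    ⟨(CharP.char_is_prime_or_zero K (ringChar K)).resolve_right hchar⟩
  have : CharP S (ringChar K) := charP_of_injective_algebraMap (algebraMap K S).injective _
  exact h.isDirectSummandOf (ringChar K) (ℬ := ℬ) hX hbij hinj (fun j => hdeg _ _ (hye j)) he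

end GradedSetting

end

/-! ### The graded dual as a graded injective hull of the residue field. -/

section

open GradedAlgebra DirectSum

section GradedDual

variable {K R : Type u} [Field K] [CommRing R] [Algebra K R] (𝒜 : ℕ → Submodule K R)

/-- The functionals on `R` that vanish in all sufficiently large degrees. -/
def gradedDualSubmodule : Submodule K (Module.Dual K R) where
  carrier := {f | ∃ N, ∀ i ≥ N, ∀ x ∈ 𝒜 i, f x = 0}
  zero_mem' := ⟨0, fun _ _ _ _ => rfl⟩
  add_mem' := by
    rintro f g ⟨N, hN⟩ ⟨N', hN'⟩
    refine ⟨max N N', fun i hi x hx => ?_⟩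
    rw [LinearMap.add_apply, hN i (le_of_max_le_left hi) x hx, hN' i (le_of_max_le_right hi) x hx,
      add_zero]
  smul_mem' := by
    rintro c f ⟨N, hN⟩
    exact ⟨N, fun i hi x hx => by rw [LinearMap.smul_apply, hN i hi x hx, smul_zero]⟩

/-- The graded `K`-dual of `R`. -/
def GradedDual : Type u := gradedDualSubmodule 𝒜

namespace GradedDual

instance : AddCommGroup (GradedDual 𝒜) := inferInstanceAs (AddCommGroup (gradedDualSubmodule 𝒜))

variable {𝒜}

/-- The functional underlying an element of the graded dual. -/
def toDual (f : GradedDual 𝒜) : Module.Dual K R := f.1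

@[simp] lemma toDual_add (f g : GradedDual 𝒜) : (f + g).toDual = f.toDual + g.toDual := rfl

@[simp] lemma toDual_zero : (0 : GradedDual 𝒜).toDual = 0 := rfl

lemma toDual_injective : Function.Injective (toDual : GradedDual 𝒜 → Module.Dual K R) :=
  Subtype.val_injective

variable [GradedAlgebra 𝒜]

lemma dual_ext {f g : Module.Dual K R} (h : ∀ i, ∀ x ∈ 𝒜 i, f x = g x) : f = g := by
  ext x
  obtain ⟨s, hs⟩ := exists_eq_sum_proj 𝒜 x
  rw [hs, map_sum, map_sum]
  exact Finset.sum_congr rfl fun i _ => h i _ (proj_mem 𝒜 i x)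

lemma comp_mulLeft_mem {f : Module.Dual K R} (hf : f ∈ gradedDualSubmodule 𝒜) (r : R) :
    f.comp (LinearMap.mulLeft K r) ∈ gradedDualSubmodule 𝒜 := by
  obtain ⟨N, hN⟩ := hf
  refine ⟨N, fun i hi x hx => ?_⟩
  obtain ⟨s, hs⟩ := exists_eq_sum_proj 𝒜 r
  rw [LinearMap.comp_apply, LinearMap.mulLeft_apply, hs, Finset.sum_mul, map_sum]
  exact Finset.sum_eq_zero fun n _ =>
    hN (n + i) (by omega) _ (SetLike.mul_mem_graded (proj_mem 𝒜 n r) hx)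

instance : Module R (GradedDual 𝒜) where
  smul r f := ⟨f.toDual.comp (LinearMap.mulLeft K r), comp_mulLeft_mem f.2 r⟩
  one_smul f := toDual_injective (LinearMap.ext fun x => congrArg f.toDual (one_mul x))
  mul_smul r s f := toDual_injective (LinearMap.ext fun x =>
    congrArg f.toDual (show r * s * x = s * (r * x) by ring))
  smul_zero _ := rfl
  smul_add _ _ _ := rfl
  add_smul r s f := toDual_injective (LinearMap.ext fun x =>
    (congrArg f.toDual (add_mul r s x)).trans (map_add f.toDual _ _))
  zero_smul f := toDual_injective (LinearMap.ext fun x =>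
    (congrArg f.toDual (zero_mul x)).trans (map_zero f.toDual))

@[simp] lemma toDual_smul (r : R) (f : GradedDual 𝒜) (x : R) :
    (r • f).toDual x = f.toDual (r * x) := rfl

variable (𝒜) in
/-- The functionals concentrated in degree `-j` of `R`. -/
def grading (j : ℤ) : AddSubgroup (GradedDual 𝒜) where
  carrier := {f | ∀ i : ℕ, (i : ℤ) ≠ -j → ∀ x ∈ 𝒜 i, f.toDual x = 0}
  zero_mem' := fun _ _ _ _ => rfl
  add_mem' := fun {f g} hf hg i hi x hx => by
    rw [toDual_add, LinearMap.add_apply, hf i hi x hx, hg i hi x hx, add_zero]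
  neg_mem' := fun {f} hf i hi x hx => by
    have : (-f).toDual x = -f.toDual x := rfl
    rw [this, hf i hi x hx, neg_zero]

variable (𝒜) in
/-- A functional on `R`, restricted to degree `i`. -/
noncomputable def component (i : ℕ) : Module.Dual K R →+ GradedDual 𝒜 where
  toFun f := ⟨f.comp (proj 𝒜 i), i + 1, fun k hk x hx => by
    rw [LinearMap.comp_apply, proj_of_mem_ne hx (by omega), map_zero]⟩
  map_zero' := rfl
  map_add' _ _ := rfl

lemma toDual_component (i : ℕ) (f : Module.Dual K R) (x : R) :
    (component 𝒜 i f).toDual x = f (proj 𝒜 i x) := rfl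

lemma component_mem (i : ℕ) (f : Module.Dual K R) : component 𝒜 i f ∈ grading 𝒜 (-(i : ℤ)) := by
  intro k hk x hx
  rw [toDual_component, proj_of_mem_ne hx (by rintro rfl; simp at hk), map_zero]

/-- Evaluation at an element of `R`. -/
def eval (x : R) : GradedDual 𝒜 →+ K where
  toFun f := f.toDual x
  map_zero' := rfl
  map_add' _ _ := rfl

lemma isInternal_grading : DirectSum.IsInternal (grading 𝒜) := by
  classical
  constructor
  · rw [injective_iff_map_eq_zero]
    have key : ∀ (v : ⨁ j, grading 𝒜 j) (i : ℕ) (x : R), x ∈ 𝒜 i →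
        eval x (DirectSum.coeAddMonoidHom (grading 𝒜) v) = (v (-(i : ℤ)) : GradedDual 𝒜).toDual x := by
      intro v i x hx
      induction v using DirectSum.induction_on with
      | zero => simp
      | of j f =>
        rw [DirectSum.coeAddMonoidHom_of]
        by_cases h : j = -(i : ℤ)
        · subst h
          rw [DirectSum.of_eq_same]
          rfl
        · rw [DirectSum.of_eq_of_ne _ _ _ (Ne.symm h)]
          exact f.2 i (fun h' => h (by omega)) x hx
      | add v w hv hw =>
        rw [map_add, map_add, hv, hw]
        rfl
    intro v hv
    refine DFinsupp.ext fun j => Subtype.ext (toDual_injective (dual_ext (𝒜 := 𝒜) fun i x hx => ?_))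
    by_cases h : (i : ℤ) = -j
    · obtain rfl : j = -(i : ℤ) := by omega
      rw [← key v i x hx, hv, map_zero]
      rfl
    · exact (v j).2 i h x hx
  · intro f
    obtain ⟨N, hN⟩ := f.2
    refine ⟨∑ i ∈ Finset.range N,
      DirectSum.of (fun j : ℤ => grading 𝒜 j) (-(i : ℤ)) ⟨_, component_mem (𝒜 := 𝒜) i f.toDual⟩, ?_⟩
    rw [map_sum]
    simp only [DirectSum.coeAddMonoidHom_of]
    refine toDual_injective (dual_ext (𝒜 := 𝒜) fun k x hx => ?_)
    have h1 : (∑ i ∈ Finset.range N, component 𝒜 i f.toDual).toDual x =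
        ∑ i ∈ Finset.range N, f.toDual (proj 𝒜 i x) :=
      map_sum (eval x) _ _
    rw [h1]
    by_cases hk : k < N
    · rw [Finset.sum_eq_single k, proj_of_mem hx]
      · intro i _ hik
        rw [proj_of_mem_ne hx (Ne.symm hik), map_zero]
      · intro h
        exact absurd (Finset.mem_range.2 hk) h
    · rw [Finset.sum_eq_zero]
      · exact (hN k (not_lt.1 hk) x hx).symm
      · intro i hi
        rw [proj_of_mem_ne hx (by rw [Finset.mem_range] at hi; omega), map_zero]

lemma isModuleGrading : IsModuleGrading 𝒜 (grading 𝒜) where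
  isInternal := isInternal_grading
  smul_mem i j r f hr hf k hk x hx := by
    rw [toDual_smul]
    exact hf (i + k) (by push_cast; omega) _ (SetLike.mul_mem_graded hr hx)

variable (𝒜) in
-- Evaluation at `1` turns graded maps into the graded dual into `K`-functionals supported in degree
-- 0, and functionals on a subspace extend.
lemma isGradedInjective : IsGradedInjective 𝒜 (grading 𝒜) := by
  classical
  intro M N _ _ _ _ ℳ 𝒩 hM hN f g hf hinj hg
  let _ := hM.isInternal.chooseDecomposition
  let _ := hN.isInternal.chooseDecomposition
  let _ : Module K M := Module.compHom M (algebraMap K R)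
  let _ : Module K N := Module.compHom N (algebraMap K R)
  have : IsScalarTower K R M := ⟨fun c r m => by
    rw [Algebra.smul_def, mul_smul]; rfl⟩
  have : IsScalarTower K R N := ⟨fun c r m => by
    rw [Algebra.smul_def, mul_smul]; rfl⟩
  let γ : M →ₗ[K] K :=
    { toFun := fun m => (g m).toDual 1
      map_add' := fun a b => by rw [map_add]; rfl
      map_smul' := fun c m => by
        rw [← algebraMap_smul R c m, map_smul, toDual_smul, mul_one, RingHom.id_apply,
          Algebra.algebraMap_eq_smul_one, map_smul] }
  have hγ : ∀ j ≠ 0, ∀ m ∈ ℳ j, γ m = 0 := fun j hj m hm =>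
    hg j m hm 0 (by rw [Nat.cast_zero]; omega) 1 SetLike.GradedOne.one_mem
  obtain ⟨l, hl⟩ := LinearMap.exists_leftInverse_of_injective (f.restrictScalars K)
    (LinearMap.ker_eq_bot.2 hinj)
  -- Projecting to degree 0 before extending makes the extension vanish in all other degrees. This
  -- puts the induced functionals on `R` into the graded dual and makes the map preserve degrees.
  let p : N → N := fun n => (decompose 𝒩 n 0 : N)
  have hp_add : ∀ a b, p (a + b) = p a + p b := fun a b => by
    simp only [p, decompose_add]
    rfl
  have hp_smul : ∀ (c : K) n, p (c • n) = c • p n := by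
    intro c n
    induction n using DirectSum.Decomposition.inductionOn 𝒩 with
    | zero => simp [p]
    | @homogeneous j n =>
      have h1 : c • (n : N) ∈ 𝒩 j := by
        have := hN.smul_mem 0 j _ _ (algebraMap_mem_zero c) n.2
        rwa [algebraMap_smul, Nat.cast_zero, zero_add] at this
      by_cases hj : j = 0
      · subst hj
        simp only [p]
        rw [decompose_of_mem_same _ h1, decompose_of_mem_same _ n.2]
      · simp only [p]
        rw [decompose_of_mem_ne _ h1 hj, decompose_of_mem_ne _ n.2 hj, smul_zero]
    | add a b ha hb => rw [smul_add, hp_add, ha, hb, hp_add, smul_add]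
  let p' : N →ₗ[K] N := { toFun := p, map_add' := hp_add, map_smul' := hp_smul }
  let η : N →ₗ[K] K := γ.comp (l.comp p')
  have hη : ∀ j ≠ 0, ∀ n ∈ 𝒩 j, η n = 0 := fun j hj n hn => by
    have h1 : p n = 0 := decompose_of_mem_ne _ hn hj
    change γ (l (p n)) = 0
    rw [h1, map_zero, map_zero]
  have hηf : ∀ m, η (f m) = γ m := by
    intro m
    induction m using DirectSum.Decomposition.inductionOn ℳ with
    | zero => rw [map_zero, map_zero, map_zero]
    | @homogeneous j m =>
      by_cases hj : j = 0
      · subst hj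
        have h1 : p (f m) = f m := decompose_of_mem_same _ (hf 0 m m.2)
        change γ (l (p (f m))) = _
        rw [h1]
        exact congrArg γ (LinearMap.congr_fun hl (m : M))
      · rw [hη j hj _ (hf j m m.2), hγ j hj _ m.2]
    | add a b ha hb => rw [map_add, map_add, map_add, ha, hb]
  have hmem : ∀ n, η.comp ((LinearMap.toSpanSingleton R N n).restrictScalars K) ∈
      gradedDualSubmodule 𝒜 := by
    intro n
    induction n using DirectSum.Decomposition.inductionOn 𝒩 with
    | zero => exact ⟨0, fun i _ x _ => by simp⟩
    | @homogeneous j n =>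
      refine ⟨(-j).toNat + 1, fun i hi x hx => ?_⟩
      exact hη (i + j) (by omega) _ (hN.smul_mem i j x n hx n.2)
    | add a b ha hb =>
      have h1 : η.comp ((LinearMap.toSpanSingleton R N (a + b)).restrictScalars K) =
          η.comp ((LinearMap.toSpanSingleton R N a).restrictScalars K) +
          η.comp ((LinearMap.toSpanSingleton R N b).restrictScalars K) := by
        ext x
        simp [smul_add]
      rw [h1]
      exact add_mem ha hb
  let h : N →ₗ[R] GradedDual 𝒜 :=
    { toFun := fun n => ⟨_, hmem n⟩
      map_add' := fun a b => toDual_injective (LinearMap.ext fun x =>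
        (congrArg η (smul_add x a b)).trans (map_add η _ _))
      map_smul' := fun r n => toDual_injective (LinearMap.ext fun x =>
        congrArg η (show x • r • n = (r * x) • n by rw [smul_smul, mul_comm])) }
  have hh : ∀ n x, (h n).toDual x = η (x • n) := fun n x => rfl
  refine ⟨h, fun j n hn i hi x hx => ?_, LinearMap.ext fun m => toDual_injective
    (LinearMap.ext fun x => ?_)⟩
  · rw [hh]
    exact hη (i + j) (by omega) _ (hN.smul_mem i j x n hx hn)
  · rw [LinearMap.comp_apply, hh, ← map_smul, hηf]
    change (g (x • m)).toDual 1 = _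
    rw [map_smul, toDual_smul, mul_one]

variable (𝒜) in
lemma exists_augmentation [Nontrivial R] :
    ∃ ε : GradedDual 𝒜, ε ∈ grading 𝒜 0 ∧ ε.toDual 1 = 1 := by
  obtain ⟨l, hl⟩ := LinearMap.exists_leftInverse_of_injective (Algebra.linearMap K R)
    (LinearMap.ker_eq_bot.2 (algebraMap K R).injective)
  refine ⟨component 𝒜 0 l, component_mem 0 l, ?_⟩
  rw [toDual_component, proj_of_mem SetLike.GradedOne.one_mem]
  have := LinearMap.congr_fun hl 1
  simpa using this

lemma apply_eq_zero_of_mem {f : GradedDual 𝒜} {i : ℕ} {x : R} (hx : x ∈ 𝒜 i)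
    (hf : f ∈ grading 𝒜 (-(i : ℤ))) {m : R} (hm : m ∈ homogeneousMaximalIdeal 𝒜) :
    f.toDual (x * m) = 0 := by
  obtain ⟨s, hs⟩ := exists_eq_sum_proj 𝒜 m
  rw [hs, Finset.mul_sum, map_sum]
  refine Finset.sum_eq_zero fun n _ => ?_
  rcases Nat.eq_zero_or_pos n with rfl | hn
  · rw [mem_homogeneousMaximalIdeal_iff.1 hm, mul_zero, map_zero]
  · exact hf (i + n) (by push_cast; omega) _ (SetLike.mul_mem_graded hx (proj_mem 𝒜 n m))

lemma augmentation_eq_zero_iff (h0 : 𝒜 0 = 1) {ε : GradedDual 𝒜} (hε : ε ∈ grading 𝒜 0)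
    (hε1 : ε.toDual 1 = 1) {x : R} : ε.toDual x = 0 ↔ x ∈ homogeneousMaximalIdeal 𝒜 := by
  have key : ∀ m ∈ homogeneousMaximalIdeal 𝒜, ε.toDual m = 0 := fun m hm => by
    rw [← one_mul m]
    exact apply_eq_zero_of_mem SetLike.GradedOne.one_mem (i := 0) (by simpa using hε) hm
  refine ⟨fun h => ?_, key x⟩
  obtain ⟨c, hc⟩ := exists_sub_algebraMap_mem h0 x
  have h1 := key _ hc
  rw [map_sub, h, Algebra.algebraMap_eq_smul_one, map_smul, hε1, smul_eq_mul, mul_one, zero_sub,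
    neg_eq_zero] at h1
  rwa [h1, map_zero, sub_zero] at hc

/-- The socle of the graded dual. -/
lemma exists_embedding (h0 : 𝒜 0 = 1) {ε : GradedDual 𝒜} (hε : ε ∈ grading 𝒜 0)
    (hε1 : ε.toDual 1 = 1) :
    ∃ ι : (R ⧸ homogeneousMaximalIdeal 𝒜) →ₗ[R] GradedDual 𝒜,
      Function.Injective ι ∧ ∀ a, ι (Ideal.Quotient.mk _ a) = a • ε := by
  have hker : ∀ a, a • ε = 0 ↔ a ∈ homogeneousMaximalIdeal 𝒜 := by
    intro a
    constructor
    · intro h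
      rw [← augmentation_eq_zero_iff h0 hε hε1, ← mul_one a, ← toDual_smul, h]
      rfl
    · intro ha
      refine toDual_injective (LinearMap.ext fun x => ?_)
      rw [toDual_smul]
      exact (augmentation_eq_zero_iff h0 hε hε1).2 (Ideal.mul_mem_right _ _ ha)
  let ι : (R ⧸ homogeneousMaximalIdeal 𝒜) →ₗ[R] GradedDual 𝒜 :=
    (homogeneousMaximalIdeal 𝒜).liftQ (LinearMap.toSpanSingleton R _ ε) fun a ha => (hker a).2 ha
  have hι : ∀ a, ι (Ideal.Quotient.mk _ a) = a • ε := fun a => rfl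
  refine ⟨ι, ?_, hι⟩
  rw [injective_iff_map_eq_zero]
  intro a ha
  obtain ⟨a, rfl⟩ := Ideal.Quotient.mk_surjective a
  rw [hι, hker] at ha
  exact Ideal.Quotient.eq_zero_iff_mem.2 ha

/-- The graded dual of `R` is a graded injective hull of `R / 𝔪`. -/
lemma isGradedInjectiveHull [Nontrivial R] (h0 : 𝒜 0 = 1) :
    IsGradedInjectiveHull 𝒜 (grading 𝒜) where
  grading := isModuleGrading
  injective := isGradedInjective 𝒜
  essential := by
    obtain ⟨ε, hε, hε1⟩ := exists_augmentation 𝒜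
    obtain ⟨ι, hinj, hι⟩ := exists_embedding h0 hε hε1
    refine ⟨ι, hinj, fun i a ha => ?_, fun N hN hN0 => ?_⟩
    · rw [hι]
      have := isModuleGrading.smul_mem i 0 a ε ha hε
      rwa [add_zero] at this
    · obtain ⟨s, hs, rfl⟩ := hN
      obtain ⟨f, hfs, hf0⟩ : ∃ f ∈ s, f ≠ 0 := by
        by_contra h
        push Not at h
        exact hN0 (Submodule.span_eq_bot.2 h)
      obtain ⟨j, hj⟩ := hs f hfs
      obtain ⟨i, x, hx, hfx⟩ : ∃ i, ∃ x ∈ 𝒜 i, f.toDual x ≠ 0 := by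
        by_contra h
        push Not at h
        exact hf0 (toDual_injective (dual_ext (𝒜 := 𝒜) h))
      obtain rfl : j = -(i : ℤ) := by
        by_contra h
        exact hfx (hj i (by omega) x hx)
      -- As `f` lives in the degree dual to that of `x`, it kills `x 𝔪`; hence `x • f` is `f(x)`
      -- times the socle generator `ε`.
      have h1 : x • f = ι (Ideal.Quotient.mk _ (algebraMap K R (f.toDual x))) := by
        rw [hι]
        refine toDual_injective (LinearMap.ext fun y => ?_)
        obtain ⟨c, hc⟩ := exists_sub_algebraMap_mem (𝒜 := 𝒜) h0 y
        have h2 := apply_eq_zero_of_mem hx hj hc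
        have h3 := (augmentation_eq_zero_iff h0 hε hε1).2 hc
        rw [mul_sub, map_sub, sub_eq_zero, mul_comm x (algebraMap K R c), ← Algebra.smul_def,
          map_smul, smul_eq_mul] at h2
        rw [map_sub, sub_eq_zero, Algebra.algebraMap_eq_smul_one, map_smul, hε1, smul_eq_mul,
          mul_one] at h3
        rw [toDual_smul, toDual_smul, h2, ← Algebra.smul_def, map_smul, h3, smul_eq_mul, mul_comm]
      intro hbot
      have h4 : x • f ∈ (⊥ : Submodule R (GradedDual 𝒜)) := by
        rw [← hbot]
        exact ⟨Submodule.smul_mem _ _ (Submodule.subset_span hfs), h1 ▸ LinearMap.mem_range_self _ _⟩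
      have h5 : (x • f).toDual 1 = 0 := by
        rw [(Submodule.mem_bot R).1 h4]
        rfl
      rw [toDual_smul, mul_one] at h5
      exact hfx h5

end GradedDual

end GradedDual

end

/-! ### From nonvanishing on the socle to a splitting. -/

section

open GradedAlgebra DirectSum

section FiniteDimensional

variable {K R : Type u} [Field K] [CommRing R] [Algebra K R] {𝒜 : ℕ → Submodule K R}
  [GradedAlgebra 𝒜]

lemma proj_eq_zero_of_mem_pow {n : ℕ} {x : R} (hx : x ∈ homogeneousMaximalIdeal 𝒜 ^ n) :
    ∀ i < n, proj 𝒜 i x = 0 := by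
  induction n generalizing x with
  | zero => intro i hi; omega
  | succ n ih =>
    rw [pow_succ] at hx
    refine Submodule.mul_induction_on hx (fun a ha b hb i hi => ?_) fun a b ha hb i hi => by
      rw [map_add, ha i hi, hb i hi, add_zero]
    rw [proj_mul]
    refine Finset.sum_eq_zero fun kl hkl => ?_
    rw [Finset.HasAntidiagonal.mem_antidiagonal] at hkl
    rcases Nat.eq_zero_or_pos kl.2 with h | h
    · rw [h, mem_homogeneousMaximalIdeal_iff.1 hb, mul_zero]
    · rw [ih ha _ (by omega), zero_mul]

/-- Elements of `𝔪^(n+1)` have no component in degree `n`, so this component embeds in the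
finite-dimensional quotient by that power. -/
lemma finite_homogeneous_component (h0 : 𝒜 0 = 1) [Algebra.FiniteType K R] (n : ℕ) :
    Module.Finite K (𝒜 n) := by
  have := finite_quotient_of_le_radical (I := homogeneousMaximalIdeal 𝒜 ^ (n + 1)) h0
    (by rw [Ideal.radical_pow _ n.succ_ne_zero]; exact Ideal.le_radical)
  refine Module.Finite.of_injective
    ((Ideal.Quotient.mkₐ K (homogeneousMaximalIdeal 𝒜 ^ (n + 1))).toLinearMap.comp (𝒜 n).subtype) ?_
  rw [injective_iff_map_eq_zero]
  intro x hx
  have h1 := proj_eq_zero_of_mem_pow (Ideal.Quotient.eq_zero_iff_mem.1 hx) n n.lt_succ_self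
  rw [Submodule.coe_subtype, proj_of_mem x.2] at h1
  exact Subtype.ext h1

end FiniteDimensional

section Splitting

open GradedDual

variable {K R S : Type u} [Field K] [CommRing R] [CommRing S] [Nontrivial R]
  [Algebra K R] [Algebra K S] [Algebra R S] [IsScalarTower K R S]
  {𝒜 : ℕ → Submodule K R} [GradedAlgebra 𝒜] {ℬ : ℕ → Submodule K S} [GradedAlgebra ℬ]

omit [Nontrivial R] in
-- Reflexivity of the finite-dimensional space `𝒜 i`: functionals on its dual are evaluations.
lemma exists_homogeneous_representative (i : ℕ) [Module.Finite K (𝒜 i)]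
    (Λ : GradedDual 𝒜 →+ K) (hΛ : ∀ (c : K) f, Λ (algebraMap K R c • f) = c * Λ f) :
    ∃ r ∈ 𝒜 i, ∀ f ∈ grading 𝒜 (-(i : ℤ)), f.toDual r = Λ f := by
  let π : R →ₗ[K] 𝒜 i := (proj 𝒜 i).codRestrict (𝒜 i) (proj_mem 𝒜 i)
  have hπ : ∀ x (hx : x ∈ 𝒜 i), π x = ⟨x, hx⟩ := fun x hx => Subtype.ext (proj_of_mem hx)
  let Ξ : Module.Dual K (Module.Dual K (𝒜 i)) :=
    { toFun := fun ξ => Λ (component 𝒜 i (ξ.comp π))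
      map_add' := fun ξ ξ' => by
        rw [LinearMap.add_comp, map_add, map_add]
      map_smul' := fun c ξ => by
        rw [RingHom.id_apply, smul_eq_mul, ← hΛ]
        refine congrArg Λ (toDual_injective (dual_ext (𝒜 := 𝒜) fun k x hx => ?_))
        rw [GradedDual.toDual_smul, toDual_component, toDual_component, ← Algebra.smul_def, map_smul, map_smul]
        rfl }
  refine ⟨(Module.evalEquiv K (𝒜 i)).symm Ξ, SetLike.coe_mem _, fun f hf => ?_⟩
  let ξ : Module.Dual K (𝒜 i) := f.toDual.comp (𝒜 i).subtype
  have h1 : ξ ((Module.evalEquiv K (𝒜 i)).symm Ξ) = Ξ ξ := Module.apply_evalEquiv_symm_apply K _ ξ Ξ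
  refine h1.trans (congrArg Λ (toDual_injective (dual_ext (𝒜 := 𝒜) fun k x hx => ?_)))
  rw [toDual_component]
  by_cases hk : k = i
  · subst hk
    rw [LinearMap.comp_apply, proj_of_mem hx, hπ x hx]
    rfl
  · rw [proj_of_mem_ne hx hk, map_zero, hf k (by omega) x hx]

omit [Nontrivial R] in
lemma eq_of_forall_grading {i : ℕ} {r r' : R} (hr : r ∈ 𝒜 i) (hr' : r' ∈ 𝒜 i)
    (h : ∀ f ∈ grading 𝒜 (-(i : ℤ)), f.toDual r = f.toDual r') : r = r' := by
  rw [← sub_eq_zero]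
  by_contra hne
  obtain ⟨g, hg⟩ : ∃ g : Module.Dual K R, g (r - r') ≠ 0 := by
    by_contra hc
    push Not at hc
    exact hne ((Module.forall_dual_apply_eq_zero_iff K _).1 hc)
  have h1 := h _ (component_mem i g)
  rw [toDual_component, toDual_component, proj_of_mem hr, proj_of_mem hr'] at h1
  exact hg (by rw [map_sub, h1, sub_self])

omit [Nontrivial R] in
lemma isDirectSummandOf_of_tmul_ne_zero (h0 : 𝒜 0 = 1) [Algebra.FiniteType K R]
    (hdeg : ∀ (i : ℕ) (a : R), a ∈ 𝒜 i → algebraMap R S a ∈ ℬ i)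
    {ε : GradedDual 𝒜} (hε : ε ∈ grading 𝒜 0) (hne : (1 : S) ⊗ₜ[R] ε ≠ 0) :
    IsDirectSummandOf R S := by
  classical
  have hfd := finite_homogeneous_component (𝒜 := 𝒜) h0
  obtain ⟨l, hl⟩ : ∃ l : Module.Dual K (S ⊗[R] GradedDual 𝒜), l ((1 : S) ⊗ₜ[R] ε) ≠ 0 := by
    by_contra hc
    push Not at hc
    exact hne ((Module.forall_dual_apply_eq_zero_iff K _).1 hc)
  have hlsmul : ∀ (c : K) (s : S) f, l (s ⊗ₜ[R] (algebraMap K R c • f)) = c * l (s ⊗ₜ[R] f) := by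
    intro c s f
    rw [TensorProduct.tmul_smul, algebraMap_smul, map_smul, smul_eq_mul]
  have hex : ∀ (i : ℕ) (s : S), ∃ r ∈ 𝒜 i, ∀ f ∈ grading 𝒜 (-(i : ℤ)),
      f.toDual r = l (s ⊗ₜ[R] f) := fun i s =>
    exists_homogeneous_representative i
      (l.toAddMonoidHom.comp (TensorProduct.mk R S (GradedDual 𝒜) s).toAddMonoidHom)
      (fun c f => hlsmul c s f)
  choose ρ hρ hρl using hex
  let ρ' : ∀ i, ℬ i →+ R := fun i =>
    { toFun := fun s => ρ i s
      map_zero' := eq_of_forall_grading (hρ i _) (zero_mem _) fun f hf => by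
        rw [hρl i _ f hf, ZeroMemClass.coe_zero, TensorProduct.zero_tmul, map_zero, map_zero]
      map_add' := fun a b => eq_of_forall_grading (hρ i _) (add_mem (hρ i _) (hρ i _))
        fun f hf => by
          rw [map_add, hρl i _ f hf, hρl i _ f hf, hρl i _ f hf, Submodule.coe_add,
            TensorProduct.add_tmul, map_add] }
  let φ₀ : S → R := fun s => DirectSum.toAddMonoid ρ' (decompose ℬ s)
  have hadd : ∀ a b, φ₀ (a + b) = φ₀ a + φ₀ b := fun a b => by
    simp only [φ₀, decompose_add, map_add]
  have hzero : φ₀ 0 = 0 := by simp only [φ₀, decompose_zero, map_zero]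
  have hφ₀ : ∀ i (s : S), s ∈ ℬ i → φ₀ s = ρ i s := fun i s hs => by
    simp only [φ₀]
    rw [decompose_of_mem ℬ hs, DirectSum.toAddMonoid_of]
    rfl
  have hsmul : ∀ (r : R) (s : S), φ₀ (r • s) = r * φ₀ s := by
    intro r s
    induction s using DirectSum.Decomposition.inductionOn ℬ with
    | zero => rw [smul_zero, hzero, mul_zero]
    | add a b ha hb => rw [smul_add, hadd, ha, hb, hadd, mul_add]
    | @homogeneous i s =>
      induction r using DirectSum.Decomposition.inductionOn 𝒜 with
      | zero => rw [zero_smul, hzero, zero_mul]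
      | add a b ha hb => rw [add_smul, hadd, ha, hb, add_mul]
      | @homogeneous k r =>
        have hrs : (r : R) • (s : S) ∈ ℬ (k + i) := by
          rw [Algebra.smul_def]
          exact SetLike.mul_mem_graded (hdeg k r r.2) s.2
        rw [hφ₀ _ _ hrs, hφ₀ _ _ s.2]
        -- Linearity is tested against functionals `f`: both sides come to the same value because
        -- `(r s) ⊗ f = s ⊗ (r f)`.
        refine eq_of_forall_grading (hρ _ _) (SetLike.mul_mem_graded r.2 (hρ _ _)) fun f hf => ?_
        have h1 : (r : R) • f ∈ grading 𝒜 (-(i : ℤ)) := by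
          have := isModuleGrading.smul_mem k _ (r : R) f r.2 hf
          rwa [show (k : ℤ) + -((k + i : ℕ) : ℤ) = -(i : ℤ) by push_cast; ring] at this
        rw [hρl _ _ f hf, ← GradedDual.toDual_smul, hρl _ _ _ h1, TensorProduct.smul_tmul]
  -- The image of `1` is a scalar since `R_0 = K`, and it is nonzero since `ε` takes the value `l (1
  -- ⊗ ε)` on it.
  obtain ⟨c, hc⟩ := exists_algebraMap_eq h0 (hρ 0 1)
  have hc0 : c ≠ 0 := by
    rintro rfl
    rw [map_zero] at hc
    have h1 := hρl 0 1 ε (by simpa using hε)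
    rw [← hc, map_zero] at h1
    exact hl h1.symm
  let φ : S →ₗ[R] R := { toFun := φ₀, map_add' := hadd, map_smul' := hsmul }
  refine ⟨algebraMap K R c⁻¹ • φ, LinearMap.ext_ring ?_⟩
  have h2 : φ 1 = algebraMap K R c := (hφ₀ 0 1 SetLike.GradedOne.one_mem).trans hc.symm
  rw [LinearMap.comp_apply, Algebra.linearMap_apply, map_one, LinearMap.smul_apply, h2, smul_eq_mul,
    ← map_mul, inv_mul_cancel₀ hc0, map_one]
  rfl

omit [Nontrivial R] in
/-- The residue field `R / 𝔪`, concentrated in degree zero. -/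
lemma exists_isModuleGrading_quotient :
    ∃ ℳ : ℤ → AddSubgroup (R ⧸ homogeneousMaximalIdeal 𝒜), IsModuleGrading 𝒜 ℳ ∧
      ∀ j x, x ∈ ℳ j → x = 0 ∨ j = 0 := by
  classical
  let ℳ : ℤ → AddSubgroup (R ⧸ homogeneousMaximalIdeal 𝒜) := fun j => if j = 0 then ⊤ else ⊥
  have hz : ∀ x, x ∈ ℳ 0 := fun x => by simp [ℳ]
  have hmem : ∀ j x, x ∈ ℳ j → x = 0 ∨ j = 0 := by
    intro j x hx
    by_cases hj : j = 0
    · exact Or.inr hj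
    · simp only [ℳ, if_neg hj] at hx
      exact Or.inl hx
  refine ⟨ℳ, ⟨⟨?_, fun x => ⟨DirectSum.of (fun j => ℳ j) 0 ⟨x, hz x⟩, ?_⟩⟩, ?_⟩, hmem⟩
  · have key : ∀ v : ⨁ j, ℳ j, DirectSum.coeAddMonoidHom ℳ v = v 0 := by
      intro v
      induction v using DirectSum.induction_on with
      | zero => simp
      | of j x =>
        rw [DirectSum.coeAddMonoidHom_of]
        by_cases hj : j = 0
        · subst hj
          rw [DirectSum.of_eq_same]
        · rw [DirectSum.of_eq_of_ne _ _ _ (Ne.symm hj)]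
          exact (hmem j x x.2).resolve_right hj
      | add v w hv hw => rw [map_add, hv, hw]; rfl
    rw [injective_iff_map_eq_zero]
    intro v hv
    refine DFinsupp.ext fun j => Subtype.ext ?_
    by_cases hj : j = 0
    · subst hj
      exact (key v).symm.trans hv
    · exact (hmem j _ (v j).2).resolve_right hj
  · exact DirectSum.coeAddMonoidHom_of _ _ _
  · intro i j r m hr hm
    rcases hmem j m hm with rfl | rfl
    · rw [smul_zero]; exact zero_mem _
    · rcases Nat.eq_zero_or_pos i with rfl | hi
      · exact hz _
      · have h1 : r • m = 0 := by
          obtain ⟨m, rfl⟩ := Ideal.Quotient.mk_surjective m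
          exact Ideal.Quotient.eq_zero_iff_mem.2 (Ideal.mul_mem_right _ _
            (mem_homogeneousMaximalIdeal_of_mem hi hr))
        rw [h1]
        exact zero_mem _

/-- Uniqueness of hulls is not needed: a map from the graded dual to `E` that matches the two
embeddings of `R/𝔪` already transfers nonvanishing of `1 ⊗ ι 1` back to `1 ⊗ ε`. -/
lemma InjectiveAfterTensor.isDirectSummandOf (h0 : 𝒜 0 = 1) [Algebra.FiniteType K R]
    (hdeg : ∀ (i : ℕ) (a : R), a ∈ 𝒜 i → algebraMap R S a ∈ ℬ i)
    {E : Type u} [AddCommGroup E] [Module R E] {ℰ : ℤ → AddSubgroup E}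
    (hE : IsGradedInjectiveHull 𝒜 ℰ) (h : InjectiveAfterTensor R S E) : IsDirectSummandOf R S := by
  obtain ⟨ε, hε, hε1⟩ := exists_augmentation 𝒜
  obtain ⟨ι', hι', hι'a⟩ := exists_embedding h0 hε hε1
  obtain ⟨ι, hι, hιdeg, -⟩ := hE.essential
  obtain ⟨ℳ, hℳ, hℳ0⟩ := exists_isModuleGrading_quotient (𝒜 := 𝒜)
  have hscalar : ∀ x : R ⧸ homogeneousMaximalIdeal 𝒜, ∃ c : K,
      x = Ideal.Quotient.mk _ (algebraMap K R c) := by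
    intro x
    obtain ⟨x, rfl⟩ := Ideal.Quotient.mk_surjective x
    obtain ⟨c, hc⟩ := exists_sub_algebraMap_mem (𝒜 := 𝒜) h0 x
    exact ⟨c, Ideal.Quotient.eq.2 hc⟩
  have hgr' : IsGradedHom ℳ (grading 𝒜) ι' := by
    intro j x hx
    rcases hℳ0 j x hx with rfl | rfl
    · rw [map_zero]; exact zero_mem _
    · obtain ⟨c, rfl⟩ := hscalar x
      rw [hι'a]
      have := isModuleGrading.smul_mem 0 0 _ ε (algebraMap_mem_zero (𝒜 := 𝒜) c) hε
      simpa using this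
  have hgr : IsGradedHom ℳ ℰ ι := by
    intro j x hx
    rcases hℳ0 j x hx with rfl | rfl
    · rw [map_zero]; exact zero_mem _
    · obtain ⟨c, rfl⟩ := hscalar x
      exact hιdeg 0 _ (algebraMap_mem_zero c)
  obtain ⟨g, -, hg⟩ := hE.injective _ _ ℳ (grading 𝒜) hℳ isModuleGrading ι' ι hgr' hι' hgr
  refine isDirectSummandOf_of_tmul_ne_zero (ℬ := ℬ) h0 hdeg hε fun hzero => ?_
  have hgε : g ε = ι 1 := by
    rw [← hg, LinearMap.comp_apply]
    congr 1
    have := hι'a 1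
    rw [one_smul] at this
    exact this.symm
  have h1 : (1 : S) ⊗ₜ[R] ι 1 = 0 := by
    have := congrArg (LinearMap.lTensor S g) hzero
    rwa [LinearMap.lTensor_tmul, map_zero, hgε] at this
  have h2 : (1 : R) ⊗ₜ[R] ι 1 = 0 := by
    refine h ?_
    rw [LinearMap.rTensor_tmul, Algebra.linearMap_apply, map_one, h1, map_zero]
  have h3 : ι 1 = 0 := by
    have := congrArg (TensorProduct.lid R E) h2
    rwa [TensorProduct.lid_tmul, map_zero, one_smul] at this
  have h4 : (1 : R ⧸ homogeneousMaximalIdeal 𝒜) = 0 := hι (h3.trans (map_zero ι).symm)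
  exact homogeneousMaximalIdeal_ne_top (𝒜 := 𝒜)
    ((Ideal.eq_top_iff_one _).2 (Ideal.Quotient.eq_zero_iff_mem.1 h4))

end Splitting

section DirectSummand

variable {R S : Type u} [CommRing R] [CommRing S] [Algebra R S]

lemma IsDirectSummandOf.isPureMap (h : IsDirectSummandOf R S) : IsPureMap R S := by
  obtain ⟨φ, hφ⟩ := h
  intro M _ _
  refine Function.LeftInverse.injective (g := LinearMap.rTensor M φ) fun x => ?_
  rw [← LinearMap.comp_apply, ← LinearMap.rTensor_comp, hφ, LinearMap.rTensor_id]
  rfl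

lemma IsDirectSummandOf.isSolidAlgebra [Nontrivial R] (h : IsDirectSummandOf R S) :
    IsSolidAlgebra R S := by
  obtain ⟨φ, hφ⟩ := h
  refine ⟨φ, ?_⟩
  rintro rfl
  exact one_ne_zero (LinearMap.congr_fun hφ (1 : R)).symm

end DirectSummand

end

/-! ### The equivalences assembled. -/

theorem theorem2p1
    {K R S : Type u} [Field K] [CommRing R] [CommRing S] [Nontrivial R]
    [Algebra K R] [Algebra K S] [Algebra R S] [IsScalarTower K R S]
    (𝒜 : ℕ → Submodule K R) [GradedAlgebra 𝒜] (ℬ : ℕ → Submodule K S) [GradedAlgebra ℬ]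
    -- `R` and `S` are finitely generated over the field `K = R₀ = S₀`, and are normal
    (hR0 : 𝒜 0 = 1) (hS0 : ℬ 0 = 1)
    (hRfin : Algebra.FiniteType K R) (hSfin : Algebra.FiniteType K S)
    (hRnormal : IsNormalRing R) (hSnormal : IsNormalRing S)
    -- `R → S` is a degree-preserving inclusion
    (hinj : Function.Injective (algebraMap R S))
    (hdeg : ∀ (i : ℕ) (a : R), a ∈ 𝒜 i → algebraMap R S a ∈ ℬ i)
    (d : ℕ) (hd : ringKrullDim R = d) :
    -- the graded injective hull of `R / 𝔪` exists
    (∃ (E : Type u) (_ : AddCommGroup E) (_ : Module R E) (ℰ : ℤ → AddSubgroup E),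
      IsGradedInjectiveHull 𝒜 ℰ) ∧
    -- and for any such hull `E`:
    ∀ (E : Type u) [AddCommGroup E] [Module R E] (ℰ : ℤ → AddSubgroup E),
      IsGradedInjectiveHull 𝒜 ℰ →
      [IsDirectSummandOf R S, IsPureMap R S, InjectiveAfterTensor R S E].TFAE ∧
      (IsDirectSummandOf R S → LocalCohomologyNonzero R S (homogeneousMaximalIdeal 𝒜) d) ∧
      (LocalCohomologyNonzero R S (homogeneousMaximalIdeal 𝒜) d ↔ IsSolidAlgebra R S) ∧
      ((∃ n : ℕ, Nonempty (R ≃ₐ[K] MvPolynomial (Fin n) K)) → ringChar K ≠ 0 →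
        [IsDirectSummandOf R S, IsPureMap R S, InjectiveAfterTensor R S E,
          LocalCohomologyNonzero R S (homogeneousMaximalIdeal 𝒜) d,
          IsSolidAlgebra R S].TFAE) := by
  have hRdom : IsDomain R := isDomain_of_isNormalRing hR0 hRnormal
  have : Nontrivial S := hinj.nontrivial
  have hSdom : IsDomain S := isDomain_of_isNormalRing hS0 hSnormal
  refine ⟨⟨GradedDual 𝒜, inferInstance, inferInstance, GradedDual.grading 𝒜,
    GradedDual.isGradedInjectiveHull hR0⟩, ?_⟩
  intro E _ _ ℰ hE
  have h12 : IsDirectSummandOf R S → IsPureMap R S := fun h => h.isPureMap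
  have h23 : IsPureMap R S → InjectiveAfterTensor R S E := fun h => h E
  have h31 : InjectiveAfterTensor R S E → IsDirectSummandOf R S :=
    fun h => h.isDirectSummandOf hR0 hdeg hE
  have h45 : LocalCohomologyNonzero R S (homogeneousMaximalIdeal 𝒜) d ↔ IsSolidAlgebra R S :=
    localCohomologyNonzero_iff_isSolidAlgebra hR0 hinj hdeg hd
  have h15 : IsDirectSummandOf R S → IsSolidAlgebra R S := fun h => h.isSolidAlgebra
  refine ⟨?_, fun h => h45.2 (h15 h), h45, ?_⟩
  · tfae_have 1 → 2 := h12
    tfae_have 2 → 3 := h23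
    tfae_have 3 → 1 := h31
    tfae_finish
  · rintro ⟨n, ⟨e⟩⟩ hchar
    tfae_have 1 → 2 := h12
    tfae_have 2 → 3 := h23
    tfae_have 3 → 1 := h31
    tfae_have 4 ↔ 5 := h45
    tfae_have 1 → 5 := h15
    tfae_have 5 → 1 := fun h => h.isDirectSummandOf_of_polynomial hR0 hinj hdeg e hchar
    tfae_finish
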